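/- **Theorem 2.1.** Let $d\in\{2,3\}$, let $\Omega\subset\mathbb{R}^d$ be a non-empty open set, and let $m\ge 0$, $c>0$. Let $\sigma_1=\begin{pmatrix}0&1\\1&0\end{pmatrix}$, $\sigma_2=\begin{pmatrix}0&-i\\i&0\end{pmatrix}$, $\sigma_3=\begin{pmatrix}1&0\\0&-1\end{pmatrix}$ be the Pauli matrices, let $I_2$ be the $2\times 2$ identity matrix, and let $H^1_0(\Omega)$ be the closure of $C_0^\infty(\Omega)$ in $H^1(\Omega)$; all derivatives below are distributional. The Dirac operator $H_{m,\Omega}$ with zigzag boundary conditions is, for $d=2$, the operator in $L^2(\Omega;\mathbb{C}^2)$ given by $$H_{m,\Omega}f=\begin{pmatrix}mc^2&-ic(\partial_1-i\partial_2)\\-ic(\partial_1+i\partial_2)&-mc^2\end{pmatrix}f,\qquad \operatorname{dom}H_{m,\Omega}=\{(f_1,f_2)\in L^2(\Omega;\mathbb{C}^2):(\partial_1+i\partial_2)f_1\in L^2(\Omega),\ f_2\in H^1_0(\Omega)\},$$ and, for $d=3$, with $\sigma\cdot\nabla=\sigma_1\partial_1+\sigma_2\partial_2+\sigma_3\partial_3$,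 the operator in $L^2(\Omega;\mathbb{C}^4)$ given by $$H_{m,\Omega}f=\begin{pmatrix}mc^2I_2&-ic\,\sigma\cdot\nabla\\-ic\,\sigma\cdot\nabla&-mc^2I_2\end{pmatrix}f,\qquad \operatorname{dom}H_{m,\Omega}=\{(f_1,f_2)\in L^2(\Omega;\mathbb{C}^2\oplus\mathbb{C}^2):(\sigma\cdot\nabla)f_1\in L^2(\Omega;\mathbb{C}^2),\ f_2\in H^1_0(\Omega;\mathbb{C}^2)\}.$$ Let $-\Delta_D^\Omega$ be the Dirichlet Laplacian in $L^2(\Omega)$, i.e. the operator associated with the quadratic form $u\mapsto\int_\Omega|\nabla u|^2$ on $H^1_0(\Omega)$. Then $H_{m,\Omega}$ is self-adjoint, its spectrum is $$\sigma(H_{m,\Omega})=\{mc^2\}\cup\bigl\{\pm c\sqrt{\lambda+(mc)^2}:\lambda\in\sigma(-\Delta_D^\Omega)\bigr\},$$ and the following hold. (i) $mc^2\in\sigma_{\mathrm{ess}}(H_{m,\Omega})$, where the essential spectrum is the spectrum without the isolated eigenvalues of finite multiplicity. (ii) If $m\ne 0$, then $-mc^2$ is not an eigenvalue of $H_{m,\Omega}$.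 (iii) Let $r=1$ if $d=2$ and $r=2$ if $d=3$. For every $\lambda>0$, for each of the two numbers $E=\pm c\sqrt{\lambda+(mc)^2}$ and for every $k\in\{1,2,\dots\}\cup\{\infty\}$, $E$ is an eigenvalue of $H_{m,\Omega}$ of multiplicity $rk$ if and only if $\lambda$ is an eigenvalue of $-\Delta_D^\Omega$ of multiplicity $k$; moreover, $E$ is an eigenvalue of $H_{m,\Omega}$ if and only if $\lambda$ is an eigenvalue of $-\Delta_D^\Omega$. -/

import Mathlib

open MeasureTheory TopologicalSpace
open scoped Distributions

noncomputable section

namespace Zigzag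

/-! ### Unbounded operators: resolvent, spectrum, eigenvalues, essential spectrum -/

section Operators

variable {E : Type*} [NormedAddCommGroup E] [InnerProductSpace ℂ E]

/-- `z` is in the resolvent set of `T`: the operator `T - z : dom T → E` is a bijection whose
inverse `R` is bounded and everywhere defined. -/
def IsResolventPoint (T : E →ₗ.[ℂ] E) (z : ℂ) : Prop :=
  ∃ R : E →L[ℂ] E,
    (∀ x : E, ∃ h : R x ∈ T.domain, T ⟨R x, h⟩ - z • R x = x) ∧
    (∀ x : T.domain, R (T x - z • (x : E)) = x)

/-- The spectrum of an unbounded operator. -/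
def spectrum (T : E →ₗ.[ℂ] E) : Set ℂ :=
  {z | ¬ IsResolventPoint T z}

/-- The eigenspace `ker (T - z)`, as a subspace of `E`. -/
def eigenspace (T : E →ₗ.[ℂ] E) (z : ℂ) : Submodule ℂ E where
  carrier := {x | ∃ h : x ∈ T.domain, T ⟨x, h⟩ = z • x}
  zero_mem' := ⟨T.domain.zero_mem, by
    have : (⟨0, T.domain.zero_mem⟩ : T.domain) = 0 := rfl
    rw [this, T.map_zero, smul_zero]⟩
  add_mem' := by
    rintro x y ⟨hx, ex⟩ ⟨hy, ey⟩
    refine ⟨T.domain.add_mem hx hy, ?_⟩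
    have : (⟨x + y, T.domain.add_mem hx hy⟩ : T.domain) = ⟨x, hx⟩ + ⟨y, hy⟩ := rfl
    rw [this, T.map_add, ex, ey, smul_add]
  smul_mem' := by
    rintro a x ⟨hx, ex⟩
    refine ⟨T.domain.smul_mem a hx, ?_⟩
    have : (⟨a • x, T.domain.smul_mem a hx⟩ : T.domain) = a • ⟨x, hx⟩ := rfl
    rw [this, T.map_smul, ex, smul_comm]

/-- The point spectrum (set of eigenvalues). -/
def pointSpectrum (T : E →ₗ.[ℂ] E) : Set ℂ :=
  {z | eigenspace T z ≠ ⊥}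

/-- The multiplicity `dim ker (T - z)`, with values in `{0, 1, 2, …, ∞}`. -/
def multiplicity (T : E →ₗ.[ℂ] E) (z : ℂ) : ℕ∞ :=
  Cardinal.toENat (Module.rank ℂ (eigenspace T z))

/-- The discrete spectrum: the isolated points of the spectrum that are eigenvalues of finite
multiplicity. -/
def discreteSpectrum (T : E →ₗ.[ℂ] E) : Set ℂ :=
  {z | z ∈ pointSpectrum T ∧ multiplicity T z < ⊤ ∧ ∃ ε > 0, spectrum T ∩ Metric.ball z ε = {z}}

/-- The essential spectrum (of a self-adjoint operator): the complement of the discrete spectrum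
in the spectrum. -/
def essentialSpectrum (T : E →ₗ.[ℂ] E) : Set ℂ :=
  spectrum T \ discreteSpectrum T

end Operators

/-! ### Function spaces and weak derivatives -/

/-- Euclidean space `ℝᵈ`. -/
abbrev Euc (d : ℕ) := EuclideanSpace ℝ (Fin d)

/-- `L²(Ω; V)` with respect to Lebesgue measure. -/
abbrev L2 {d : ℕ} (Ω : Opens (Euc d)) (V : Type*) [NormedAddCommGroup V] :=
  Lp V 2 (volume.restrict (Ω : Set (Euc d)))

/-- The classical partial derivative `∂ⱼ φ`. -/
def pderiv {d : ℕ} {V : Type*} [NormedAddCommGroup V] [NormedSpace ℝ V] (j : Fin d)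
    (φ : Euc d → V) (x : Euc d) : V :=
  fderiv ℝ φ x (EuclideanSpace.single j 1)

section Weak

variable {d : ℕ} (Ω : Opens (Euc d))
variable {V W : Type*} [NormedAddCommGroup V] [NormedSpace ℂ V]
  [NormedAddCommGroup W] [NormedSpace ℂ W]

theorem memLp_test (φ : 𝓓(Ω, V)) : MemLp φ 2 (volume.restrict (Ω : Set (Euc d))) :=
  φ.continuous.memLp_of_hasCompactSupport φ.hasCompactSupport

theorem continuous_pderiv (φ : 𝓓(Ω, V)) (j : Fin d) : Continuous (pderiv j φ) :=
  (φ.contDiff.continuous_fderiv (by simp)).clm_apply continuous_const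

theorem hasCompactSupport_pderiv (φ : 𝓓(Ω, V)) (j : Fin d) : HasCompactSupport (pderiv j φ) :=
  φ.hasCompactSupport.fderiv_apply ℝ _

theorem memLp_pderiv (φ : 𝓓(Ω, V)) (j : Fin d) :
    MemLp (pderiv j φ) 2 (volume.restrict (Ω : Set (Euc d))) :=
  (continuous_pderiv Ω φ j).memLp_of_hasCompactSupport (hasCompactSupport_pderiv Ω φ j)

theorem integrable_smul_of_memLp {ψ : Euc d → ℂ}
    (hψ : MemLp ψ 2 (volume.restrict (Ω : Set (Euc d)))) (f : L2 Ω V) :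
    IntegrableOn (fun x => ψ x • f x) Ω :=
  memLp_one_iff_integrable.1 (MemLp.smul (p := 2) (q := 2) (r := 1) (Lp.memLp f) hψ)

theorem integrable_smul_clm {ψ : Euc d → ℂ}
    (hψ : MemLp ψ 2 (volume.restrict (Ω : Set (Euc d)))) (L : V →L[ℂ] W) (f : L2 Ω V) :
    IntegrableOn (fun x => ψ x • L (f x)) Ω :=
  memLp_one_iff_integrable.1
    (MemLp.smul (p := 2) (q := 2) (r := 1) (L.comp_memLp' (Lp.memLp f)) hψ)

/-- The set of pairs `(f, g)` in `L²(Ω; V) × L²(Ω; W)` such that `∑ⱼ Aⱼ ∂ⱼ f = g` in the sense of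
distributions on `Ω`, i.e. when tested with all `φ ∈ C₀^∞(Ω)`. -/
def weakGraph (A : Fin d → V →L[ℂ] W) : Submodule ℂ (L2 Ω V × L2 Ω W) where
  carrier := {p | ∀ φ : 𝓓(Ω, ℂ),
    ∑ j, ∫ x in Ω, pderiv j φ x • A j (p.1 x) = -∫ x in Ω, φ x • p.2 x}
  zero_mem' := by
    intro φ
    have h1 : ∀ j, ∫ x in Ω, pderiv j φ x • A j ((0 : L2 Ω V) x) = 0 := fun j =>
      integral_eq_zero_of_ae <| by
        filter_upwards [Lp.coeFn_zero V 2 (volume.restrict (Ω : Set (Euc d)))] with x hx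
        rw [hx, Pi.zero_apply, map_zero, smul_zero, Pi.zero_apply]
    have h2 : ∫ x in Ω, φ x • (0 : L2 Ω W) x = 0 :=
      integral_eq_zero_of_ae <| by
        filter_upwards [Lp.coeFn_zero W 2 (volume.restrict (Ω : Set (Euc d)))] with x hx
        rw [hx, Pi.zero_apply, smul_zero]
    simp only [Prod.fst_zero, Prod.snd_zero, h1, h2, Finset.sum_const_zero, neg_zero]
  add_mem' := by
    rintro p q hp hq φ
    have h1 : ∀ j, ∫ x in Ω, pderiv j φ x • A j ((p.1 + q.1 : L2 Ω V) x) =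
        (∫ x in Ω, pderiv j φ x • A j (p.1 x)) +
          ∫ x in Ω, pderiv j φ x • A j (q.1 x) := fun j => by
      rw [← integral_add (integrable_smul_clm Ω (memLp_pderiv Ω φ j) _ _)
        (integrable_smul_clm Ω (memLp_pderiv Ω φ j) _ _)]
      refine integral_congr_ae ?_
      filter_upwards [Lp.coeFn_add p.1 q.1] with x hx
      rw [hx, Pi.add_apply, map_add, smul_add]
    have h2 : ∫ x in Ω, φ x • (p.2 + q.2 : L2 Ω W) x =
        (∫ x in Ω, φ x • p.2 x) + ∫ x in Ω, φ x • q.2 x := by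
      rw [← integral_add (integrable_smul_of_memLp Ω (memLp_test Ω φ) _)
        (integrable_smul_of_memLp Ω (memLp_test Ω φ) _)]
      refine integral_congr_ae ?_
      filter_upwards [Lp.coeFn_add p.2 q.2] with x hx
      rw [hx, Pi.add_apply, smul_add]
    simp only [Prod.fst_add, Prod.snd_add, h1, h2, Finset.sum_add_distrib]
    rw [hp φ, hq φ, neg_add]
  smul_mem' := by
    rintro a p hp φ
    have h1 : ∀ j, ∫ x in Ω, pderiv j φ x • A j ((a • p.1 : L2 Ω V) x) =
        a • ∫ x in Ω, pderiv j φ x • A j (p.1 x) := fun j => by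
      rw [← integral_smul]
      refine integral_congr_ae ?_
      filter_upwards [Lp.coeFn_smul a p.1] with x hx
      simp [hx, smul_comm a]
    have h2 : ∫ x in Ω, φ x • (a • p.2 : L2 Ω W) x = a • ∫ x in Ω, φ x • p.2 x := by
      rw [← integral_smul]
      refine integral_congr_ae ?_
      filter_upwards [Lp.coeFn_smul a p.2] with x hx
      simp [hx, smul_comm a]
    simp only [Prod.smul_fst, Prod.smul_snd, h1, h2, ← Finset.smul_sum]
    rw [hp φ, smul_neg]

/-- An `L²` function that vanishes as a distribution is zero. -/
theorem eq_zero_of_test [CompleteSpace W] (g : L2 Ω W) (h : ∀ φ : 𝓓(Ω, ℂ), ∫ x in Ω, φ x • g x = 0) : g = 0 := by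
  have hg : LocallyIntegrableOn (g : Euc d → W) Ω volume :=
    locallyIntegrableOn_of_locallyIntegrable_restrict
      ((Lp.memLp g).locallyIntegrable (by norm_num))
  have key := Ω.isOpen.ae_eq_zero_of_integral_contDiff_smul_eq_zero hg fun ψ h1 h2 h3 => by
    have hs : Function.support (fun x => ((ψ x : ℝ) : ℂ)) = Function.support ψ := by
      ext x; simp
    have ht : tsupport (fun x => ((ψ x : ℝ) : ℂ)) = tsupport ψ := by
      rw [tsupport, hs, tsupport]
    have := h ⟨fun x => (ψ x : ℂ), Complex.ofRealCLM.contDiff.comp h1,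
      by rw [HasCompactSupport, ht]; exact h2, by rw [ht]; exact h3⟩
    rw [← setIntegral_eq_integral_of_forall_compl_eq_zero (s := (Ω : Set (Euc d)))]
    · exact this
    · intro x hx
      rw [image_eq_zero_of_notMem_tsupport fun h' => hx (h3 h'), zero_smul]
  refine Lp.eq_zero_iff_ae_eq_zero.2 ?_
  exact (ae_restrict_iff' Ω.isOpen.measurableSet).2 key

/-- `∑ⱼ Aⱼ ∂ⱼ f` is determined by `f`. -/
theorem weakGraph_single [CompleteSpace W] (A : Fin d → V →L[ℂ] W) :
    ∀ p ∈ weakGraph Ω A, p.1 = 0 → p.2 = 0 := by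
  rintro ⟨f, g⟩ hp (rfl : f = 0)
  refine eq_zero_of_test Ω g fun φ => ?_
  have h1 : ∀ j, ∫ x in Ω, pderiv j φ x • A j ((0 : L2 Ω V) x) = 0 := fun j =>
    integral_eq_zero_of_ae <| by
      filter_upwards [Lp.coeFn_zero V 2 (volume.restrict (Ω : Set (Euc d)))] with x hx
      rw [hx, Pi.zero_apply, map_zero, smul_zero, Pi.zero_apply]
  have := hp φ
  simp only [h1, Finset.sum_const_zero] at this
  exact neg_eq_zero.1 this.symm

/-- The maximal realization of the first order differential expression `∑ⱼ Aⱼ ∂ⱼ` as an operator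
from `L²(Ω; V)` to `L²(Ω; W)`: its domain consists of all `f ∈ L²(Ω; V)` for which the distribution
`∑ⱼ Aⱼ ∂ⱼ f` belongs to `L²(Ω; W)`. -/
def weakOp (A : Fin d → V →L[ℂ] W) : L2 Ω V →ₗ.[ℂ] L2 Ω W :=
  (weakGraph Ω A).toLinearPMap

/-- `weakOp` is given by its graph without any junk value. -/
theorem weakOp_graph [CompleteSpace W] (A : Fin d → V →L[ℂ] W) : (weakOp Ω A).graph = weakGraph Ω A :=
  Submodule.toLinearPMap_graph_eq _ (weakGraph_single Ω A)

/-- The graph `{(φ, (∂ⱼ φ)ⱼ) : φ ∈ C₀^∞(Ω; V)}` of the gradient on test functions. -/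
def testGraph (V : Type*) [NormedAddCommGroup V] [NormedSpace ℂ V] :
    Submodule ℂ (L2 Ω V × (Fin d → L2 Ω V)) where
  carrier := {p | ∃ φ : 𝓓(Ω, V), p.1 =ᵐ[volume.restrict (Ω : Set (Euc d))] φ ∧
    ∀ j, p.2 j =ᵐ[volume.restrict (Ω : Set (Euc d))] pderiv j φ}
  zero_mem' := by
    refine ⟨0, ?_, fun j => ?_⟩
    · filter_upwards [Lp.coeFn_zero V 2 (volume.restrict (Ω : Set (Euc d)))] with x hx
      rw [Prod.fst_zero, hx]
      rfl
    · filter_upwards [Lp.coeFn_zero V 2 (volume.restrict (Ω : Set (Euc d)))] with x hx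
      simp only [Prod.snd_zero, Pi.zero_apply, hx]
      simp [pderiv]
  add_mem' := by
    rintro p q ⟨φ, h1, h2⟩ ⟨ψ, k1, k2⟩
    refine ⟨φ + ψ, ?_, fun j => ?_⟩
    · filter_upwards [Lp.coeFn_add p.1 q.1, h1, k1] with x hx hx1 hx2
      rw [Prod.fst_add, hx, Pi.add_apply, hx1, hx2]
      rfl
    · filter_upwards [Lp.coeFn_add (p.2 j) (q.2 j), h2 j, k2 j] with x hx hx1 hx2
      simp only [Prod.snd_add, Pi.add_apply, hx, hx1, hx2, pderiv, FunLike.coe_add]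
      rw [fderiv_add (φ.contDiff.differentiable (by simp) x)
        (ψ.contDiff.differentiable (by simp) x)]
      rfl
  smul_mem' := by
    rintro a p ⟨φ, h1, h2⟩
    refine ⟨a • φ, ?_, fun j => ?_⟩
    · filter_upwards [Lp.coeFn_smul a p.1, h1] with x hx hx1
      simp [hx, hx1]
    · filter_upwards [Lp.coeFn_smul a (p.2 j), h2 j] with x hx hx1
      simp only [Prod.smul_snd, Pi.smul_apply, hx, hx1, pderiv, FunLike.coe_smul]
      rw [fderiv_const_smul (φ.contDiff.differentiable (by simp) x)]
      rfl

/-- The graph `{(f, ∇f) : f ∈ H¹₀(Ω; V)}`: the closure of the test functions in the norm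
`‖f‖ + ‖∇f‖` of `H¹(Ω; V)`, where an element of `H¹` is recorded together with its gradient. -/
def H10Graph (V : Type*) [NormedAddCommGroup V] [NormedSpace ℂ V] :
    Submodule ℂ (L2 Ω V × (Fin d → L2 Ω V)) :=
  (testGraph Ω V).topologicalClosure

/-- The Sobolev space `H¹₀(Ω; V)`, as a subspace of `L²(Ω; V)`. -/
def H10 (V : Type*) [NormedAddCommGroup V] [NormedSpace ℂ V] : Submodule ℂ (L2 Ω V) :=
  (H10Graph Ω V).map (LinearMap.fst ℂ _ _)

/-- The components recorded in `H10Graph` are the weak partial derivatives. -/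
theorem H10Graph_weak [CompleteSpace V] {f : L2 Ω V} {p : Fin d → L2 Ω V} (h : (f, p) ∈ H10Graph Ω V)
    (j : Fin d) (φ : 𝓓(Ω, ℂ)) :
    ∫ x in Ω, pderiv j φ x • f x = -∫ x in Ω, φ x • p j x := by
  let B := ContinuousLinearMap.lsmul ℂ ℂ (E := V)
  let P := B.lpPairing (volume.restrict (Ω : Set (Euc d))) 2 2
  have hP : ∀ (ψ : Euc d → ℂ) (hψ : MemLp ψ 2 (volume.restrict (Ω : Set (Euc d)))) (u : L2 Ω V),
      P (hψ.toLp ψ) u = ∫ x in Ω, ψ x • u x := fun ψ hψ u => by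
    rw [ContinuousLinearMap.lpPairing_eq_integral]
    refine integral_congr_ae ?_
    filter_upwards [hψ.coeFn_toLp] with x hx
    simp [B, hx]
  have hclosed : IsClosed {w : L2 Ω V × (Fin d → L2 Ω V) |
      P ((memLp_pderiv Ω φ j).toLp _) w.1 = -P ((memLp_test Ω φ).toLp _) (w.2 j)} :=
    isClosed_eq (by fun_prop) (by fun_prop)
  have hsub : (testGraph Ω V : Set (L2 Ω V × (Fin d → L2 Ω V))) ⊆ {w |
      P ((memLp_pderiv Ω φ j).toLp _) w.1 = -P ((memLp_test Ω φ).toLp _) (w.2 j)} := by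
    rintro w ⟨χ, h1, h2⟩
    simp only [Set.mem_ofPred_eq, hP]
    have e1 : ∫ x in Ω, pderiv j φ x • w.1 x = ∫ x, pderiv j φ x • χ x := by
      refine (integral_congr_ae (g := fun x => pderiv j φ x • χ x) ?_).trans
        (setIntegral_eq_integral_of_forall_compl_eq_zero ?_)
      · filter_upwards [h1] with x hx
        rw [hx]
      · intro x hx
        rw [image_eq_zero_of_notMem_tsupport fun h' => hx (χ.tsupport_subset h'), smul_zero]
    have e2 : ∫ x in Ω, φ x • w.2 j x = ∫ x, φ x • pderiv j χ x := by
      refine (integral_congr_ae (g := fun x => φ x • pderiv j χ x) ?_).trans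
        (setIntegral_eq_integral_of_forall_compl_eq_zero ?_)
      · filter_upwards [h2 j] with x hx
        rw [hx]
      · intro x hx
        rw [image_eq_zero_of_notMem_tsupport fun h' => hx (φ.tsupport_subset h'), zero_smul]
    rw [e1, e2, eq_neg_iff_add_eq_zero, add_comm, ← eq_neg_iff_add_eq_zero]
    refine integral_smul_fderiv_eq_neg_fderiv_smul_of_integrable ?_ ?_ ?_
      (fun x _ => φ.contDiff.differentiable (by simp) x)
      (fun x _ => χ.contDiff.differentiable (by simp) x)
    · exact ((continuous_pderiv Ω φ j).smul χ.continuous).integrable_of_hasCompactSupport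
        ((hasCompactSupport_pderiv Ω φ j).smul_right)
    · exact (φ.continuous.smul (continuous_pderiv Ω χ j)).integrable_of_hasCompactSupport
        (φ.hasCompactSupport.smul_right)
    · exact (φ.continuous.smul χ.continuous).integrable_of_hasCompactSupport
        (φ.hasCompactSupport.smul_right)
  have := closure_minimal hsub hclosed h
  simpa only [Set.mem_ofPred_eq, hP] using this

/-- An element of `H¹₀` determines its gradient. -/
theorem H10Graph_single [CompleteSpace V] {p : Fin d → L2 Ω V} (h : ((0 : L2 Ω V), p) ∈ H10Graph Ω V) : p = 0 := by
  funext j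
  refine eq_zero_of_test Ω _ fun φ => ?_
  have h1 : ∫ x in Ω, pderiv j φ x • (0 : L2 Ω V) x = 0 :=
    integral_eq_zero_of_ae <| by
      filter_upwards [Lp.coeFn_zero V 2 (volume.restrict (Ω : Set (Euc d)))] with x hx
      rw [hx, Pi.zero_apply, smul_zero]
  have := H10Graph_weak Ω h j φ
  rw [h1] at this
  exact neg_eq_zero.1 this.symm

end Weak

/-- The pairs `(u, g)` with `u ∈ H¹₀(Ω)`, `g ∈ L²(Ω)` and
`∫ ∇u · conj(∇v) = ∫ g conj(v)` for all `v ∈ H¹₀(Ω)`. -/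
def dirichletGraph {d : ℕ} (Ω : Opens (Euc d)) : Submodule ℂ (L2 Ω ℂ × L2 Ω ℂ) where
  carrier := {w | ∃ p, (w.1, p) ∈ H10Graph Ω ℂ ∧
    ∀ v q, (v, q) ∈ H10Graph Ω ℂ → ∑ j, inner ℂ (q j) (p j) = inner ℂ v w.2}
  zero_mem' := ⟨0, (H10Graph Ω ℂ).zero_mem, by intros; simp⟩
  add_mem' := by
    rintro x y ⟨p, hp, hp'⟩ ⟨q, hq, hq'⟩
    refine ⟨p + q, (H10Graph Ω ℂ).add_mem hp hq, fun v r hr => ?_⟩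
    simp only [Pi.add_apply, inner_add_right, Finset.sum_add_distrib, Prod.snd_add]
    rw [hp' v r hr, hq' v r hr]
  smul_mem' := by
    rintro a x ⟨p, hp, hp'⟩
    refine ⟨a • p, (H10Graph Ω ℂ).smul_mem a hp, fun v r hr => ?_⟩
    simp only [Pi.smul_apply, inner_smul_right, ← Finset.mul_sum, Prod.smul_snd]
    rw [hp' v r hr]

/-- The function `-Δ u` is determined by `u`. -/
theorem dirichletGraph_single {d : ℕ} (Ω : Opens (Euc d)) :
    ∀ w ∈ dirichletGraph Ω, w.1 = 0 → w.2 = 0 := by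
  rintro ⟨u, g⟩ ⟨p, hp, hg⟩ (rfl : u = 0)
  obtain rfl := H10Graph_single Ω hp
  refine eq_zero_of_test Ω g fun φ => ?_
  let ψ : 𝓓(Ω, ℂ) := ⟨fun x => star (φ x), Complex.conjCLE.contDiff.comp φ.contDiff,
    φ.hasCompactSupport.comp_left (g := star) (star_zero ℂ),
    (closure_mono (Function.support_comp_subset (star_zero ℂ) φ)).trans φ.tsupport_subset⟩
  have := hg ((memLp_test Ω ψ).toLp ψ) (fun j => (memLp_pderiv Ω ψ j).toLp _)
    (Submodule.le_topologicalClosure _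
      ⟨ψ, (memLp_test Ω ψ).coeFn_toLp, fun j => (memLp_pderiv Ω ψ j).coeFn_toLp⟩)
  simp only [Pi.zero_apply, inner_zero_right, Finset.sum_const_zero] at this
  rw [L2.inner_def] at this
  rw [this]
  refine integral_congr_ae ?_
  filter_upwards [(memLp_test Ω ψ).coeFn_toLp] with x hx
  rw [hx]
  simp [ψ, mul_comm]

/-- The Dirichlet Laplacian `-Δ` on `Ω`: the operator in `L²(Ω)` associated with the quadratic form
`u ↦ ∫ |∇u|²` with form domain `H¹₀(Ω)`. -/
def dirichletLaplacian {d : ℕ} (Ω : Opens (Euc d)) : L2 Ω ℂ →ₗ.[ℂ] L2 Ω ℂ :=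
  (dirichletGraph Ω).toLinearPMap

/-- `dirichletLaplacian` is given by its graph without any junk value. -/
theorem dirichletLaplacian_graph {d : ℕ} (Ω : Opens (Euc d)) :
    (dirichletLaplacian Ω).graph = dirichletGraph Ω :=
  Submodule.toLinearPMap_graph_eq _ (dirichletGraph_single Ω)

/-! ### The Dirac operators -/

/-- The Pauli matrices `σ₁, σ₂, σ₃`, indexed by `0, 1, 2`. -/
def pauli : Fin 3 → Matrix (Fin 2) (Fin 2) ℂ :=
  ![!![0, 1; 1, 0], !![0, -Complex.I; Complex.I, 0], !![1, 0; 0, -1]]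

/-- The space `ℂ²`. -/
abbrev C2 := EuclideanSpace ℂ (Fin 2)

/-- The space `ℂ⁴ = ℂ² ⊕ ℂ²`; `inl` and `inr` index the first and the last two components. -/
abbrev C4 := EuclideanSpace ℂ (Fin 2 ⊕ Fin 2)

/-- The Dirac matrices `α₁, α₂, α₃`, indexed by `0, 1, 2`. -/
def alphaMatrix (j : Fin 3) : Matrix (Fin 2 ⊕ Fin 2) (Fin 2 ⊕ Fin 2) ℂ :=
  Matrix.fromBlocks 0 (pauli j) (pauli j) 0

/-- The Dirac matrix `β`. -/
def betaMatrix : Matrix (Fin 2 ⊕ Fin 2) (Fin 2 ⊕ Fin 2) ℂ :=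
  Matrix.fromBlocks 1 0 0 (-1)

/-- A complex matrix acting on column vectors. -/
def mat {ι : Type*} [Fintype ι] [DecidableEq ι] (M : Matrix ι ι ℂ) :
    EuclideanSpace ℂ ι →L[ℂ] EuclideanSpace ℂ ι :=
  Matrix.toEuclideanCLM (n := ι) (𝕜 := ℂ) M

theorem mat_apply {ι : Type*} [Fintype ι] [DecidableEq ι] (M : Matrix ι ι ℂ)
    (v : EuclideanSpace ℂ ι) (i : ι) : mat M v i = ∑ k, M i k * v k := rfl

/-- The first two components of a vector in `ℂ⁴`. -/
def upper : C4 →L[ℂ] C2 :=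
  LinearMap.toContinuousLinearMap
    { toFun := fun v => WithLp.toLp 2 fun i => v (Sum.inl i)
      map_add' := fun _ _ => rfl
      map_smul' := fun _ _ => rfl }

/-- The last two components of a vector in `ℂ⁴`. -/
def lower : C4 →L[ℂ] C2 :=
  LinearMap.toContinuousLinearMap
    { toFun := fun v => WithLp.toLp 2 fun i => v (Sum.inr i)
      map_add' := fun _ _ => rfl
      map_smul' := fun _ _ => rfl }

/-- The pointwise application of a linear map to an `L²` function. -/
def pointwise {d : ℕ} (Ω : Opens (Euc d)) {V W : Type*} [NormedAddCommGroup V] [NormedSpace ℂ V]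
    [NormedAddCommGroup W] [NormedSpace ℂ W] (L : V →L[ℂ] W) : L2 Ω V →ₗ[ℂ] L2 Ω W :=
  (L.compLpL 2 (volume.restrict (Ω : Set (Euc d)))).toLinearMap

/-- If `Aⱼ = J Sⱼ P + Kⱼ Q`, `∑ⱼ Sⱼ ∂ⱼ (P f)` is in `L²` and `Q f ∈ H¹₀`, then `∑ⱼ Aⱼ ∂ⱼ f` is
in `L²`. -/
theorem mem_domain_of_split {d : ℕ} (Ω : Opens (Euc d)) {V V₁ V₂ W₁ W : Type*}
    [NormedAddCommGroup V] [NormedSpace ℂ V] [NormedAddCommGroup V₁] [NormedSpace ℂ V₁]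
    [NormedAddCommGroup V₂] [NormedSpace ℂ V₂] [NormedAddCommGroup W₁] [NormedSpace ℂ W₁]
    [NormedAddCommGroup W] [NormedSpace ℂ W] [CompleteSpace V₂] [CompleteSpace W₁]
    [CompleteSpace W]
    (A : Fin d → V →L[ℂ] W) (S : Fin d → V₁ →L[ℂ] W₁) (P : V →L[ℂ] V₁) (Q : V →L[ℂ] V₂)
    (J : W₁ →L[ℂ] W) (K : Fin d → V₂ →L[ℂ] W)
    (hA : ∀ j v, A j v = J (S j (P v)) + K j (Q v)) (f : L2 Ω V)
    (h1 : pointwise Ω P f ∈ (weakOp Ω S).domain) (h2 : pointwise Ω Q f ∈ H10 Ω V₂) :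
    f ∈ (weakOp Ω A).domain := by
  obtain ⟨⟨f1, g⟩, hg, (rfl : f1 = _)⟩ := h1
  obtain ⟨⟨f2, p⟩, hp, (rfl : f2 = _)⟩ := h2
  refine ⟨(f, pointwise Ω J g + ∑ j, pointwise Ω (K j) (p j)), fun φ => ?_, rfl⟩
  have iφ := memLp_test Ω φ
  have iφ' := memLp_pderiv Ω φ
  have e1 : ∀ j, ∫ x in Ω, pderiv j φ x • A j (f x) =
      J (∫ x in Ω, pderiv j φ x • S j (pointwise Ω P f x)) +
        K j (∫ x in Ω, pderiv j φ x • pointwise Ω Q f x) := fun j => by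
    rw [← ContinuousLinearMap.integral_comp_comm _ (integrable_smul_clm Ω (iφ' j) _ _),
      ← ContinuousLinearMap.integral_comp_comm _ (integrable_smul_of_memLp Ω (iφ' j) _),
      ← integral_add]
    · refine integral_congr_ae ?_
      filter_upwards [P.coeFn_compLpL (p := 2) f, Q.coeFn_compLpL (p := 2) f] with x hx hx'
      have hx1 : pointwise Ω P f x = P (f x) := hx
      have hx2 : pointwise Ω Q f x = Q (f x) := hx'
      rw [hx1, hx2, hA, smul_add, map_smul, map_smul]
    · exact ContinuousLinearMap.integrable_comp _ (integrable_smul_clm Ω (iφ' j) _ _)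
    · exact ContinuousLinearMap.integrable_comp _ (integrable_smul_of_memLp Ω (iφ' j) _)
  have e2 : ∫ x in Ω, φ x • (pointwise Ω J g + ∑ j, pointwise Ω (K j) (p j) : L2 Ω W) x =
      J (∫ x in Ω, φ x • g x) + ∑ j, K j (∫ x in Ω, φ x • p j x) := by
    have a1 : ∀ j, K j (∫ x in Ω, φ x • p j x) = ∫ x in Ω, φ x • pointwise Ω (K j) (p j) x :=
      fun j => by
        rw [← ContinuousLinearMap.integral_comp_comm _ (integrable_smul_of_memLp Ω iφ _)]
        refine integral_congr_ae ?_
        filter_upwards [(K j).coeFn_compLpL (p := 2) (p j)] with x hx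
        have hx1 : pointwise Ω (K j) (p j) x = K j (p j x) := hx
        rw [hx1, map_smul]
    have a2 : J (∫ x in Ω, φ x • g x) = ∫ x in Ω, φ x • pointwise Ω J g x := by
      rw [← ContinuousLinearMap.integral_comp_comm _ (integrable_smul_of_memLp Ω iφ _)]
      refine integral_congr_ae ?_
      filter_upwards [J.coeFn_compLpL (p := 2) g] with x hx
      have hx1 : pointwise Ω J g x = J (g x) := hx
      rw [hx1, map_smul]
    simp only [a1, a2]
    have i1 : ∀ j ∈ Finset.univ, IntegrableOn (fun x => φ x • pointwise Ω (K j) (p j) x) Ω :=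
      fun j _ => integrable_smul_of_memLp Ω iφ _
    rw [← integral_finsetSum _ i1, ← integral_add (integrable_smul_of_memLp Ω iφ _)
      (integrable_finsetSum _ i1)]
    refine integral_congr_ae ?_
    filter_upwards [Lp.coeFn_add (pointwise Ω J g) (∑ j, pointwise Ω (K j) (p j)),
      Lp.coeFn_finsetSum Finset.univ (fun j => pointwise Ω (K j) (p j))] with x hx hx'
    rw [hx, Pi.add_apply, hx', smul_add, Finset.sum_apply, Finset.smul_sum]
  change ∑ j, ∫ x in Ω, pderiv j φ x • A j (f x) = _
  have e3 := hg φ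
  simp only at e3
  rw [e2, Finset.sum_congr rfl fun j _ => e1 j, Finset.sum_add_distrib, ← map_sum, e3]
  simp only [H10Graph_weak Ω hp, map_neg, Finset.sum_neg_distrib]
  rw [neg_add]

/-- The differential expression `-i c ∑ⱼ αⱼ ∂ⱼ + m c² β` in `L²(Ω; V)`, on its maximal domain. -/
def diracExpr {d : ℕ} (Ω : Opens (Euc d)) {V : Type*} [NormedAddCommGroup V] [NormedSpace ℂ V]
    (α : Fin d → V →L[ℂ] V) (β : V →L[ℂ] V) (m c : ℝ) : L2 Ω V →ₗ.[ℂ] L2 Ω V :=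
  ((m * c ^ 2 : ℝ) : ℂ) • pointwise Ω β +ᵥ (-Complex.I * (c : ℂ)) • weakOp Ω α

/-- The coefficients of `∂₁ + i ∂₂`. -/
def dbar : Fin 2 → ℂ →L[ℂ] ℂ :=
  ![ContinuousLinearMap.id ℂ ℂ, Complex.I • ContinuousLinearMap.id ℂ ℂ]

/-- All `f = (f₁, f₂) ∈ L²(Ω; ℂ²)` with `(∂₁ + i ∂₂) f₁ ∈ L²(Ω)` and `f₂ ∈ H¹₀(Ω)`. -/
def zigzagDomain2 (Ω : Opens (Euc 2)) : Submodule ℂ (L2 Ω C2) :=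
  (weakOp Ω dbar).domain.comap (pointwise Ω (EuclideanSpace.proj 0)) ⊓
    (H10 Ω ℂ).comap (pointwise Ω (EuclideanSpace.proj 1))

/-- The two-dimensional Dirac operator `-i c (σ₁ ∂₁ + σ₂ ∂₂) + m c² σ₃` with zigzag boundary
conditions. -/
def dirac2 (m c : ℝ) (Ω : Opens (Euc 2)) : L2 Ω C2 →ₗ.[ℂ] L2 Ω C2 :=
  (diracExpr Ω (fun j => mat (pauli j.castSucc)) (mat (pauli 2)) m c).domRestrict (zigzagDomain2 Ω)

/-- The operator is really defined on all of `zigzagDomain2`. -/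
theorem dirac2_domain (m c : ℝ) (Ω : Opens (Euc 2)) : (dirac2 m c Ω).domain = zigzagDomain2 Ω := by
  refine inf_eq_left.2 fun f hf => ?_
  refine mem_domain_of_split Ω (fun j => mat (pauli j.castSucc)) dbar
    (EuclideanSpace.proj (0 : Fin 2)) (EuclideanSpace.proj (1 : Fin 2))
    (ContinuousLinearMap.toSpanSingleton ℂ (EuclideanSpace.single (1 : Fin 2) (1 : ℂ)))
    ![ContinuousLinearMap.toSpanSingleton ℂ (EuclideanSpace.single (0 : Fin 2) (1 : ℂ)),
      ContinuousLinearMap.toSpanSingleton ℂ (EuclideanSpace.single (0 : Fin 2) (-Complex.I))]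
    (fun j v => ?_) f hf.1 hf.2
  ext i
  fin_cases j <;> fin_cases i <;> simp [mat_apply, pauli, dbar, mul_comm]

/-- All `f = (f₁, f₂) ∈ L²(Ω; ℂ⁴)` with `(σ · ∇) f₁ ∈ L²(Ω; ℂ²)` and `f₂ ∈ H¹₀(Ω; ℂ²)`. -/
def zigzagDomain3 (Ω : Opens (Euc 3)) : Submodule ℂ (L2 Ω C4) :=
  (weakOp Ω fun j => mat (pauli j)).domain.comap (pointwise Ω upper) ⊓
    (H10 Ω C2).comap (pointwise Ω lower)

/-- The three-dimensional Dirac operator `-i c α · ∇ + m c² β` with zigzag type boundary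
conditions. -/
def dirac3 (m c : ℝ) (Ω : Opens (Euc 3)) : L2 Ω C4 →ₗ.[ℂ] L2 Ω C4 :=
  (diracExpr Ω (fun j => mat (alphaMatrix j)) (mat betaMatrix) m c).domRestrict (zigzagDomain3 Ω)

/-- The operator is really defined on all of `zigzagDomain3`. -/
theorem dirac3_domain (m c : ℝ) (Ω : Opens (Euc 3)) : (dirac3 m c Ω).domain = zigzagDomain3 Ω := by
  refine inf_eq_left.2 fun f hf => ?_
  let inl : C2 →L[ℂ] C4 := LinearMap.toContinuousLinearMap
    { toFun := fun v => WithLp.toLp 2 (Sum.elim v 0)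
      map_add' := fun _ _ => by ext (i | i) <;> simp
      map_smul' := fun _ _ => by ext (i | i) <;> simp }
  let inr : C2 →L[ℂ] C4 := LinearMap.toContinuousLinearMap
    { toFun := fun v => WithLp.toLp 2 (Sum.elim 0 v)
      map_add' := fun _ _ => by ext (i | i) <;> simp
      map_smul' := fun _ _ => by ext (i | i) <;> simp }
  refine mem_domain_of_split Ω _ (fun j => mat (pauli j)) upper lower inr
    (fun j => inl ∘L mat (pauli j)) (fun j v => ?_) f hf.1 hf.2
  ext (i | i)
  · change mat (alphaMatrix j) v (Sum.inl i) = 0 + mat (pauli j) (lower v) i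
    simp [mat_apply, alphaMatrix]
    rfl
  · change mat (alphaMatrix j) v (Sum.inr i) = mat (pauli j) (upper v) i + 0
    simp [mat_apply, alphaMatrix]
    rfl

end Zigzag

end

/-!
Supersymmetry. With respect to the splitting of spinors into upper and lower components, the Dirac
operator with zigzag boundary conditions is the block operator `H = [[mc², A], [A*, -mc²]]`, where
`A = -i c ∑ⱼ Sⱼ* ∂ⱼ` with domain `H¹₀(Ω; V)` (`firstOrderGraph`) and `A*` is the maximal realization
of `-i c ∑ⱼ Sⱼ ∂ⱼ` (`mem_adjoint_firstOrderGraph_iff`). By the Clifford relations and integration by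
parts, `‖A w‖² = c² ‖∇w‖²` on `H¹₀`. Hence `A` is closed and `A* A` acts as `c² (-Δ_D)` on each
component (`IsClifford.mem_gramGraph_iff_dirichletLaplacian`).

For a closed and densely defined `A`, the block operator is self-adjoint. For `z ≠ mc²`, the number `z`
is in its resolvent set if and only if `z² - (mc²)²` is in the resolvent set of `A* A`, and the
corresponding eigenspaces are isomorphic; this gives the spectrum and the multiplicities. If `-mc²`
with `m ≠ 0` were an eigenvalue, then `A` would have a kernel, which is impossible for a function in
`H¹₀`. All of this avoids the spectral theorem for unbounded operators: the spectral theory of `A* A` is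
reduced to that of the bounded operator `(A* A + 1)⁻¹`, which is the compression of the orthogonal
projection onto the graph of `A`.

There remains `mc² ∈ σ_ess(H)`. If `0 ∈ σ(A* A)`, then `0` is not isolated there, since an isolated
point would be an eigenvalue, and `mc²` is not isolated in `σ(H)`. Otherwise `A` is bounded below, and
`mc²` is an eigenvalue with eigenspace `ker A*`, which is infinite-dimensional
(`IsClifford.not_finiteDimensional_ker_adjoint`). This is proved for arbitrary open `Ω`, for which no
explicit elements of `ker A*` are available, in the following way. Suppose that `ker A*` is
finite-dimensional and fix `χ ≠ 0` in `V`. For real `g ∈ C₀^∞(ℝᵈ)` the identity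
`|A (g χ)|² = c² |∇(g χ)|²` holds pointwise; so if `A (g χ)` is in the closed range of `A`, say
`A (g χ) = A w`, then `∇(g χ) = ∇w` and `g χ - w ∈ ker A*`. Therefore `g χ ∈ H¹₀(Ω; V)` for all `g` in a
subspace of finite codimension. This subspace is invariant under multiplication by the bounded
functions `arctan xⱼ`, so by the Cayley-Hamilton theorem it contains `P(arctan xⱼ) g` for all `g` and
some polynomial `P ≠ 0`, that is, all `g` supported away from finitely many hyperplanes `xⱼ = t`. For
these `g` one obtains `∫_Ω ∂ₖ g = 0` for every `k`, so the indicator function of `Ω` is constant almost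
everywhere on the components of the complement of the hyperplanes. Using two different coordinates,
the constant is seen to be `1` on some half space, where bump functions of large width contradict the
lower bound for `A`.
-/

noncomputable section

namespace Zigzag

/-! ### Closed graphs between Hilbert spaces -/

section Graphs

variable {K₁ K₂ : Type*} [NormedAddCommGroup K₁] [InnerProductSpace ℂ K₁]
  [NormedAddCommGroup K₂] [InnerProductSpace ℂ K₂]
  {Γ : Submodule ℂ (K₂ × K₁)}

theorem inner_eq_of_mem_adjoint {u : K₂} {g f : K₁} {k : K₂} (hu : (u, g) ∈ Γ)
    (hf : (f, k) ∈ Γ.adjoint) : inner ℂ g f = inner ℂ u k :=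
  sub_eq_zero.1 ((Submodule.mem_adjoint_iff Γ (f, k)).1 hf u g hu)

theorem mem_adjoint_of_forall {f : K₁} {k : K₂}
    (h : ∀ u g, (u, g) ∈ Γ → inner ℂ g f = inner ℂ u k) : (f, k) ∈ Γ.adjoint :=
  (Submodule.mem_adjoint_iff Γ (f, k)).2 fun u g hu => sub_eq_zero.2 (h u g hu)

/-- The graph of `A* A`, where `Γ` is the graph of `A`. -/
def gramGraph (Γ : Submodule ℂ (K₂ × K₁)) : Submodule ℂ (K₂ × K₂) where
  carrier := {w | ∃ g, (w.1, g) ∈ Γ ∧ (g, w.2) ∈ Γ.adjoint}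
  zero_mem' := ⟨0, Γ.zero_mem, Γ.adjoint.zero_mem⟩
  add_mem' := by
    rintro x y ⟨g, h1, h2⟩ ⟨k, h3, h4⟩
    exact ⟨g + k, Γ.add_mem h1 h3, Γ.adjoint.add_mem h2 h4⟩
  smul_mem' := by
    rintro a x ⟨g, h1, h2⟩
    exact ⟨a • g, Γ.smul_mem a h1, Γ.adjoint.smul_mem a h2⟩

/-- The orthogonal projection onto the closed graph of `A`. For `w = (y, ζ)` it selects the pair
`(v, A v)` with `v - y = A* (ζ - A v)`, that is, the solution of `v + A* A v = y + A* ζ`. -/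
theorem exists_clm_adjoint_decomposition [CompleteSpace K₁] [CompleteSpace K₂]
    (hΓ : IsClosed (Γ : Set (K₂ × K₁))) :
    ∃ P : (K₂ × K₁) →L[ℂ] (K₂ × K₁), ∀ w, P w ∈ Γ ∧ (w.2 - (P w).2, (P w).1 - w.1) ∈ Γ.adjoint := by
  let q := WithLp.prodContinuousLinearEquiv 2 ℂ K₂ K₁
  let G : Submodule ℂ (WithLp 2 (K₂ × K₁)) := Γ.comap q.toLinearMap
  have hG : IsClosed (G : Set (WithLp 2 (K₂ × K₁))) := hΓ.preimage q.continuous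
  have : CompleteSpace G := hG.completeSpace_coe
  refine ⟨(q : _ →L[ℂ] _) ∘L G.starProjection ∘L (q.symm : _ →L[ℂ] _), fun w => ⟨?_, ?_⟩⟩
  · exact G.starProjection_apply_mem (q.symm w)
  · refine mem_adjoint_of_forall fun u g hu => ?_
    have h := Submodule.sub_starProjection_mem_orthogonal (K := G) (q.symm w)
    have h1 := (Submodule.mem_orthogonal _ _).1 h (q.symm (u, g)) (by
      change q (q.symm (u, g)) ∈ Γ
      rwa [ContinuousLinearEquiv.apply_symm_apply])
    rw [WithLp.prod_inner_apply] at h1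
    change inner ℂ u (w.1 - (q (G.starProjection (q.symm w))).1) +
      inner ℂ g (w.2 - (q (G.starProjection (q.symm w))).2) = 0 at h1
    change inner ℂ g (w.2 - (q (G.starProjection (q.symm w))).2) =
      inner ℂ u ((q (G.starProjection (q.symm w))).1 - w.1)
    rw [← neg_sub w.1, inner_neg_right]
    linear_combination h1

/-- A closed graph coincides with its double adjoint. -/
theorem mem_of_forall_adjoint [CompleteSpace K₁] [CompleteSpace K₂]
    (hΓ : IsClosed (Γ : Set (K₂ × K₁))) {y : K₂} {ζ : K₁}
    (h : ∀ f k, (f, k) ∈ Γ.adjoint → inner ℂ f ζ = inner ℂ k y) : (y, ζ) ∈ Γ := by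
  obtain ⟨P, hP⟩ := exists_clm_adjoint_decomposition hΓ
  obtain ⟨v, g, h1, h2⟩ : ∃ v g, (v, g) ∈ Γ ∧ (ζ - g, v - y) ∈ Γ.adjoint :=
    ⟨_, _, hP (y, ζ)⟩
  have e1 := h _ _ h2
  have e2 := congrArg (starRingEnd ℂ) (inner_eq_of_mem_adjoint h1 h2)
  rw [inner_conj_symm, inner_conj_symm] at e2
  have e3 : inner ℂ (ζ - g) (ζ - g) + inner ℂ (v - y) (v - y) = 0 := by
    rw [inner_sub_right (ζ - g), inner_sub_right (v - y), e1, e2]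
    ring
  have e4 : ‖ζ - g‖ ^ 2 + ‖v - y‖ ^ 2 = 0 := by
    have := congrArg Complex.re e3
    rwa [Complex.add_re, Complex.zero_re, ← RCLike.re_eq_complex_re, ← norm_sq_eq_re_inner,
      ← norm_sq_eq_re_inner] at this
  have e5 : ‖ζ - g‖ = 0 := by nlinarith [sq_nonneg ‖ζ - g‖, sq_nonneg ‖v - y‖]
  have e6 : ‖v - y‖ = 0 := by nlinarith [sq_nonneg ‖ζ - g‖, sq_nonneg ‖v - y‖]
  rw [norm_eq_zero, sub_eq_zero] at e5 e6
  rwa [e5, ← e6]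

theorem eq_zero_of_zero_mem_adjoint (hd : Dense (Γ.map (LinearMap.fst ℂ K₂ K₁) : Set K₂)) {k : K₂}
    (h : ((0 : K₁), k) ∈ Γ.adjoint) : k = 0 := by
  refine hd.eq_zero_of_inner_right ℂ fun u hu => ?_
  obtain ⟨⟨u', g⟩, hg, rfl⟩ := hu
  simpa using (inner_eq_of_mem_adjoint hg h).symm

theorem gramGraph_single (hs : ∀ g, ((0 : K₂), g) ∈ Γ → g = 0)
    (hd : Dense (Γ.map (LinearMap.fst ℂ K₂ K₁) : Set K₂)) :
    ∀ w ∈ gramGraph Γ, w.1 = 0 → w.2 = 0 := by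
  rintro ⟨u, v⟩ ⟨g, h1, h2⟩ (rfl : u = 0)
  obtain rfl := hs g h1
  exact eq_zero_of_zero_mem_adjoint hd h2

/-- The resolvent `(A* A + 1)⁻¹`, as an everywhere defined bounded operator. -/
theorem exists_gram_resolvent [CompleteSpace K₁] [CompleteSpace K₂]
    (hΓ : IsClosed (Γ : Set (K₂ × K₁))) :
    ∃ R : K₂ →L[ℂ] K₂, ∀ y, (R y, y - R y) ∈ gramGraph Γ := by
  obtain ⟨P, hP⟩ := exists_clm_adjoint_decomposition hΓ
  refine ⟨ContinuousLinearMap.fst ℂ _ _ ∘L P ∘L ContinuousLinearMap.inl ℂ _ _, fun y => ?_⟩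
  obtain ⟨h1, h2⟩ := hP (y, 0)
  refine ⟨(P (y, 0)).2, h1, ?_⟩
  have := Γ.adjoint.neg_mem h2
  simpa using this

end Graphs

/-! ### The spectrum of `A* A` -/

section Operators

variable {E : Type*} [NormedAddCommGroup E] [InnerProductSpace ℂ E]

/-- Resolvent points in terms of the graph, without reference to domain membership. -/
theorem isResolventPoint_iff (T : E →ₗ.[ℂ] E) (z : ℂ) :
    IsResolventPoint T z ↔ ∃ R : E →L[ℂ] E, (∀ x, (R x, x + z • R x) ∈ T.graph) ∧
      ∀ x y, (x, y) ∈ T.graph → R (y - z • x) = x := by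
  refine exists_congr fun R => and_congr (forall_congr' fun x => ?_) ?_
  · simp only [LinearPMap.mem_graph_iff, Subtype.exists, exists_and_left, exists_eq_left,
      sub_eq_iff_eq_add]
  · constructor
    · intro h x y hxy
      obtain ⟨x', rfl, rfl⟩ := (LinearPMap.mem_graph_iff T).1 hxy
      exact h x'
    · exact fun h x => h x (T x) (T.mem_graph x)

theorem mem_eigenspace_iff (T : E →ₗ.[ℂ] E) (z : ℂ) (x : E) :
    x ∈ eigenspace T z ↔ (x, z • x) ∈ T.graph := by
  rw [LinearPMap.mem_graph_iff]
  simp only [Subtype.exists, exists_and_left, exists_eq_left]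
  rfl

/-- By the closed graph theorem, the inverse of a bijective closed operator is bounded. -/
theorem isResolventPoint_of_bijective [CompleteSpace E] {T : E →ₗ.[ℂ] E} (hT : T.IsClosed) (z : ℂ)
    (hinj : ∀ x, (x, z • x) ∈ T.graph → x = 0) (hsurj : ∀ y, ∃ x, (x, y + z • x) ∈ T.graph) :
    IsResolventPoint T z := by
  choose R hR using hsurj
  have huniq : ∀ {x y}, (x, y + z • x) ∈ T.graph → R y = x := fun {x y} h => by
    refine sub_eq_zero.1 (hinj _ ?_)
    have := T.graph.sub_mem (hR y) h
    rwa [Prod.mk_sub_mk, add_sub_add_left_eq_sub, ← smul_sub] at this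
  let R' : E →ₗ[ℂ] E :=
    { toFun := R
      map_add' := fun x y => huniq (by
        have := T.graph.add_mem (hR x) (hR y)
        rwa [Prod.mk_add_mk, add_add_add_comm, ← smul_add] at this)
      map_smul' := fun a x => huniq (by
        have := T.graph.smul_mem a (hR x)
        rwa [Prod.smul_mk, smul_add, smul_comm a z] at this) }
  have hc : Continuous R' := by
    refine LinearMap.continuous_of_isClosed_graph _ ?_
    have : (R'.graph : Set (E × E)) = (fun p : E × E => (p.2, p.1 + z • p.2)) ⁻¹' T.graph := by
      ext ⟨y, x⟩
      simp only [SetLike.mem_coe, LinearMap.mem_graph_iff, Set.mem_preimage]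
      constructor
      · rintro rfl
        exact hR y
      · exact fun h => (huniq h).symm
    rw [this]
    exact hT.preimage (by fun_prop)
  refine (isResolventPoint_iff T z).2 ⟨⟨R', hc⟩, hR, fun x y h => huniq ?_⟩
  rwa [sub_add_cancel]

end Operators

section Gram

variable {K₁ K₂ : Type*} [NormedAddCommGroup K₁] [InnerProductSpace ℂ K₁]
  [NormedAddCommGroup K₂] [InnerProductSpace ℂ K₂]
  {Γ : Submodule ℂ (K₂ × K₁)} {L : K₂ →ₗ.[ℂ] K₂} {R : K₂ →L[ℂ] K₂}

/-- `‖u‖ ≤ ‖u + A* A u‖`, because `⟨u, u + A* A u⟩ = ‖u‖² + ‖A u‖²`. -/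
theorem norm_le_of_mem_gramGraph {u v : K₂} (h : (u, v) ∈ gramGraph Γ) : ‖u‖ ≤ ‖u + v‖ := by
  obtain ⟨g, h1, h2⟩ := h
  have e := inner_eq_of_mem_adjoint h1 h2
  have e1 : inner ℂ u (u + v) = ((‖u‖ ^ 2 + ‖g‖ ^ 2 : ℝ) : ℂ) := by
    rw [inner_add_right, ← e, inner_self_eq_norm_sq_to_K, inner_self_eq_norm_sq_to_K]
    push_cast
    rfl
  have e2 := norm_inner_le_norm (𝕜 := ℂ) u (u + v)
  rw [e1, Complex.norm_real, Real.norm_of_nonneg (by positivity)] at e2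
  by_contra hlt
  push Not at hlt
  nlinarith [norm_nonneg u, norm_nonneg (u + v), sq_nonneg ‖g‖]

theorem gram_resolvent_apply (hR : ∀ y, (R y, y - R y) ∈ gramGraph Γ) {u v : K₂}
    (h : (u, v) ∈ gramGraph Γ) : R (u + v) = u := by
  have h1 := (gramGraph Γ).sub_mem (hR (u + v)) h
  have h2 := norm_le_of_mem_gramGraph h1
  rw [show (R (u + v) - u + (u + v - R (u + v) - v)) = 0 by abel, norm_zero] at h2
  exact sub_eq_zero.1 (norm_le_zero_iff.1 h2)

/-- With `R = (A* A + 1)⁻¹` one has `A* A - μ = (1 - (1 + μ) R) R⁻¹`. -/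
theorem gram_isResolventPoint_iff (hL : L.graph = gramGraph Γ)
    (hR : ∀ y, (R y, y - R y) ∈ gramGraph Γ) (μ : ℂ) :
    IsResolventPoint L μ ↔ IsUnit (1 - (1 + μ) • R) := by
  rw [isResolventPoint_iff, hL]
  constructor
  · rintro ⟨B, hB1, hB2⟩
    have e1 : B * (1 - (1 + μ) • R) = R := by
      ext y
      have := hB2 _ _ (hR y)
      rw [mul_apply_eq_comp, ← this]
      congr 1
      change y - (1 + μ) • R y = _
      module
    have e2 : R * (1 + (1 + μ) • B) = B := by
      ext y
      have := gram_resolvent_apply hR (hB1 y)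
      rw [mul_apply_eq_comp, ← this]
      congr 1
      change y + (1 + μ) • B y = _
      module
    refine ⟨⟨1 - (1 + μ) • R, 1 + (1 + μ) • B, ?_, ?_⟩, rfl⟩
    · rw [sub_mul, one_mul, smul_mul_assoc, e2, add_sub_cancel_right]
    · rw [add_mul, one_mul, smul_mul_assoc, e1, sub_add_cancel]
  · rintro ⟨U, hU⟩
    refine ⟨R * (↑U⁻¹ : K₂ →L[ℂ] K₂), fun x => ?_, fun u v h => ?_⟩
    · have e : ((1 - (1 + μ) • R) * (↑U⁻¹ : K₂ →L[ℂ] K₂)) x = x := by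
        rw [← hU, Units.mul_inv]
        rfl
      set y := (↑U⁻¹ : K₂ →L[ℂ] K₂) x with hy
      change y - (1 + μ) • R y = x at e
      change (R y, x + μ • R y) ∈ _
      convert! hR y using 2
      rw [← e]
      module
    · have e : ((↑U⁻¹ : K₂ →L[ℂ] K₂) * (1 - (1 + μ) • R)) (u + v) = u + v := by
        rw [← hU, Units.inv_mul]
        rfl
      have e1 : v - μ • u = (1 - (1 + μ) • R) (u + v) := by
        change _ = (u + v) - (1 + μ) • R (u + v)
        rw [gram_resolvent_apply hR h]
        module
      rw [e1, mul_apply_eq_comp, ← mul_apply_eq_comp (↑U⁻¹ : K₂ →L[ℂ] K₂),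
        e, gram_resolvent_apply hR h]

theorem gram_mem_spectrum_iff (hL : L.graph = gramGraph Γ)
    (hR : ∀ y, (R y, y - R y) ∈ gramGraph Γ) {μ : ℂ} (hμ : 1 + μ ≠ 0) :
    μ ∈ spectrum L ↔ (1 + μ)⁻¹ ∈ _root_.spectrum ℂ R := by
  change ¬ IsResolventPoint L μ ↔ ¬ IsUnit _
  rw [gram_isResolventPoint_iff hL hR, Algebra.algebraMap_eq_smul_one]
  have : (1 + μ)⁻¹ • (1 : K₂ →L[ℂ] K₂) - R = Units.mk0 _ (inv_ne_zero hμ) • (1 - (1 + μ) • R) := by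
    rw [Units.smul_def, Units.val_mk0, smul_sub, smul_smul, inv_mul_cancel₀ hμ, one_smul]
  rw [this, not_iff_not]
  exact (isUnit_smul_iff _ _).symm

theorem gram_resolvent_isPositive [CompleteSpace K₂] (hR : ∀ y, (R y, y - R y) ∈ gramGraph Γ) :
    R.IsPositive := by
  refine (ContinuousLinearMap.isPositive_iff_complex R).2 fun y => ?_
  obtain ⟨g, h1, h2⟩ := hR y
  have e : inner ℂ (R y) y = ((‖R y‖ ^ 2 + ‖g‖ ^ 2 : ℝ) : ℂ) := by
    have := inner_eq_of_mem_adjoint h1 h2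
    rw [inner_sub_right, inner_self_eq_norm_sq_to_K, inner_self_eq_norm_sq_to_K] at this
    push_cast
    linear_combination -this
  rw [e]
  refine ⟨congrArg _ (Complex.ofReal_re _), by exact (by positivity : (0 : ℝ) ≤ ‖R y‖ ^ 2 + ‖g‖ ^ 2)⟩

theorem gram_resolvent_norm_le (hR : ∀ y, (R y, y - R y) ∈ gramGraph Γ) : ‖R‖ ≤ 1 := by
  refine ContinuousLinearMap.opNorm_le_bound _ zero_le_one fun y => ?_
  have := norm_le_of_mem_gramGraph (hR y)
  rwa [add_sub_cancel, ← one_mul ‖y‖] at this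

open scoped ComplexOrder in
theorem gram_resolvent_spectrum [CompleteSpace K₂] (hR : ∀ y, (R y, y - R y) ∈ gramGraph Γ) {s : ℂ}
    (hs : s ∈ _root_.spectrum ℂ R) : s = (s.re : ℂ) ∧ 0 ≤ s.re ∧ s.re ≤ 1 := by
  have hp := gram_resolvent_isPositive hR
  have h1 : s = (s.re : ℂ) := hp.isSelfAdjoint.mem_spectrum_eq_re hs
  have h0 : 0 ≤ R := (ContinuousLinearMap.nonneg_iff_isPositive R).2 hp
  have h2 : (0 : ℂ) ≤ s := spectrum_nonneg_of_nonneg h0 hs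
  refine ⟨h1, (Complex.le_def.1 h2).1, ?_⟩
  have h3 : ‖s‖ ≤ ‖R‖ * ‖(1 : K₂ →L[ℂ] K₂)‖ := _root_.spectrum.norm_le_norm_mul_of_mem hs
  have h4 : ‖(1 : K₂ →L[ℂ] K₂)‖ ≤ 1 := ContinuousLinearMap.norm_id_le
  have h5 := gram_resolvent_norm_le hR
  have h6 := Complex.re_le_norm s
  nlinarith [norm_nonneg R, norm_nonneg (1 : K₂ →L[ℂ] K₂)]

/-- The spectrum of `A* A` is contained in `[0, ∞)`. -/
theorem gram_spectrum_nonneg [CompleteSpace K₂] (hL : L.graph = gramGraph Γ)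
    (hR : ∀ y, (R y, y - R y) ∈ gramGraph Γ) {μ : ℂ} (hμ : μ ∈ spectrum L) :
    ∃ l : ℝ, 0 ≤ l ∧ μ = l := by
  by_cases h0 : 1 + μ = 0
  · refine absurd ?_ hμ
    rw [gram_isResolventPoint_iff hL hR, h0, zero_smul, sub_zero]
    exact isUnit_one
  obtain ⟨h1, h2, h3⟩ := gram_resolvent_spectrum hR ((gram_mem_spectrum_iff hL hR h0).1 hμ)
  set s := ((1 + μ)⁻¹).re
  have h4 : s ≠ 0 := fun h => inv_ne_zero h0 (by rw [h1, h]; simp)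
  have hs : 0 < s := lt_of_le_of_ne h2 h4.symm
  refine ⟨s⁻¹ - 1, by linarith [(one_le_inv₀ hs).2 h3], ?_⟩
  push_cast
  rw [← h1, inv_inv]
  ring

/-- An isolated point of the spectrum of a bounded self-adjoint operator is an eigenvalue: the
continuous functional calculus of the indicator function of the point is a nonzero operator with
values in the eigenspace. -/
theorem exists_eigenvector_of_isolated [CompleteSpace K₂] (hsa : IsSelfAdjoint R) {s : ℂ}
    (hs : s ∈ _root_.spectrum ℂ R) {ε : ℝ} (hε : 0 < ε)
    (hiso : ∀ t ∈ _root_.spectrum ℂ R, dist t s < ε → t = s) : ∃ x, x ≠ 0 ∧ R x = s • x := by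
  classical
  let f : ℂ → ℂ := fun t => if t = s then 1 else 0
  have hf : ContinuousOn f (_root_.spectrum ℂ R) := by
    intro t ht
    by_cases hts : t = s
    · refine (continuousWithinAt_const (b := f t)).congr_of_eventuallyEq ?_ rfl
      filter_upwards [self_mem_nhdsWithin,
        mem_nhdsWithin_of_mem_nhds (Metric.ball_mem_nhds s hε |> (hts ▸ ·))] with x hx hx'
      rw [hiso x hx (hts ▸ hx'), hts]
    · refine (continuousWithinAt_const (b := f t)).congr_of_eventuallyEq ?_ rfl
      filter_upwards [mem_nhdsWithin_of_mem_nhds (isOpen_ne.mem_nhds hts)] with x hx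
      simp only [f, if_neg hts]
      rw [if_neg hx]
  have hn : IsStarNormal R := hsa.isStarNormal
  have hne : cfc f R ≠ 0 := by
    intro h0
    have h1 : (1 : ℂ) ∈ _root_.spectrum ℂ (cfc f R) := by
      rw [cfc_map_spectrum f R]
      exact ⟨s, hs, by simp [f]⟩
    rw [h0] at h1
    have : Nontrivial (K₂ →L[ℂ] K₂) := by
      by_contra hnt
      rw [not_nontrivial_iff_subsingleton] at hnt
      rw [_root_.spectrum.of_subsingleton] at h1
      exact h1
    rw [_root_.spectrum.zero_eq] at h1
    exact one_ne_zero h1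
  have hmul : R * cfc f R = s • cfc f R := by
    have e1 : R * cfc f R = cfc (fun t => t * f t) R := by
      rw [cfc_mul (fun t => t) f R continuousOn_id hf, cfc_id' ℂ R]
    have e2 : s • cfc f R = cfc (fun t => s • f t) R := by
      rw [cfc_smul s f R hf]
    rw [e1, e2]
    refine cfc_congr fun t _ => ?_
    by_cases hts : t = s <;> simp [f, hts]
  obtain ⟨y, hy⟩ : ∃ y, cfc f R y ≠ 0 := by
    by_contra h
    push Not at h
    exact hne (by ext y; exact h y)
  exact ⟨cfc f R y, hy, congrArg (fun B : K₂ →L[ℂ] K₂ => B y) hmul⟩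

/-- If `A` is injective and `0` is in the spectrum of `A* A`, then `0` is not isolated in it. -/
theorem gram_zero_not_isolated [CompleteSpace K₂] (hL : L.graph = gramGraph Γ)
    (hR : ∀ y, (R y, y - R y) ∈ gramGraph Γ) (hinj : ∀ u, (u, (0 : K₁)) ∈ Γ → u = 0)
    (h0 : (0 : ℂ) ∈ spectrum L) {ε : ℝ} (hε : 0 < ε) :
    ∃ l : ℝ, 0 < l ∧ l < ε ∧ (l : ℂ) ∈ spectrum L := by
  have h1 : (1 : ℂ) ∈ _root_.spectrum ℂ R := by
    have := (gram_mem_spectrum_iff hL hR (μ := 0) (by simp)).1 h0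
    simpa using this
  by_contra hcon
  push Not at hcon
  have hδ : 0 < 1 - (1 + ε)⁻¹ := by
    have : (1 + ε)⁻¹ < 1 := inv_lt_one_of_one_lt₀ (by linarith)
    linarith
  obtain ⟨x, hx, hRx⟩ := exists_eigenvector_of_isolated (gram_resolvent_isPositive hR).isSelfAdjoint
    h1 hδ fun t ht htd => by
      by_contra hne
      obtain ⟨e1, e2, e3⟩ := gram_resolvent_spectrum hR ht
      set r := t.re
      have hr1 : r < 1 := lt_of_le_of_ne e3 fun h => hne (by rw [e1, h]; simp)
      have hr2 : (1 + ε)⁻¹ < r := by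
        rw [e1, dist_eq_norm, ← Complex.ofReal_one, ← Complex.ofReal_sub, Complex.norm_real,
          Real.norm_of_nonpos (by linarith)] at htd
        linarith
      have hr0 : 0 < r := lt_trans (by positivity) hr2
      have h2 : 1 < r⁻¹ := (one_lt_inv₀ hr0).2 hr1
      -- The point `r` of the spectrum of `R` corresponds to `r⁻¹ - 1` in the spectrum of `A* A`.
      refine hcon (r⁻¹ - 1) (by linarith) ?_ ?_
      · have := inv_strictAnti₀ (by positivity) hr2
        rw [inv_inv] at this
        linarith
      · rw [gram_mem_spectrum_iff hL hR]
        · push_cast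
          rw [add_sub_cancel, inv_inv, ← e1]
          exact ht
        · push_cast
          rw [add_sub_cancel]
          exact inv_ne_zero (by exact_mod_cast hr0.ne')
  obtain ⟨g, g1, g2⟩ := hR x
  rw [hRx, one_smul, sub_self] at g2
  rw [hRx, one_smul] at g1
  have := inner_eq_of_mem_adjoint g1 g2
  rw [inner_zero_right, inner_self_eq_zero] at this
  exact hx (hinj x (this ▸ g1))

/-- If `0` is in the resolvent set of `A* A`, then `A` is bounded from below. -/
theorem gram_bounded_below (hL : L.graph = gramGraph Γ) (h0 : IsResolventPoint L 0) :
    ∃ C : ℝ, 0 ≤ C ∧ ∀ u g, (u, g) ∈ Γ → ‖u‖ ≤ C * ‖g‖ := by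
  -- With `B = (A* A)⁻¹`, use `‖u‖² = ⟨A u, A B u⟩` and `‖A B u‖² = ⟨B u, u⟩ ≤ ‖B‖ ‖u‖²`.
  obtain ⟨B, hB, -⟩ := (isResolventPoint_iff L 0).1 h0
  refine ⟨√‖B‖, Real.sqrt_nonneg _, fun u g hu => ?_⟩
  have h := hB u
  rw [hL, zero_smul, add_zero] at h
  obtain ⟨k, h1, h2⟩ := h
  have e1 := inner_eq_of_mem_adjoint hu h2
  have e2 := inner_eq_of_mem_adjoint h1 h2
  have b1 : ‖k‖ ^ 2 ≤ ‖B‖ * ‖u‖ ^ 2 := by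
    have := norm_inner_le_norm (𝕜 := ℂ) (B u) u
    rw [← e2, inner_self_eq_norm_sq_to_K] at this
    simp only [norm_pow, RCLike.norm_ofReal, abs_norm] at this
    nlinarith [B.le_opNorm u, norm_nonneg u]
  have b2 : ‖u‖ ^ 2 ≤ ‖g‖ * ‖k‖ := by
    have := norm_inner_le_norm (𝕜 := ℂ) g k
    rw [e1, inner_self_eq_norm_sq_to_K] at this
    simpa only [norm_pow, RCLike.norm_ofReal, abs_norm] using this
  have b3 : ‖k‖ ≤ √‖B‖ * ‖u‖ := by
    refine abs_le_of_sq_le_sq' ?_ (by positivity) |>.2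
    rwa [mul_pow, Real.sq_sqrt (norm_nonneg _)]
  rcases (norm_nonneg u).eq_or_lt with h | h
  · rw [← h]
    positivity
  · nlinarith [norm_nonneg g]

end Gram

/-! ### Supersymmetric block operators -/

section Block

variable {K K₁ K₂ : Type*} [NormedAddCommGroup K₁] [InnerProductSpace ℂ K₁]
  [NormedAddCommGroup K₂] [InnerProductSpace ℂ K₂]
  [NormedAddCommGroup K] [InnerProductSpace ℂ K]

/-- `T` is the block operator `[[a, A], [A*, -a]]` in `K ≃ K₁ × K₂`, where `Γ` is the graph of
`A : K₂ → K₁`. -/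
structure IsBlockOperator (Γ : Submodule ℂ (K₂ × K₁)) (a : ℝ) (e : K ≃L[ℂ] K₁ × K₂)
    (T : K →ₗ.[ℂ] K) : Prop where
  closed : IsClosed (Γ : Set (K₂ × K₁))
  single : ∀ g, ((0 : K₂), g) ∈ Γ → g = 0
  dense : Dense (Γ.map (LinearMap.fst ℂ K₂ K₁) : Set K₂)
  inner_eq : ∀ x y, inner ℂ x y = inner ℂ (e x).1 (e y).1 + inner ℂ (e x).2 (e y).2
  mem_graph_iff : ∀ x y, (x, y) ∈ T.graph ↔ ∃ g h, ((e x).2, g) ∈ Γ ∧ ((e x).1, h) ∈ Γ.adjoint ∧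
    e y = ((a : ℂ) • (e x).1 + g, h - (a : ℂ) • (e x).2)

namespace IsBlockOperator

variable {Γ : Submodule ℂ (K₂ × K₁)} {a : ℝ} {e : K ≃L[ℂ] K₁ × K₂} {T : K →ₗ.[ℂ] K}
  {L : K₂ →ₗ.[ℂ] K₂}

theorem symm_mem_graph (hT : IsBlockOperator Γ a e T) {x₁ g : K₁} {x₂ h : K₂} (h₂ : (x₂, g) ∈ Γ)
    (h₁ : (x₁, h) ∈ Γ.adjoint) :
    (e.symm (x₁, x₂), e.symm ((a : ℂ) • x₁ + g, h - (a : ℂ) • x₂)) ∈ T.graph := by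
  rw [hT.mem_graph_iff]
  exact ⟨g, h, by simpa using h₂, by simpa using h₁, by simp⟩

theorem exists_of_mem_graph (hT : IsBlockOperator Γ a e T) {x y : K} (h : (x, y) ∈ T.graph) :
    ∃ g k, ((e x).2, g) ∈ Γ ∧ ((e x).1, k) ∈ Γ.adjoint ∧
      (e y).1 = (a : ℂ) • (e x).1 + g ∧ (e y).2 = k - (a : ℂ) • (e x).2 := by
  obtain ⟨g, k, h1, h2, h3⟩ := (hT.mem_graph_iff x y).1 h
  exact ⟨g, k, h1, h2, by rw [h3], by rw [h3]⟩

theorem gram_graph (hT : IsBlockOperator Γ a e T) : (gramGraph Γ).toLinearPMap.graph = gramGraph Γ :=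
  Submodule.toLinearPMap_graph_eq _ (gramGraph_single hT.single hT.dense)

theorem dense_domain [CompleteSpace K] [CompleteSpace K₁] [CompleteSpace K₂]
    (hT : IsBlockOperator Γ a e T) : Dense (T.domain : Set K) := by
  rw [Submodule.dense_iff_topologicalClosure_eq_top, Submodule.topologicalClosure_eq_top_iff,
    Submodule.eq_bot_iff]
  intro x hx
  rw [Submodule.mem_orthogonal] at hx
  have hx' : ∀ x₁ h x₂ g, (x₂, g) ∈ Γ → (x₁, h) ∈ Γ.adjoint →
      inner ℂ x₁ (e x).1 + inner ℂ x₂ (e x).2 = 0 := fun x₁ h x₂ g h₂ h₁ => by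
    have := hx _ (LinearPMap.mem_domain_of_mem_graph (hT.symm_mem_graph h₂ h₁))
    rwa [hT.inner_eq, ContinuousLinearEquiv.apply_symm_apply] at this
  have e2 : (e x).2 = 0 := by
    refine hT.dense.eq_zero_of_inner_right ℂ fun u hu => ?_
    obtain ⟨⟨u', g⟩, hg, rfl⟩ := hu
    simpa using hx' 0 0 _ _ hg (Submodule.zero_mem _)
  have e1 : (e x).1 = 0 := by
    refine hT.single _ (mem_of_forall_adjoint hT.closed fun f k hf => ?_)
    simpa using hx' f k 0 0 Γ.zero_mem hf
  rw [← e.map_eq_zero_iff]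
  exact Prod.ext e1 e2

/-- A block operator is self-adjoint: testing its adjoint with vectors `(f, 0)` and `(0, u)`
separately recovers the two defining conditions of its domain. -/
theorem isSelfAdjoint [CompleteSpace K] [CompleteSpace K₁] [CompleteSpace K₂]
    (hT : IsBlockOperator Γ a e T) : IsSelfAdjoint T := by
  rw [LinearPMap.isSelfAdjoint_def]
  refine LinearPMap.eq_of_eq_graph ?_
  rw [LinearPMap.adjoint_graph_eq_graph_adjoint hT.dense_domain]
  ext ⟨y, z⟩
  constructor
  · intro hyz
    have key : ∀ {x₁ h x₂ g}, (x₂, g) ∈ Γ → (x₁, h) ∈ Γ.adjoint →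
        (a : ℂ) * inner ℂ x₁ (e y).1 + inner ℂ g (e y).1 + (inner ℂ h (e y).2 -
          (a : ℂ) * inner ℂ x₂ (e y).2) = inner ℂ x₁ (e z).1 + inner ℂ x₂ (e z).2 :=
      fun h₂ h₁ => by
        have := inner_eq_of_mem_adjoint (hT.symm_mem_graph h₂ h₁) hyz
        simpa [hT.inner_eq, inner_add_left, inner_sub_left, inner_smul_left] using this
    rw [hT.mem_graph_iff]
    refine ⟨(e z).1 - (a : ℂ) • (e y).1, (e z).2 + (a : ℂ) • (e y).2, ?_, ?_, ?_⟩
    · refine mem_of_forall_adjoint hT.closed fun f k hf => ?_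
      have := key Γ.zero_mem hf
      simp only [inner_zero_left, mul_zero, add_zero, sub_zero] at this
      rw [inner_sub_right, inner_smul_right, ← this]
      ring
    · refine mem_adjoint_of_forall fun u g hu => ?_
      have := key hu (Submodule.zero_mem _)
      simp only [inner_zero_left, mul_zero, zero_add, zero_sub] at this
      rw [inner_add_right, inner_smul_right, ← this]
      ring
    · simp
  · intro hyz
    obtain ⟨g, k, h1, h2, h3, h4⟩ := hT.exists_of_mem_graph hyz
    refine mem_adjoint_of_forall fun x w hxw => ?_
    obtain ⟨g', k', h1', h2', h3', h4'⟩ := hT.exists_of_mem_graph hxw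
    have i1 := inner_eq_of_mem_adjoint h1' h2
    have i2 := congrArg (starRingEnd ℂ) (inner_eq_of_mem_adjoint h1 h2')
    rw [inner_conj_symm, inner_conj_symm] at i2
    rw [hT.inner_eq, hT.inner_eq, h3, h4, h3', h4']
    simp only [inner_add_left, inner_add_right, inner_sub_left, inner_sub_right, inner_smul_left,
      inner_smul_right, Complex.conj_ofReal, i1, ← i2]
    ring

/-- Away from `a`, the spectrum of the block operator is determined by that of `A* A`. -/
theorem isResolventPoint_iff_gram [CompleteSpace K] [CompleteSpace K₁] [CompleteSpace K₂]
    (hT : IsBlockOperator Γ a e T) (hL : L.graph = gramGraph Γ) {z : ℂ} (hz : z ≠ a) :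
    IsResolventPoint T z ↔ IsResolventPoint L (z ^ 2 - (a : ℂ) ^ 2) := by
  have hza : z - a ≠ 0 := sub_ne_zero.2 hz
  constructor
  · intro h
    -- `(A* A - (z² - a²))⁻¹ y` is `(z - a)⁻¹` times the second component of `(T - z)⁻¹ (0, y)`.
    obtain ⟨R, hR1, hR2⟩ := (isResolventPoint_iff T z).1 h
    refine (isResolventPoint_iff L _).2 ⟨(z - a)⁻¹ • ContinuousLinearMap.snd ℂ K₁ K₂ ∘L
      (e : K →L[ℂ] K₁ × K₂) ∘L R ∘L (e.symm : K₁ × K₂ →L[ℂ] K) ∘L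
        ContinuousLinearMap.inr ℂ K₁ K₂, fun y => ?_, fun u v huv => ?_⟩
    · obtain ⟨g, k, h1, h2, h3, h4⟩ := hT.exists_of_mem_graph (hR1 (e.symm (0, y)))
      set x := R (e.symm (0, y))
      simp only [map_add, map_smul, ContinuousLinearEquiv.apply_symm_apply, Prod.fst_add,
        Prod.smul_fst, zero_add, Prod.snd_add, Prod.smul_snd] at h3 h4
      change ((z - a)⁻¹ • (e x).2, y + (z ^ 2 - (a : ℂ) ^ 2) • (z - a)⁻¹ • (e x).2) ∈ L.graph
      rw [hL]
      refine ⟨(z - a)⁻¹ • g, Γ.smul_mem _ h1, ?_⟩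
      have e1 : (z - a)⁻¹ • g = (e x).1 := by
        rw [inv_smul_eq_iff₀ hza, sub_smul, h3, add_sub_cancel_left]
      have e2 : y + (z ^ 2 - (a : ℂ) ^ 2) • (z - a)⁻¹ • (e x).2 = k := by
        rw [smul_smul, show (z ^ 2 - (a : ℂ) ^ 2) * (z - a)⁻¹ = z + a by field_simp; ring,
          add_smul, ← add_assoc, h4, sub_add_cancel]
      rw [e1]
      simp only
      rwa [e2]
    · rw [hL] at huv
      obtain ⟨g, h1, h2⟩ := huv
      have := hR2 _ _ (hT.symm_mem_graph (Γ.smul_mem (z - a) h1) h2)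
      rw [← map_smul, ← map_sub] at this
      have e1 : ((a : ℂ) • g + (z - a) • g, v - (a : ℂ) • (z - a) • u) - z • (g, (z - a) • u) =
          ((0 : K₁), v - (z ^ 2 - (a : ℂ) ^ 2) • u) := by
        refine Prod.ext ?_ ?_ <;> simp only [Prod.fst_sub, Prod.snd_sub, Prod.smul_fst,
          Prod.smul_snd] <;> module
      simp only [Prod.smul_mk] at this e1
      rw [e1] at this
      change (z - a)⁻¹ • (e (R (e.symm (0, v - (z ^ 2 - (a : ℂ) ^ 2) • u)))).2 = u
      rw [this, ContinuousLinearEquiv.apply_symm_apply, inv_smul_smul₀ hza]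
  · intro h
    obtain ⟨B, hB1, hB2⟩ := (isResolventPoint_iff L _).1 h
    rw [hL] at hB1 hB2
    refine isResolventPoint_of_bijective hT.isSelfAdjoint.isClosed z (fun x hx => ?_) fun y => ?_
    · obtain ⟨g, k, h1, h2, h3, h4⟩ := hT.exists_of_mem_graph hx
      simp only [map_smul, Prod.smul_fst, Prod.smul_snd] at h3 h4
      have e1 : g = (z - a) • (e x).1 := by rw [sub_smul, h3, add_sub_cancel_left]
      have e2 : (z - a) • k = (z ^ 2 - (a : ℂ) ^ 2) • (e x).2 := by
        rw [show k = (z + a) • (e x).2 by rw [add_smul, h4, sub_add_cancel], smul_smul]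
        congr 1
        ring
      have e3 := hB2 (e x).2 ((z ^ 2 - (a : ℂ) ^ 2) • (e x).2) ⟨g, h1, by
        rw [e1]; simpa only [Prod.smul_mk, e2] using Γ.adjoint.smul_mem (z - a) h2⟩
      rw [sub_self, map_zero] at e3
      rw [← e3] at h1
      rw [hT.single g h1, eq_comm, smul_eq_zero, or_iff_right hza] at e1
      rw [← e.map_eq_zero_iff]
      exact Prod.ext e1 e3.symm
    -- Since the first component of `y` need not be in the domain of `A*`, the equation
    -- `(T - z) x = y` is solved up to an `L²` error by `v` with `v + A* A v = A* y₁`, and the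
    -- error is removed with `B = (A* A - (z² - a²))⁻¹`.
    · obtain ⟨P, hP⟩ := exists_clm_adjoint_decomposition hT.closed
      obtain ⟨v, g, h1, h2⟩ : ∃ v g, (v, g) ∈ Γ ∧ ((e y).1 - g, v) ∈ Γ.adjoint :=
        ⟨(P (0, (e y).1)).1, (P (0, (e y).1)).2, (hP (0, (e y).1)).1, by
          simpa only [sub_zero] using (hP (0, (e y).1)).2⟩
      set μ := z ^ 2 - (a : ℂ) ^ 2 with hμ
      obtain ⟨g', h3, h4⟩ := hB1 (v + μ • v - (a - z) • (e y).2)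
      set r := B (v + μ • v - (a - z) • (e y).2)
      simp only at h3 h4
      have haz : (a : ℂ) - z ≠ 0 := sub_ne_zero.2 hz.symm
      have h5 := Γ.adjoint.smul_mem (a - z : ℂ)⁻¹ (Γ.adjoint.sub_mem h2 h4)
      have h6 := hT.symm_mem_graph (Γ.add_mem h1 h3) h5
      refine ⟨e.symm ((a - z : ℂ)⁻¹ • ((e y).1 - g - g'), v + r), ?_⟩
      convert! h6 using 2
      conv_lhs => rw [← e.symm_apply_apply y]
      rw [← map_smul, ← map_add]
      congr 1
      refine Prod.ext ?_ ?_
      · simp only [Prod.fst_add, Prod.fst_sub, Prod.smul_mk, e.apply_symm_apply]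
        match_scalars <;> field_simp <;> ring
      · simp only [Prod.snd_add, Prod.snd_sub, Prod.smul_mk, e.apply_symm_apply, hμ]
        match_scalars <;> field_simp <;> ring

/-- If `A` is injective and `a` is in the resolvent set of the block operator, then `0` is in the
resolvent set of `A* A`. -/
theorem isResolventPoint_gram_zero (hT : IsBlockOperator Γ a e T) (hL : L.graph = gramGraph Γ)
    (hinj : ∀ u, (u, (0 : K₁)) ∈ Γ → u = 0) (h : IsResolventPoint T a) : IsResolventPoint L 0 := by
  -- The second component of `(T - a)⁻¹ (y₁, ·)` is `A⁻¹ y₁`, the first component of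
  -- `(T - a)⁻¹ (0, y)` is a preimage of `y` under `A*`; their composition inverts `A* A`.
  obtain ⟨R, hR1, hR2⟩ := (isResolventPoint_iff T a).1 h
  let p₁ := ContinuousLinearMap.fst ℂ K₁ K₂ ∘L (e : K →L[ℂ] K₁ × K₂)
  let p₂ := ContinuousLinearMap.snd ℂ K₁ K₂ ∘L (e : K →L[ℂ] K₁ × K₂)
  let i₁ := (e.symm : K₁ × K₂ →L[ℂ] K) ∘L ContinuousLinearMap.inl ℂ K₁ K₂
  let i₂ := (e.symm : K₁ × K₂ →L[ℂ] K) ∘L ContinuousLinearMap.inr ℂ K₁ K₂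
  have key : ∀ w, ((e (R w)).2, (e w).1) ∈ Γ ∧
      ((e (R w)).1, (e w).2 + (2 * a : ℂ) • (e (R w)).2) ∈ Γ.adjoint := fun w => by
    obtain ⟨g, k, h1, h2, h3, h4⟩ := hT.exists_of_mem_graph (hR1 w)
    simp only [map_add, map_smul, Prod.fst_add, Prod.smul_fst, Prod.snd_add, Prod.smul_snd] at h3 h4
    rw [add_comm, add_right_inj] at h3
    refine ⟨h3 ▸ h1, ?_⟩
    convert! h2 using 2
    rw [eq_sub_iff_add_eq] at h4
    rw [← h4]
    module
  have k1 : ∀ y, (e (R (i₂ y))).2 = 0 := fun y => hinj _ (by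
    simpa [i₂] using (key (i₂ y)).1)
  refine (isResolventPoint_iff L 0).2 ⟨p₂ ∘L R ∘L i₁ ∘L p₁ ∘L R ∘L i₂, fun y => ?_, ?_⟩
  · rw [hL, zero_smul, add_zero]
    refine ⟨(e (R (i₂ y))).1, ?_, ?_⟩
    · simpa [i₁, p₁, p₂] using (key (i₁ (p₁ (R (i₂ y))))).1
    · have := (key (i₂ y)).2
      rw [k1, smul_zero, add_zero] at this
      simpa [i₂] using this
  · intro u v huv
    rw [hL] at huv
    obtain ⟨g, h1, h2⟩ := huv
    have e1 := hR2 _ _ (hT.symm_mem_graph Γ.zero_mem h2)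
    rw [← map_smul, ← map_sub] at e1
    have e2 : R (i₂ v) = e.symm (g, 0) := by
      rw [← e1]
      change R (e.symm (0, v)) = _
      congr 2
      simp
    change (e (R (e.symm ((e (R (i₂ (v - (0 : ℂ) • u)))).1, 0)))).2 = u
    rw [zero_smul, sub_zero, e2, ContinuousLinearEquiv.apply_symm_apply]
    refine sub_eq_zero.1 (hinj _ ?_)
    have := Γ.sub_mem (key (e.symm (g, 0))).1 h1
    simpa using this

/-- Away from `a`, the eigenspaces of the block operator are isomorphic to those of `A* A`. -/
theorem nonempty_eigenspace_equiv (hT : IsBlockOperator Γ a e T) (hL : L.graph = gramGraph Γ)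
    {z : ℂ} (hz : z ≠ a) :
    Nonempty (eigenspace T z ≃ₗ[ℂ] eigenspace L (z ^ 2 - (a : ℂ) ^ 2)) := by
  have hza : z - a ≠ 0 := sub_ne_zero.2 hz
  have key : ∀ x ∈ eigenspace T z, ((e x).2, (z - a) • (e x).1) ∈ Γ ∧
      ((e x).1, (z + a) • (e x).2) ∈ Γ.adjoint := fun x hx => by
    obtain ⟨g, k, h1, h2, h3, h4⟩ := hT.exists_of_mem_graph ((mem_eigenspace_iff T z x).1 hx)
    simp only [map_smul, Prod.smul_fst, Prod.smul_snd] at h3 h4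
    rw [sub_smul, h3, add_sub_cancel_left, add_smul, h4, sub_add_cancel]
    exact ⟨h1, h2⟩
  let f : eigenspace T z →ₗ[ℂ] eigenspace L (z ^ 2 - (a : ℂ) ^ 2) :=
    ((LinearMap.snd ℂ K₁ K₂ ∘ₗ (e : K →L[ℂ] K₁ × K₂).toLinearMap).domRestrict _).codRestrict _
      fun x => by
        rw [mem_eigenspace_iff, hL]
        obtain ⟨h1, h2⟩ := key x.1 x.2
        refine ⟨_, h1, ?_⟩
        have := Γ.adjoint.smul_mem (z - a) h2
        rw [Prod.smul_mk, smul_smul, show (z - a) * (z + a) = z ^ 2 - (a : ℂ) ^ 2 by ring] at this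
        exact this
  refine ⟨LinearEquiv.ofBijective f ⟨?_, ?_⟩⟩
  · rw [injective_iff_map_eq_zero]
    intro x hx
    have hx2 : (e x).2 = 0 := congrArg Subtype.val hx
    have h1 := (key x.1 x.2).1
    rw [hx2] at h1
    have h2 := (smul_eq_zero.1 (hT.single _ h1)).resolve_left hza
    exact Subtype.ext (e.map_eq_zero_iff.1 (Prod.ext h2 hx2))
  · rintro ⟨u, hu⟩
    obtain ⟨g, h1, h2⟩ := by simpa only [mem_eigenspace_iff, hL] using hu
    simp only at h1 h2
    refine ⟨⟨e.symm ((z - a)⁻¹ • g, u), ?_⟩, Subtype.ext ?_⟩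
    · rw [mem_eigenspace_iff]
      convert! hT.symm_mem_graph h1 (Γ.adjoint.smul_mem (z - a)⁻¹ h2) using 2
      rw [← map_smul]
      congr 1
      refine Prod.ext ?_ ?_
      · simp only [Prod.smul_fst]
        match_scalars
        field_simp
        ring
      · simp only [Prod.smul_snd]
        match_scalars
        field_simp
        ring
    · change (e (e.symm ((z - a)⁻¹ • g, u))).2 = u
      simp

/-- If `T x = -a x`, then `A x₂ = -2a x₁` and `A* x₁ = 0`, so that `‖A x₂‖² = 0`. -/
theorem neg_notMem_pointSpectrum (hT : IsBlockOperator Γ a e T)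
    (hinj : ∀ u, (u, (0 : K₁)) ∈ Γ → u = 0) (ha : a ≠ 0) : (-a : ℂ) ∉ pointSpectrum T := by
  refine not_not.2 ((Submodule.eq_bot_iff _).2 fun x hx => ?_)
  obtain ⟨g, k, h1, h2, h3, h4⟩ := hT.exists_of_mem_graph ((mem_eigenspace_iff T _ x).1 hx)
  simp only [neg_smul, map_neg, map_smul, Prod.fst_neg, Prod.snd_neg, Prod.smul_fst,
    Prod.smul_snd] at h3 h4
  have hk : k = 0 := by rw [neg_eq_iff_add_eq_zero, add_sub_cancel] at h4; exact h4
  have hg : g = (-2 * a : ℂ) • (e x).1 := by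
    rw [← sub_eq_iff_eq_add'] at h3
    rw [← h3]
    module
  have h0 : g = 0 := by
    have := inner_eq_of_mem_adjoint h1 (Γ.adjoint.smul_mem (-2 * a : ℂ) h2)
    simp only [← hg, hk, smul_zero, inner_zero_right, inner_self_eq_zero] at this
    exact this
  rw [h0] at h1 hg
  have h5 := (smul_eq_zero.1 hg.symm).resolve_left (by simpa using ha)
  exact e.map_eq_zero_iff.1 (Prod.ext h5 (hinj _ h1))

/-- The eigenvalue `a` has infinite multiplicity if the kernel of `A*` is infinite-dimensional. -/
theorem multiplicity_eq_top (hT : IsBlockOperator Γ a e T)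
    (hker : ¬ FiniteDimensional ℂ (Γ.adjoint.comap (LinearMap.inl ℂ K₁ K₂))) :
    multiplicity T a = ⊤ := by
  rw [multiplicity, Cardinal.toENat_eq_top]
  by_contra hlt
  rw [not_le, Module.rank_lt_aleph0_iff] at hlt
  refine hker ?_
  let f : Γ.adjoint.comap (LinearMap.inl ℂ K₁ K₂) →ₗ[ℂ] eigenspace T a :=
    (((e.symm : K₁ × K₂ →L[ℂ] K).toLinearMap ∘ₗ LinearMap.inl ℂ K₁ K₂).domRestrict _).codRestrict _
      fun x => by
        rw [mem_eigenspace_iff]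
        have := hT.symm_mem_graph Γ.zero_mem x.2
        simpa [← map_smul] using this
  refine FiniteDimensional.of_injective f fun x y hxy => Subtype.ext ?_
  have h1 : e.symm ((x : K₁), (0 : K₂)) = e.symm ((y : K₁), 0) := congrArg Subtype.val hxy
  exact congrArg Prod.fst (e.symm.injective h1)

/-- Either `0` is in the spectrum of `A* A`, where it is not isolated, so that `a` is not isolated
in the spectrum of the block operator; or `A` is bounded from below, and then `a` is an eigenvalue of
infinite multiplicity. -/
theorem mem_essentialSpectrum [CompleteSpace K] [CompleteSpace K₁] [CompleteSpace K₂]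
    (hT : IsBlockOperator Γ a e T) (hinj : ∀ u, (u, (0 : K₁)) ∈ Γ → u = 0) (ha : 0 ≤ a)
    (hker : ∀ C : ℝ, 0 ≤ C → (∀ u g, (u, g) ∈ Γ → ‖u‖ ≤ C * ‖g‖) →
      ¬ FiniteDimensional ℂ (Γ.adjoint.comap (LinearMap.inl ℂ K₁ K₂))) :
    (a : ℂ) ∈ essentialSpectrum T := by
  have hL := hT.gram_graph
  set L := (gramGraph Γ).toLinearPMap
  by_cases h0 : IsResolventPoint L 0
  · obtain ⟨C, hC, hP⟩ := gram_bounded_below hL h0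
    have hm := hT.multiplicity_eq_top (hker C hC hP)
    refine ⟨fun hres => ?_, fun hd => by simpa [hm] using hd.2.1⟩
    obtain ⟨R, -, hR⟩ := (isResolventPoint_iff T a).1 hres
    have : eigenspace T a = ⊥ := (Submodule.eq_bot_iff _).2 fun x hx => by
      rw [← hR _ _ ((mem_eigenspace_iff T _ x).1 hx), sub_self, map_zero]
    rw [multiplicity, this] at hm
    simp at hm
  · refine ⟨fun hres => h0 (hT.isResolventPoint_gram_zero hL hinj hres), fun hd => ?_⟩
    obtain ⟨ε, hε, hball⟩ := hd.2.2
    obtain ⟨R, hR⟩ := exists_gram_resolvent hT.closed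
    obtain ⟨l, hl0, hl, hls⟩ := gram_zero_not_isolated hL hR hinj h0 (ε := ε ^ 2) (by positivity)
    set z : ℝ := √(l + a ^ 2) with hz
    have hz2 : z ^ 2 = l + a ^ 2 := Real.sq_sqrt (by positivity)
    have haz : a < z := Real.lt_sqrt_of_sq_lt (by linarith)
    have hzε : z < a + ε := by
      refine (Real.sqrt_lt' (by linarith)).2 ?_
      nlinarith
    have hmem : (z : ℂ) ∈ spectrum T ∩ Metric.ball (a : ℂ) ε := by
      refine ⟨fun hres => hls ?_, ?_⟩
      · have := (hT.isResolventPoint_iff_gram hL (by exact_mod_cast haz.ne')).1 hres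
        rwa [show ((z : ℂ) ^ 2 - (a : ℂ) ^ 2) = (l : ℂ) by
          rw [← Complex.ofReal_pow, hz2]; push_cast; ring] at this
      · rw [Metric.mem_ball, dist_eq_norm, ← Complex.ofReal_sub, Complex.norm_real,
          Real.norm_of_nonneg (by linarith)]
        linarith
    rw [hball] at hmem
    exact haz.ne' (Complex.ofReal_inj.1 (Set.mem_singleton_iff.1 hmem))

theorem mem_spectrum_iff [CompleteSpace K] [CompleteSpace K₁] [CompleteSpace K₂]
    (hT : IsBlockOperator Γ a e T) (hL : L.graph = gramGraph Γ) (ha : (a : ℂ) ∈ spectrum T) (z : ℂ) :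
    z ∈ spectrum T ↔ z = a ∨ ∃ l : ℝ, (l : ℂ) ∈ spectrum L ∧
      (z = (√(l + a ^ 2) : ℝ) ∨ z = (-√(l + a ^ 2) : ℝ)) := by
  by_cases hz : z = a
  · simp [hz, ha]
  rw [or_iff_right hz]
  obtain ⟨R, hR⟩ := exists_gram_resolvent hT.closed
  have h1 : z ∈ spectrum T ↔ z ^ 2 - (a : ℂ) ^ 2 ∈ spectrum L :=
    not_congr (hT.isResolventPoint_iff_gram hL hz)
  rw [h1]
  constructor
  · intro h
    obtain ⟨l, hl, hzl⟩ := gram_spectrum_nonneg hL hR h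
    refine ⟨l, hzl ▸ h, ?_⟩
    have : (z - (√(l + a ^ 2) : ℝ)) * (z + (√(l + a ^ 2) : ℝ)) = 0 := by
      have h2 : ((√(l + a ^ 2) : ℝ) : ℂ) ^ 2 = l + a ^ 2 := by
        exact_mod_cast Real.sq_sqrt (by positivity : 0 ≤ l + a ^ 2)
      linear_combination hzl - h2
    rcases mul_eq_zero.1 this with h2 | h2
    · exact Or.inl (sub_eq_zero.1 h2)
    · exact Or.inr (by push_cast; exact eq_neg_of_add_eq_zero_left h2)
  · rintro ⟨l, hl, h⟩
    obtain ⟨l', hl', hll⟩ := gram_spectrum_nonneg hL hR hl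
    have hl0 : 0 ≤ l := by rwa [Complex.ofReal_inj.1 hll]
    have h2 : ((√(l + a ^ 2) : ℝ) : ℂ) ^ 2 = l + a ^ 2 := by
      exact_mod_cast Real.sq_sqrt (by positivity : 0 ≤ l + a ^ 2)
    have : z ^ 2 - (a : ℂ) ^ 2 = l := by
      rcases h with rfl | rfl
      · rw [h2]; ring
      · push_cast
        rw [neg_sq, h2]; ring
    rwa [this]

end IsBlockOperator

end Block

/-! ### Multiples of direct sums of an operator -/

section DirectSum

variable {K₂ K₀ : Type} [NormedAddCommGroup K₂] [InnerProductSpace ℂ K₂]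
  [NormedAddCommGroup K₀] [InnerProductSpace ℂ K₀] {ι : Type}
  {L : K₂ →ₗ.[ℂ] K₂} {D : K₀ →ₗ.[ℂ] K₀} {Φ : K₂ ≃L[ℂ] (ι → K₀)} {κ : ℂ}

/-- If `κ⁻¹ L` is a direct sum of copies of `D`, then the spectrum of `L` is `κ` times the spectrum of
`D`. -/
theorem isResolventPoint_directSum_iff [Nonempty ι] (hκ : κ ≠ 0)
    (hD : ∀ u v, (u, κ • v) ∈ L.graph ↔ ∀ i, (Φ u i, Φ v i) ∈ D.graph) (l : ℂ) :
    IsResolventPoint L (κ * l) ↔ IsResolventPoint D l := by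
  classical
  rw [isResolventPoint_iff, isResolventPoint_iff]
  constructor
  · rintro ⟨R, h1, h2⟩
    obtain ⟨i⟩ := ‹Nonempty ι›
    let s := (Φ.symm : (ι → K₀) →L[ℂ] K₂) ∘L ContinuousLinearMap.single ℂ (fun _ : ι => K₀) i
    let p := ContinuousLinearMap.proj (R := ℂ) (φ := fun _ : ι => K₀) i ∘L (Φ : K₂ →L[ℂ] ι → K₀)
    have hps : ∀ x, p (s x) = x := fun x => by simp [p, s]
    refine ⟨κ • p ∘L R ∘L s, fun x => ?_, fun x y hxy => ?_⟩
    · have h := h1 (s x)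
      rw [show s x + (κ * l) • R (s x) = κ • (κ⁻¹ • s x + l • R (s x)) by
        rw [smul_add, smul_inv_smul₀ hκ, smul_smul], hD] at h
      have h' := D.graph.smul_mem κ (h i)
      rw [Prod.smul_mk] at h'
      convert! h' using 2
      change x + l • κ • p (R (s x)) = κ • p (κ⁻¹ • s x + l • R (s x))
      rw [map_add, map_smul, map_smul, hps, smul_add, smul_inv_smul₀ hκ, smul_comm l]
    · have hs : (s x, κ • s y) ∈ L.graph := (hD _ _).2 fun j => by
        by_cases hj : j = i
        · subst hj
          simpa [s] using hxy
        · simp only [s, ContinuousLinearMap.comp_apply, ContinuousLinearEquiv.coe_coe,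
            ContinuousLinearEquiv.apply_symm_apply, ContinuousLinearMap.single_apply,
            Pi.single_eq_of_ne hj]
          exact D.graph.zero_mem
      have h := h2 _ _ hs
      change κ • p (R (s (y - l • x))) = x
      rw [← map_smul, ← map_smul, ← map_smul, smul_sub, smul_smul, map_sub, map_smul, map_smul, h,
        hps]
  · rintro ⟨R, h1, h2⟩
    let Rι : (ι → K₀) →L[ℂ] (ι → K₀) := ContinuousLinearMap.pi fun i => R ∘L ContinuousLinearMap.proj i
    refine ⟨κ⁻¹ • (Φ.symm : (ι → K₀) →L[ℂ] K₂) ∘L Rι ∘L (Φ : K₂ →L[ℂ] ι → K₀), fun x => ?_,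
      fun u v huv => ?_⟩
    · change (κ⁻¹ • Φ.symm (Rι (Φ x)), x + (κ * l) • κ⁻¹ • Φ.symm (Rι (Φ x))) ∈ _
      rw [show x + (κ * l) • κ⁻¹ • Φ.symm (Rι (Φ x)) = κ • (κ⁻¹ • (x + l • Φ.symm (Rι (Φ x)))) by
        rw [smul_inv_smul₀ hκ, smul_smul, mul_right_comm, mul_inv_cancel₀ hκ, one_mul], hD]
      intro i
      have := D.graph.smul_mem κ⁻¹ (h1 (Φ x i))
      simpa [Rι] using this
    · rw [← smul_inv_smul₀ hκ v, hD] at huv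
      change κ⁻¹ • Φ.symm (Rι (Φ (v - (κ * l) • u))) = u
      rw [← map_smul, ← map_smul, Φ.symm_apply_eq, ← map_smul]
      funext i
      have := h2 _ _ (huv i)
      change R (Φ (κ⁻¹ • (v - (κ * l) • u)) i) = Φ u i
      rw [← this]
      congr 1
      rw [smul_sub, smul_smul, inv_mul_cancel_left₀ hκ, map_sub, map_smul _ l]
      rfl

theorem nonempty_eigenspace_directSum_equiv
    (hD : ∀ u v, (u, κ • v) ∈ L.graph ↔ ∀ i, (Φ u i, Φ v i) ∈ D.graph) (l : ℂ) :
    Nonempty (eigenspace L (κ * l) ≃ₗ[ℂ] (ι → eigenspace D l)) := by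
  have key : ∀ u, u ∈ eigenspace L (κ * l) ↔ ∀ i, Φ u i ∈ eigenspace D l := fun u => by
    simp only [mem_eigenspace_iff]
    rw [mul_smul, hD]
    simp
  refine ⟨LinearEquiv.ofBijective
    (LinearMap.pi fun i => ((LinearMap.proj i ∘ₗ (Φ : K₂ →L[ℂ] ι → K₀).toLinearMap).domRestrict
      _).codRestrict _ fun u => (key u).1 u.2 i) ⟨?_, ?_⟩⟩
  · intro u v huv
    refine Subtype.ext (Φ.injective (funext fun i => ?_))
    exact congrArg (fun w : ι → eigenspace D l => (w i : K₀)) huv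
  · intro w
    refine ⟨⟨Φ.symm fun i => w i, (key _).2 fun i => ?_⟩, ?_⟩
    · rw [ContinuousLinearEquiv.apply_symm_apply]
      exact (w i).2
    · funext i
      refine Subtype.ext ?_
      change Φ (Φ.symm fun i => (w i : K₀)) i = w i
      rw [ContinuousLinearEquiv.apply_symm_apply]

end DirectSum

section Conclusion

variable {K K₁ K₂ K₀ : Type} [NormedAddCommGroup K₁] [InnerProductSpace ℂ K₁]
  [NormedAddCommGroup K₂] [InnerProductSpace ℂ K₂]
  [NormedAddCommGroup K] [InnerProductSpace ℂ K]
  [NormedAddCommGroup K₀] [InnerProductSpace ℂ K₀]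
  [CompleteSpace K] [CompleteSpace K₁] [CompleteSpace K₂] {ι : Type} [Fintype ι] [Nonempty ι]

/-- The spectral properties of a block operator `[[mc², A], [A*, -mc²]]` for which `c⁻² A* A` is a
finite direct sum of copies of an operator `D`. -/
theorem IsBlockOperator.spectral_properties {Γ : Submodule ℂ (K₂ × K₁)} {e : K ≃L[ℂ] K₁ × K₂}
    {T : K →ₗ.[ℂ] K} {D : K₀ →ₗ.[ℂ] K₀} {m c : ℝ} (hm : 0 ≤ m) (hc : 0 < c)
    (hT : IsBlockOperator Γ (m * c ^ 2) e T) (hinj : ∀ u, (u, (0 : K₁)) ∈ Γ → u = 0)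
    (hker : ∀ C : ℝ, 0 ≤ C → (∀ u g, (u, g) ∈ Γ → ‖u‖ ≤ C * ‖g‖) →
      ¬ FiniteDimensional ℂ (Γ.adjoint.comap (LinearMap.inl ℂ K₁ K₂)))
    (Φ : K₂ ≃L[ℂ] (ι → K₀))
    (hD : ∀ u v, (u, ((c ^ 2 : ℝ) : ℂ) • v) ∈ gramGraph Γ ↔ ∀ i, (Φ u i, Φ v i) ∈ D.graph) :
    IsSelfAdjoint T ∧
      spectrum T = {((m * c ^ 2 : ℝ) : ℂ)} ∪ {z | ∃ l : ℝ, (l : ℂ) ∈ spectrum D ∧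
        (z = ((c * √(l + (m * c) ^ 2) : ℝ) : ℂ) ∨ z = ((-(c * √(l + (m * c) ^ 2)) : ℝ) : ℂ))} ∧
      ((m * c ^ 2 : ℝ) : ℂ) ∈ essentialSpectrum T ∧
      (m ≠ 0 → ((-(m * c ^ 2) : ℝ) : ℂ) ∉ pointSpectrum T) ∧
      ∀ l : ℝ, 0 < l → ∀ E : ℝ, (E = c * √(l + (m * c) ^ 2) ∨ E = -(c * √(l + (m * c) ^ 2))) →
        ((E : ℂ) ∈ pointSpectrum T ↔ (l : ℂ) ∈ pointSpectrum D) ∧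
        multiplicity T E = Fintype.card ι * multiplicity D l := by
  have hL := hT.gram_graph
  set L := (gramGraph Γ).toLinearPMap
  have hκ : ((c ^ 2 : ℝ) : ℂ) ≠ 0 := by exact_mod_cast (pow_pos hc 2).ne'
  rw [← hL] at hD
  have hess := hT.mem_essentialSpectrum hinj (by positivity) hker
  have hsqrt : ∀ l : ℝ, √(c ^ 2 * l + (m * c ^ 2) ^ 2) = c * √(l + (m * c) ^ 2) := fun l => by
    rw [show c ^ 2 * l + (m * c ^ 2) ^ 2 = c ^ 2 * (l + (m * c) ^ 2) by ring,
      Real.sqrt_mul (by positivity), Real.sqrt_sq hc.le]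
  have hspec : ∀ l : ℝ, ((c ^ 2 * l : ℝ) : ℂ) ∈ spectrum L ↔ (l : ℂ) ∈ spectrum D := fun l => by
    rw [Complex.ofReal_mul]
    exact not_congr (isResolventPoint_directSum_iff hκ hD l)
  refine ⟨hT.isSelfAdjoint, ?_, hess, fun hm0 => ?_, fun l hl E hE => ?_⟩
  · ext z
    rw [hT.mem_spectrum_iff hL hess.1]
    refine or_congr Iff.rfl ⟨?_, ?_⟩
    · rintro ⟨l, hl, h⟩
      have hcl : c ^ 2 * (l / c ^ 2) = l := by field_simp
      refine ⟨l / c ^ 2, (hspec _).1 (hcl.symm ▸ hl), ?_⟩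
      rwa [← hsqrt, hcl]
    · rintro ⟨l, hl, h⟩
      exact ⟨c ^ 2 * l, (hspec l).2 hl, by rwa [hsqrt]⟩
  · rw [Complex.ofReal_neg]
    exact hT.neg_notMem_pointSpectrum hinj (by positivity)
  · have hE2 : E ^ 2 = c ^ 2 * l + (m * c ^ 2) ^ 2 := by
      rw [← hsqrt] at hE
      have h0 : 0 ≤ c ^ 2 * l + (m * c ^ 2) ^ 2 := by positivity
      rcases hE with rfl | rfl
      · exact Real.sq_sqrt h0
      · rw [neg_sq, Real.sq_sqrt h0]
    have hne : (E : ℂ) ≠ ((m * c ^ 2 : ℝ) : ℂ) := fun h => by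
      have h1 : 0 < c ^ 2 * l := by positivity
      rw [Complex.ofReal_inj.1 h] at hE2
      linarith
    obtain ⟨e1⟩ := hT.nonempty_eigenspace_equiv hL hne
    rw [show (E : ℂ) ^ 2 - ((m * c ^ 2 : ℝ) : ℂ) ^ 2 = ((c ^ 2 : ℝ) : ℂ) * l by
      rw [← Complex.ofReal_pow, hE2]; push_cast; ring] at e1
    obtain ⟨e2⟩ := nonempty_eigenspace_directSum_equiv hD l
    have e3 := e1.trans e2
    constructor
    · change eigenspace T E ≠ ⊥ ↔ eigenspace D l ≠ ⊥
      rw [← Submodule.nontrivial_iff_ne_bot, ← Submodule.nontrivial_iff_ne_bot,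
        e3.toEquiv.nontrivial_congr]
      obtain ⟨i⟩ := ‹Nonempty ι›
      constructor
      · intro h
        by_contra hn
        rw [not_nontrivial_iff_subsingleton] at hn
        exact not_subsingleton (ι → eigenspace D l) inferInstance
      · intro h
        infer_instance
    · rw [multiplicity, multiplicity, e3.rank_eq, rank_fun, map_mul, map_natCast]

end Conclusion

/-! ### Integration by parts and multiplication in `H¹₀` -/

section SmoothFunctions

variable {d : ℕ} {V W : Type*} [NormedAddCommGroup V] [NormedSpace ℂ V]
  [NormedAddCommGroup W] [NormedSpace ℂ W]

/-- Smooth compactly supported functions on the whole space `ℝᵈ`; in contrast to the test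
functions `𝓓(Ω, V)` their support may leave `Ω`. -/
def IsSmoothCompact {V : Type*} [NormedAddCommGroup V] [NormedSpace ℝ V] (ψ : Euc d → V) : Prop :=
  ContDiff ℝ ((⊤ : ℕ∞) : WithTop ℕ∞) ψ ∧ HasCompactSupport ψ

theorem isSmoothCompact_test {Ω : Opens (Euc d)} (φ : 𝓓(Ω, V)) : IsSmoothCompact (φ : Euc d → V) :=
  ⟨φ.contDiff, φ.hasCompactSupport⟩

namespace IsSmoothCompact

theorem differentiable {V : Type*} [NormedAddCommGroup V] [NormedSpace ℝ V] {ψ : Euc d → V}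
    (h : IsSmoothCompact ψ) : Differentiable ℝ ψ :=
  h.1.differentiable (by simp)

theorem pderiv {V : Type*} [NormedAddCommGroup V] [NormedSpace ℝ V] {ψ : Euc d → V}
    (h : IsSmoothCompact ψ) (j : Fin d) : IsSmoothCompact (pderiv j ψ) :=
  ⟨(h.1.fderiv_right (m := ((⊤ : ℕ∞) : WithTop ℕ∞)) (by simp)).clm_apply contDiff_const,
    h.2.fderiv_apply ℝ _⟩

theorem memLp {ψ : Euc d → V} (h : IsSmoothCompact ψ) (Ω : Opens (Euc d)) :
    MemLp ψ 2 (volume.restrict (Ω : Set (Euc d))) :=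
  h.1.continuous.memLp_of_hasCompactSupport h.2

theorem clm_comp {ψ : Euc d → V} (h : IsSmoothCompact ψ) (L : V →L[ℂ] W) :
    IsSmoothCompact fun x => L (ψ x) :=
  ⟨(L.restrictScalars ℝ).contDiff.comp h.1, h.2.comp_left (map_zero L)⟩

theorem smul_const {g : Euc d → ℝ} (h : IsSmoothCompact g) (χ : V) :
    IsSmoothCompact fun x => g x • χ :=
  ⟨h.1.smul contDiff_const, h.2.smul_right⟩

/-- The restriction to `Ω`, as an element of `L²(Ω; V)`. -/
def toL2 {ψ : Euc d → V} (h : IsSmoothCompact ψ) (Ω : Opens (Euc d)) : L2 Ω V :=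
  (h.memLp Ω).toLp ψ

theorem coeFn_toL2 {ψ : Euc d → V} (h : IsSmoothCompact ψ) (Ω : Opens (Euc d)) :
    h.toL2 Ω =ᵐ[volume.restrict (Ω : Set (Euc d))] ψ :=
  (h.memLp Ω).coeFn_toLp

end IsSmoothCompact

theorem pderiv_clm_comp {ψ : Euc d → V} (h : IsSmoothCompact ψ) (L : V →L[ℂ] W) (j : Fin d) :
    pderiv j (fun x => L (ψ x)) = fun x => L (pderiv j ψ x) := by
  funext x
  have := ((L.restrictScalars ℝ).hasFDerivAt.comp x (h.differentiable x).hasFDerivAt).fderiv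
  change fderiv ℝ (fun x => L (ψ x)) x = _ at this
  rw [pderiv, this]
  rfl

theorem pderiv_smul {V : Type*} [NormedAddCommGroup V] [NormedSpace ℝ V] {h : Euc d → ℝ} {ψ : Euc d → V} {x : Euc d} (hh : DifferentiableAt ℝ h x)
    (hψ : DifferentiableAt ℝ ψ x) (j : Fin d) :
    pderiv j (fun x => h x • ψ x) x = pderiv j h x • ψ x + h x • pderiv j ψ x := by
  rw [pderiv, fderiv_fun_smul hh hψ, add_comm]
  rfl

theorem pderiv_comm {ψ : Euc d → V} (h : IsSmoothCompact ψ) (j k : Fin d) :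
    pderiv j (pderiv k ψ) = pderiv k (pderiv j ψ) := by
  funext x
  have hd : DifferentiableAt ℝ (fderiv ℝ ψ) x :=
    (h.1.fderiv_right (m := 1) (WithTop.coe_le_coe.2 le_top)).differentiable (by simp) x
  have key : ∀ j k : Fin d, pderiv j (pderiv k ψ) x =
      fderiv ℝ (fderiv ℝ ψ) x (EuclideanSpace.single j 1) (EuclideanSpace.single k 1) :=
    fun j k => by
      change fderiv ℝ (fun y => fderiv ℝ ψ y (EuclideanSpace.single k 1)) x _ = _
      rw [fderiv_clm_apply hd (differentiableAt_const _)]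
      simp
  rw [key, key]
  exact (h.1.contDiffAt.isSymmSndFDerivAt (by
    simpa using WithTop.coe_le_coe.2 (le_top : (2 : ℕ∞) ≤ ⊤))).eq _ _

end SmoothFunctions

section Pointwise

variable {d : ℕ} {Ω : Opens (Euc d)} {V W U : Type*} [NormedAddCommGroup V] [NormedSpace ℂ V]
  [NormedAddCommGroup W] [NormedSpace ℂ W] [NormedAddCommGroup U] [NormedSpace ℂ U]

theorem coeFn_pointwise (L : V →L[ℂ] W) (f : L2 Ω V) :
    pointwise Ω L f =ᵐ[volume.restrict (Ω : Set (Euc d))] fun x => L (f x) :=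
  L.coeFn_compLpL (p := 2) f

theorem continuous_pointwise (L : V →L[ℂ] W) : Continuous (pointwise Ω L) :=
  (L.compLpL 2 (volume.restrict (Ω : Set (Euc d)))).continuous

theorem pointwise_pointwise (M : W →L[ℂ] U) (L : V →L[ℂ] W) (f : L2 Ω V) :
    pointwise Ω M (pointwise Ω L f) = pointwise Ω (M ∘L L) f := by
  refine Lp.ext ?_
  filter_upwards [coeFn_pointwise M (pointwise Ω L f), coeFn_pointwise L f,
    coeFn_pointwise (M ∘L L) f] with x h1 h2 h3
  rw [h1, h2, h3]
  rfl

theorem pointwise_id (f : L2 Ω V) : pointwise Ω (ContinuousLinearMap.id ℂ V) f = f := by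
  refine Lp.ext ?_
  filter_upwards [coeFn_pointwise (ContinuousLinearMap.id ℂ V) f] with x h1
  rw [h1]
  rfl

theorem pointwise_zero (f : L2 Ω V) : pointwise Ω (0 : V →L[ℂ] W) f = 0 := by
  refine Lp.ext ?_
  filter_upwards [coeFn_pointwise (0 : V →L[ℂ] W) f, Lp.coeFn_zero W 2 _] with x h1 h2
  rw [h1, h2]
  rfl

theorem pointwise_add (L M : V →L[ℂ] W) (f : L2 Ω V) :
    pointwise Ω (L + M) f = pointwise Ω L f + pointwise Ω M f := by
  refine Lp.ext ?_
  filter_upwards [coeFn_pointwise (L + M) f, coeFn_pointwise L f, coeFn_pointwise M f,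
    Lp.coeFn_add (pointwise Ω L f) (pointwise Ω M f)] with x h1 h2 h3 h4
  rw [h1, h4, Pi.add_apply, h2, h3]
  rfl

theorem pointwise_smul (a : ℂ) (L : V →L[ℂ] W) (f : L2 Ω V) :
    pointwise Ω (a • L) f = a • pointwise Ω L f := by
  refine Lp.ext ?_
  filter_upwards [coeFn_pointwise (a • L) f, coeFn_pointwise L f,
    Lp.coeFn_smul a (pointwise Ω L f)] with x h1 h2 h3
  rw [h1, h3, Pi.smul_apply, h2]
  rfl

theorem pointwise_toL2 (L : V →L[ℂ] W) {ψ : Euc d → V} (h : IsSmoothCompact ψ) :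
    pointwise Ω L (h.toL2 Ω) = (h.clm_comp L).toL2 Ω := by
  refine Lp.ext ?_
  filter_upwards [coeFn_pointwise L (h.toL2 Ω), h.coeFn_toL2 Ω, (h.clm_comp L).coeFn_toL2 Ω]
    with x h1 h2 h3
  rw [h1, h2, h3]

theorem toL2_pderiv_clm_comp (L : V →L[ℂ] W) {ψ : Euc d → V} (h : IsSmoothCompact ψ) (j : Fin d) :
    ((h.clm_comp L).pderiv j).toL2 Ω = pointwise Ω L ((h.pderiv j).toL2 Ω) := by
  rw [pointwise_toL2]
  refine Lp.ext ?_
  filter_upwards [((h.clm_comp L).pderiv j).coeFn_toL2 Ω, ((h.pderiv j).clm_comp L).coeFn_toL2 Ω]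
    with x h1 h2
  rw [h1, h2, pderiv_clm_comp h]

/-- A pointwise linear map acts on `H¹₀`. -/
theorem H10Graph_pointwise (L : V →L[ℂ] W) {w : L2 Ω V} {p : Fin d → L2 Ω V}
    (h : (w, p) ∈ H10Graph Ω V) : (pointwise Ω L w, fun j => pointwise Ω L (p j)) ∈ H10Graph Ω W := by
  let F : L2 Ω V × (Fin d → L2 Ω V) → L2 Ω W × (Fin d → L2 Ω W) :=
    fun v => (pointwise Ω L v.1, fun j => pointwise Ω L (v.2 j))
  have hF : Continuous F := ((continuous_pointwise L).comp continuous_fst).prodMk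
    (continuous_pi fun j => (continuous_pointwise L).comp
      ((continuous_apply j).comp continuous_snd))
  refine map_mem_closure (f := F) hF h ?_
  rintro ⟨v, q⟩ ⟨φ, h1, h2⟩
  have hφ := (isSmoothCompact_test φ).clm_comp L
  refine ⟨⟨fun x => L (φ x), hφ.1, hφ.2, (closure_mono
    (Function.support_comp_subset (map_zero L) φ)).trans φ.tsupport_subset⟩, ?_, fun j => ?_⟩
  · filter_upwards [coeFn_pointwise L v, h1] with x e1 e2
    simp only [F, e1, e2]
    rfl
  · filter_upwards [coeFn_pointwise L (q j), h2 j] with x e1 e2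
    simp only [F, e1, e2]
    change _ = pderiv j (fun x => L (φ x)) x
    rw [pderiv_clm_comp (isSmoothCompact_test φ)]

/-- Multiplication by a bounded continuous real function, as a bounded operator in `L²(Ω; V)`. -/
def mulL2 (Ω : Opens (Euc d)) (V : Type*) [NormedAddCommGroup V] [NormedSpace ℂ V] {h : Euc d → ℝ}
    (hc : Continuous h) {C : ℝ} (hb : ∀ x, |h x| ≤ C) : L2 Ω V →L[ℂ] L2 Ω V :=
  (ContinuousLinearMap.lsmul ℂ ℂ (E := V)).holderL (volume.restrict (Ω : Set (Euc d))) ⊤ 2 2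
    ((memLp_top_of_bound (Complex.continuous_ofReal.comp hc).aestronglyMeasurable C
      (Filter.Eventually.of_forall fun x => by
        rw [Function.comp_apply, Complex.norm_real]; exact hb x)).toLp _)

theorem coeFn_mulL2 {h : Euc d → ℝ} (hc : Continuous h) {C : ℝ} (hb : ∀ x, |h x| ≤ C) (f : L2 Ω V) :
    mulL2 Ω V hc hb f =ᵐ[volume.restrict (Ω : Set (Euc d))] fun x => h x • f x := by
  refine (ContinuousLinearMap.coeFn_holder (r := 2) _ _ f).trans ?_
  filter_upwards [(memLp_top_of_bound (μ := volume.restrict (Ω : Set (Euc d)))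
    (Complex.continuous_ofReal.comp hc).aestronglyMeasurable C
      (Filter.Eventually.of_forall fun x => by
        rw [Function.comp_apply, Complex.norm_real]; exact hb x)).coeFn_toLp] with x e1
  rw [e1]
  simp

/-- The product rule in `H¹₀`: multiplication by a smooth function `h` that is bounded together
with its first derivatives. -/
theorem H10Graph_mul {h : Euc d → ℝ} (hs : ContDiff ℝ ((⊤ : ℕ∞) : WithTop ℕ∞) h) {C : ℝ}
    (hb : ∀ x, |h x| ≤ C) (hc' : ∀ j, Continuous (pderiv j h)) (hb' : ∀ j x, |pderiv j h x| ≤ C)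
    {w : L2 Ω V} {p : Fin d → L2 Ω V} (hw : (w, p) ∈ H10Graph Ω V) :
    (mulL2 Ω V hs.continuous hb w,
      fun j => mulL2 Ω V (hc' j) (hb' j) w + mulL2 Ω V hs.continuous hb (p j)) ∈ H10Graph Ω V := by
  let F : L2 Ω V × (Fin d → L2 Ω V) → L2 Ω V × (Fin d → L2 Ω V) :=
    fun v => (mulL2 Ω V hs.continuous hb v.1,
      fun j => mulL2 Ω V (hc' j) (hb' j) v.1 + mulL2 Ω V hs.continuous hb (v.2 j))
  have hF : Continuous F := by fun_prop
  refine map_mem_closure (f := F) hF hw ?_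
  rintro ⟨v, q⟩ ⟨φ, h1, h2⟩
  refine ⟨⟨fun x => h x • φ x, hs.smul φ.contDiff, φ.hasCompactSupport.smul_left,
    (closure_mono (Function.support_smul_subset_right h φ)).trans φ.tsupport_subset⟩,
    ?_, fun j => ?_⟩
  · filter_upwards [coeFn_mulL2 (V := V) hs.continuous hb v, h1] with x e1 e2
    simp only [F, e1, e2]
    rfl
  · filter_upwards [coeFn_mulL2 (V := V) hs.continuous hb (q j), coeFn_mulL2 (V := V) (hc' j) (hb' j) v,
      h1, h2 j, Lp.coeFn_add (mulL2 Ω V (hc' j) (hb' j) v) (mulL2 Ω V hs.continuous hb (q j))]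
      with x e1 e2 e3 e4 e5
    simp only [F, e5, Pi.add_apply, e1, e2, e3, e4]
    exact (pderiv_smul (hs.differentiable (by simp) x)
      (φ.contDiff.differentiable (by simp) x) j).symm

end Pointwise

section Inner

variable {d : ℕ} {Ω : Opens (Euc d)} {V : Type*} [NormedAddCommGroup V] [InnerProductSpace ℂ V]

/-- Integration by parts of an `H¹₀` function against a smooth function that need not vanish on
the boundary of `Ω`. -/
theorem H10Graph_inner_toL2 {ψ : Euc d → V} (hψ : IsSmoothCompact ψ) {w : L2 Ω V}
    {p : Fin d → L2 Ω V} (hw : (w, p) ∈ H10Graph Ω V) (j : Fin d) :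
    inner ℂ ((hψ.pderiv j).toL2 Ω) w = -inner ℂ (hψ.toL2 Ω) (p j) := by
  have hclosed : IsClosed {v : L2 Ω V × (Fin d → L2 Ω V) |
      inner ℂ ((hψ.pderiv j).toL2 Ω) v.1 = -inner ℂ (hψ.toL2 Ω) (v.2 j)} :=
    isClosed_eq (by fun_prop) (by fun_prop)
  refine closure_minimal (s := (testGraph Ω V : Set (L2 Ω V × (Fin d → L2 Ω V)))) ?_ hclosed hw
  rintro ⟨v, q⟩ ⟨φ, h1, h2⟩
  have hφ := isSmoothCompact_test φ
  have e1 : inner ℂ ((hψ.pderiv j).toL2 Ω) v = ∫ x, inner ℂ (pderiv j ψ x) (φ x) := by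
    rw [L2.inner_def]
    refine (integral_congr_ae ?_).trans
      (setIntegral_eq_integral_of_forall_compl_eq_zero (s := (Ω : Set (Euc d))) ?_)
    · filter_upwards [(hψ.pderiv j).coeFn_toL2 Ω, h1] with x e1 e2
      rw [e1, e2]
    · intro x hx
      rw [image_eq_zero_of_notMem_tsupport fun h' => hx (φ.tsupport_subset h'), inner_zero_right]
  have e2 : inner ℂ (hψ.toL2 Ω) (q j) = ∫ x, inner ℂ (ψ x) (pderiv j φ x) := by
    rw [L2.inner_def]
    refine (integral_congr_ae ?_).trans
      (setIntegral_eq_integral_of_forall_compl_eq_zero (s := (Ω : Set (Euc d))) ?_)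
    · filter_upwards [hψ.coeFn_toL2 Ω, h2 j] with x e1 e2
      rw [e1, e2]
    · intro x hx
      have : pderiv j φ x = 0 := by
        rw [pderiv, image_eq_zero_of_notMem_tsupport fun h' =>
          hx (φ.tsupport_subset (tsupport_fderiv_subset ℝ h'))]
        rfl
      rw [this, inner_zero_right]
  rw [Set.mem_ofPred_eq, e1, e2, eq_neg_iff_add_eq_zero, add_comm, ← eq_neg_iff_add_eq_zero]
  let B : V →L[ℝ] V →L[ℝ] ℂ :=
    (isBoundedBilinearMap_inner (𝕜 := ℂ) (E := V)).toContinuousLinearMap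
  have hi : ∀ {f g : Euc d → V}, IsSmoothCompact f → IsSmoothCompact g →
      Integrable (fun x => B (f x) (g x)) := fun {f g} hf hg => by
    refine Continuous.integrable_of_hasCompactSupport ?_ ?_
    · exact Continuous.inner hf.1.continuous hg.1.continuous
    · exact hg.2.mono' (fun x hx => subset_tsupport _ fun h0 => hx (by
        change inner ℂ (f x) (g x) = 0
        rw [h0, inner_zero_right]))
  exact integral_bilinear_fderiv_right_eq_neg_left_of_integrable (B := B)
    (hi (hψ.pderiv j) hφ) (hi hψ (hφ.pderiv j)) (hi hψ hφ) (fun x _ => hψ.differentiable x)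
    (fun x _ => hφ.differentiable x)

theorem H10Graph_inner {w v : L2 Ω V} {p q : Fin d → L2 Ω V} (hw : (w, p) ∈ H10Graph Ω V)
    (hv : (v, q) ∈ H10Graph Ω V) (j : Fin d) : inner ℂ (q j) w = -inner ℂ v (p j) := by
  have hclosed : IsClosed {v : L2 Ω V × (Fin d → L2 Ω V) |
      inner ℂ (v.2 j) w = -inner ℂ v.1 (p j)} :=
    isClosed_eq (by fun_prop) (by fun_prop)
  refine closure_minimal (s := (testGraph Ω V : Set (L2 Ω V × (Fin d → L2 Ω V)))) ?_ hclosed hv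
  rintro ⟨u, r⟩ ⟨φ, h1, h2⟩
  have hφ := isSmoothCompact_test φ
  have e1 : u = hφ.toL2 Ω := Lp.ext (h1.trans (hφ.coeFn_toL2 Ω).symm)
  have e2 : r j = (hφ.pderiv j).toL2 Ω := Lp.ext ((h2 j).trans ((hφ.pderiv j).coeFn_toL2 Ω).symm)
  simp only [Set.mem_ofPred_eq, e1, e2]
  exact H10Graph_inner_toL2 hφ hw j

theorem toL2_mem_H10Graph (φ : 𝓓(Ω, V)) : ((isSmoothCompact_test φ).toL2 Ω,
    fun j => ((isSmoothCompact_test φ).pderiv j).toL2 Ω) ∈ H10Graph Ω V :=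
  Submodule.le_topologicalClosure _ ⟨φ, (isSmoothCompact_test φ).coeFn_toL2 Ω,
    fun j => ((isSmoothCompact_test φ).pderiv j).coeFn_toL2 Ω⟩

/-- A closed condition on `H¹₀` may be checked on test functions. -/
theorem H10Graph_induction {P : L2 Ω V → (Fin d → L2 Ω V) → Prop}
    (hP : IsClosed {v : L2 Ω V × (Fin d → L2 Ω V) | P v.1 v.2})
    (h : ∀ φ : 𝓓(Ω, V), P ((isSmoothCompact_test φ).toL2 Ω)
      fun j => ((isSmoothCompact_test φ).pderiv j).toL2 Ω)
    {w : L2 Ω V} {p : Fin d → L2 Ω V} (hw : (w, p) ∈ H10Graph Ω V) : P w p := by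
  refine closure_minimal (s := (testGraph Ω V : Set (L2 Ω V × (Fin d → L2 Ω V)))) ?_ hP hw
  rintro ⟨u, r⟩ ⟨φ, h1, h2⟩
  have hφ := isSmoothCompact_test φ
  have e1 : u = hφ.toL2 Ω := Lp.ext (h1.trans (hφ.coeFn_toL2 Ω).symm)
  have e2 : r = fun j => (hφ.pderiv j).toL2 Ω :=
    funext fun j => Lp.ext ((h2 j).trans ((hφ.pderiv j).coeFn_toL2 Ω).symm)
  rw [e1, e2]
  exact h φ

theorem inner_pointwise [CompleteSpace V] (L : V →L[ℂ] V) (f g : L2 Ω V) :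
    inner ℂ (pointwise Ω L f) g = inner ℂ f (pointwise Ω (ContinuousLinearMap.adjoint L) g) := by
  rw [L2.inner_def, L2.inner_def]
  refine integral_congr_ae ?_
  filter_upwards [coeFn_pointwise L f, coeFn_pointwise (ContinuousLinearMap.adjoint L) g]
    with x h1 h2
  rw [h1, h2, ContinuousLinearMap.adjoint_inner_right]

/-- The bounded function `arctan xⱼ`, with bounded derivatives. -/
def arctanCoord (j : Fin d) (x : Euc d) : ℝ := Real.arctan (x j)

theorem contDiff_arctanCoord (j : Fin d) {n : WithTop ℕ∞} : ContDiff ℝ n (arctanCoord j) :=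
  Real.contDiff_arctan.comp (EuclideanSpace.proj (𝕜 := ℝ) j).contDiff

theorem abs_arctanCoord_le (j : Fin d) (x : Euc d) : |arctanCoord j x| ≤ 2 := by
  have h1 := Real.arctan_lt_pi_div_two (x j)
  have h2 := Real.neg_pi_div_two_lt_arctan (x j)
  have h3 := Real.pi_le_four
  rw [arctanCoord, abs_le]
  constructor <;> linarith

theorem pderiv_arctanCoord (j k : Fin d) (x : Euc d) :
    pderiv k (arctanCoord j) x = if j = k then (1 + x j ^ 2)⁻¹ else 0 := by
  have h := (Real.hasDerivAt_arctan (x j)).comp_hasFDerivAt x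
    (EuclideanSpace.proj (𝕜 := ℝ) j).hasFDerivAt
  have e : fderiv ℝ (arctanCoord j) x = _ := h.fderiv
  rw [pderiv, e]
  simp

theorem abs_pderiv_arctanCoord_le (j k : Fin d) (x : Euc d) :
    |pderiv k (arctanCoord j) x| ≤ 2 := by
  rw [pderiv_arctanCoord]
  split_ifs
  · rw [abs_of_nonneg (by positivity)]
    refine (inv_le_one_of_one_le₀ ?_).trans one_le_two
    nlinarith [sq_nonneg (x j)]
  · simp

theorem continuous_pderiv_arctanCoord (j k : Fin d) : Continuous (pderiv k (arctanCoord j)) :=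
  ((contDiff_arctanCoord j (n := 1)).continuous_fderiv one_ne_zero).clm_apply continuous_const

/-- A function of `H¹₀` with vanishing gradient is zero. With `θ = arctan xⱼ`, integration by parts
gives `∫ ∂ⱼθ |w|² = 0`. -/
theorem eq_zero_of_grad_eq_zero (j : Fin d) {w : L2 Ω V}
    (hw : (w, (0 : Fin d → L2 Ω V)) ∈ H10Graph Ω V) : w = 0 := by
  have h := H10Graph_inner hw (H10Graph_mul (contDiff_arctanCoord j) (abs_arctanCoord_le j)
    (continuous_pderiv_arctanCoord j) (abs_pderiv_arctanCoord_le j) hw) j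
  simp only [Pi.zero_apply, map_zero, add_zero, inner_zero_right, neg_zero] at h
  set m := mulL2 Ω V (continuous_pderiv_arctanCoord j j) (abs_pderiv_arctanCoord_le j j) w
  have hm : m =ᵐ[volume.restrict (Ω : Set (Euc d))] fun x => (1 + x j ^ 2)⁻¹ • w x := by
    filter_upwards [coeFn_mulL2 (V := V) (continuous_pderiv_arctanCoord j j)
      (abs_pderiv_arctanCoord_le j j) w] with x hx
    rw [hx, pderiv_arctanCoord, if_pos rfl]
  have hin : (fun x => inner ℂ (m x) (w x)) =ᵐ[volume.restrict (Ω : Set (Euc d))]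
      fun x => (((1 + x j ^ 2)⁻¹ * ‖w x‖ ^ 2 : ℝ) : ℂ) := by
    filter_upwards [hm] with x hx
    rw [hx, ← Complex.coe_smul, inner_smul_left, inner_self_eq_norm_sq_to_K]
    simp
  have hint : Integrable (fun x => (1 + x j ^ 2)⁻¹ * ‖w x‖ ^ 2)
      (volume.restrict (Ω : Set (Euc d))) := ((L2.integrable_inner (𝕜 := ℂ) m w).congr hin).re
  rw [L2.inner_def, integral_congr_ae hin, integral_complex_ofReal, Complex.ofReal_eq_zero,
    integral_eq_zero_iff_of_nonneg (fun x => by positivity) hint] at h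
  refine Lp.eq_zero_iff_ae_eq_zero.2 ?_
  filter_upwards [h] with x hx
  have : (0 : ℝ) < (1 + x j ^ 2)⁻¹ := by positivity
  simpa [this.ne'] using hx

end Inner

/-! ### First order operators with Clifford coefficients on `H¹₀` -/

section Clifford

variable {d : ℕ} {V : Type*} [NormedAddCommGroup V] [InnerProductSpace ℂ V]

/-- The Clifford relations `Bⱼ* Bₖ + Bₖ* Bⱼ = 2 c² δⱼₖ`. -/
def IsClifford (c : ℝ) (B : Fin d → V →L[ℂ] V) : Prop :=
  ∀ j k v w, inner ℂ (B j v) (B k w) + inner ℂ (B k v) (B j w) =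
    if j = k then 2 * (c : ℂ) ^ 2 * inner ℂ v w else 0

/-- The operator `p ↦ ∑ⱼ Bⱼ pⱼ`. -/
def symbol (Ω : Opens (Euc d)) (B : Fin d → V →L[ℂ] V) : (Fin d → L2 Ω V) →L[ℂ] L2 Ω V :=
  ∑ j, (B j).compLpL 2 (volume.restrict (Ω : Set (Euc d))) ∘L ContinuousLinearMap.proj j

theorem symbol_apply (Ω : Opens (Euc d)) (B : Fin d → V →L[ℂ] V) (p : Fin d → L2 Ω V) :
    symbol Ω B p = ∑ j, pointwise Ω (B j) (p j) := by
  rw [symbol, sum_apply]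
  rfl

/-- The graph of `∑ⱼ Bⱼ ∂ⱼ` on `H¹₀(Ω; V)`. -/
def firstOrderGraph (Ω : Opens (Euc d)) (B : Fin d → V →L[ℂ] V) : Submodule ℂ (L2 Ω V × L2 Ω V) :=
  (H10Graph Ω V).map (LinearMap.prodMap LinearMap.id (symbol Ω B).toLinearMap)

variable {Ω : Opens (Euc d)} {B : Fin d → V →L[ℂ] V} {c : ℝ}

theorem mem_firstOrderGraph {u g : L2 Ω V} :
    (u, g) ∈ firstOrderGraph Ω B ↔ ∃ p, (u, p) ∈ H10Graph Ω V ∧ symbol Ω B p = g := by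
  constructor
  · rintro ⟨⟨u', p⟩, hp, h⟩
    obtain ⟨rfl, rfl⟩ := Prod.mk.inj h
    exact ⟨p, hp, rfl⟩
  · rintro ⟨p, hp, rfl⟩
    exact ⟨(u, p), hp, rfl⟩

theorem IsClifford.inner_pointwise_add (hB : IsClifford c B) (j k : Fin d) (f g : L2 Ω V) :
    inner ℂ (pointwise Ω (B j) f) (pointwise Ω (B k) g) +
      inner ℂ (pointwise Ω (B k) f) (pointwise Ω (B j) g) =
        if j = k then 2 * (c : ℂ) ^ 2 * inner ℂ f g else 0 := by
  rw [L2.inner_def, L2.inner_def, ← integral_add (L2.integrable_inner _ _)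
    (L2.integrable_inner _ _)]
  have h : ∀ᵐ x ∂(volume.restrict (Ω : Set (Euc d))),
      inner ℂ (pointwise Ω (B j) f x) (pointwise Ω (B k) g x) +
        inner ℂ (pointwise Ω (B k) f x) (pointwise Ω (B j) g x) =
          if j = k then 2 * (c : ℂ) ^ 2 * inner ℂ (f x) (g x) else 0 := by
    filter_upwards [coeFn_pointwise (B j) f, coeFn_pointwise (B j) g, coeFn_pointwise (B k) f,
      coeFn_pointwise (B k) g] with x h1 h2 h3 h4
    rw [h1, h2, h3, h4, hB]
  rw [integral_congr_ae h]
  split_ifs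
  · rw [integral_const_mul, L2.inner_def]
  · simp

/-- By the Clifford relations, the mixed terms of `⟨∑ⱼ Bⱼ pⱼ, ∑ₖ Bₖ qₖ⟩` cancel if they are
symmetric. -/
theorem IsClifford.inner_symbol_of_swap (hB : IsClifford c B) {p q : Fin d → L2 Ω V}
    (swap : ∀ j k, inner ℂ (pointwise Ω (B j) (p j)) (pointwise Ω (B k) (q k)) =
      inner ℂ (pointwise Ω (B j) (p k)) (pointwise Ω (B k) (q j))) :
    inner ℂ (symbol Ω B p) (symbol Ω B q) = (c : ℂ) ^ 2 * ∑ j, inner ℂ (p j) (q j) := by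
  have h2 : (2 : ℂ) * inner ℂ (symbol Ω B p) (symbol Ω B q) =
      2 * ((c : ℂ) ^ 2 * ∑ j, inner ℂ (p j) (q j)) := by
    have e1 : inner ℂ (symbol Ω B p) (symbol Ω B q) =
        ∑ j, ∑ k, inner ℂ (pointwise Ω (B j) (p j)) (pointwise Ω (B k) (q k)) := by
      simp only [symbol_apply, sum_inner, inner_sum]
      exact Finset.sum_comm
    have e2 : inner ℂ (symbol Ω B p) (symbol Ω B q) =
        ∑ j, ∑ k, inner ℂ (pointwise Ω (B k) (p j)) (pointwise Ω (B j) (q k)) := by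
      rw [e1, Finset.sum_comm]
      exact Finset.sum_congr rfl fun j _ => Finset.sum_congr rfl fun k _ => swap k j
    rw [two_mul]
    nth_rewrite 1 [e1]
    rw [e2, ← Finset.sum_add_distrib]
    simp only [← Finset.sum_add_distrib, hB.inner_pointwise_add]
    simp only [Finset.sum_ite_eq, Finset.mem_univ, if_true, Finset.mul_sum, mul_assoc]
  exact mul_left_cancel₀ two_ne_zero h2

/-- For functions of which one vanishes on the boundary, the form of `∑ⱼ Bⱼ ∂ⱼ` is `c²` times the
form of the gradient. -/
theorem IsClifford.inner_symbol_toL2 [CompleteSpace V] (hB : IsClifford c B) {ψ : Euc d → V}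
    (hψ : IsSmoothCompact ψ) {w : L2 Ω V} {p : Fin d → L2 Ω V} (hw : (w, p) ∈ H10Graph Ω V) :
    inner ℂ (symbol Ω B fun j => (hψ.pderiv j).toL2 Ω) (symbol Ω B p) =
      (c : ℂ) ^ 2 * ∑ j, inner ℂ ((hψ.pderiv j).toL2 Ω) (p j) := by
  refine hB.inner_symbol_of_swap fun j k => ?_
  let M := ContinuousLinearMap.adjoint (B k) ∘L B j
  have hM : ∀ f g : L2 Ω V, inner ℂ (pointwise Ω (B j) f) (pointwise Ω (B k) g) =
      inner ℂ (pointwise Ω M f) g := fun f g => by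
    rw [← pointwise_pointwise, inner_pointwise (ContinuousLinearMap.adjoint (B k)),
      ContinuousLinearMap.adjoint_adjoint]
  have hχ := hψ.clm_comp M
  have key : ∀ a b, inner ℂ (pointwise Ω M ((hψ.pderiv a).toL2 Ω)) (p b) =
      -inner ℂ (((hχ.pderiv a).pderiv b).toL2 Ω) w := fun a b => by
    rw [H10Graph_inner_toL2 (hχ.pderiv a) hw b, neg_neg, toL2_pderiv_clm_comp M hψ]
  rw [hM, hM, key, key]
  congr 3
  simp only [pderiv_comm hχ j k]

theorem IsClifford.inner_symbol [CompleteSpace V] (hB : IsClifford c B) {w v : L2 Ω V}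
    {p q : Fin d → L2 Ω V} (hw : (w, p) ∈ H10Graph Ω V) (hv : (v, q) ∈ H10Graph Ω V) :
    inner ℂ (symbol Ω B q) (symbol Ω B p) = (c : ℂ) ^ 2 * ∑ j, inner ℂ (q j) (p j) :=
  H10Graph_induction
    (P := fun _ q => inner ℂ (symbol Ω B q) (symbol Ω B p) = (c : ℂ) ^ 2 * ∑ j, inner ℂ (q j) (p j))
    (isClosed_eq (by fun_prop) (by fun_prop))
    (fun φ => hB.inner_symbol_toL2 (isSmoothCompact_test φ) hw) hv

/-- `‖∑ⱼ Bⱼ ∂ⱼ w‖² = c² ‖∇w‖²` for `w ∈ H¹₀`. -/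
theorem IsClifford.norm_symbol_sq [CompleteSpace V] (hB : IsClifford c B) {w : L2 Ω V}
    {p : Fin d → L2 Ω V} (hw : (w, p) ∈ H10Graph Ω V) :
    ‖symbol Ω B p‖ ^ 2 = c ^ 2 * ∑ j, ‖p j‖ ^ 2 := by
  have h := congrArg Complex.re (hB.inner_symbol hw hw)
  rw [← Complex.ofReal_pow, Complex.re_ofReal_mul, Complex.re_sum] at h
  rw [← inner_self_eq_norm_sq (𝕜 := ℂ)]
  refine h.trans ?_
  congr 1
  exact Finset.sum_congr rfl fun j _ => inner_self_eq_norm_sq (𝕜 := ℂ) (p j)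

theorem IsClifford.norm_le_symbol [CompleteSpace V] (hB : IsClifford c B) (hc : 0 < c) {w : L2 Ω V}
    {p : Fin d → L2 Ω V} (hw : (w, p) ∈ H10Graph Ω V) (j : Fin d) :
    ‖p j‖ ≤ c⁻¹ * ‖symbol Ω B p‖ := by
  have h1 : ‖p j‖ ^ 2 ≤ ∑ j, ‖p j‖ ^ 2 :=
    Finset.single_le_sum (f := fun j => ‖p j‖ ^ 2) (fun i _ => by positivity) (Finset.mem_univ j)
  have h2 := hB.norm_symbol_sq hw
  rw [inv_mul_eq_div, le_div_iff₀ hc]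
  refine abs_le_of_sq_le_sq' ?_ (norm_nonneg _) |>.2
  nlinarith [sq_nonneg c]

/-- The graph norm of `∑ⱼ Bⱼ ∂ⱼ` is equivalent to the `H¹` norm, hence the operator is closed. -/
theorem IsClifford.isClosed_firstOrderGraph [CompleteSpace V] (hB : IsClifford c B) (hc : 0 < c) :
    IsClosed (firstOrderGraph Ω B : Set (L2 Ω V × L2 Ω V)) := by
  let F : H10Graph Ω V →ₗ[ℂ] L2 Ω V × L2 Ω V :=
    LinearMap.prodMap LinearMap.id (symbol Ω B).toLinearMap ∘ₗ (H10Graph Ω V).subtype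
  have hF : Continuous F :=
    (continuous_fst.prodMk ((symbol Ω B).continuous.comp continuous_snd)).comp
      continuous_subtype_val
  have : CompleteSpace (H10Graph Ω V) :=
    (testGraph Ω V).isClosed_topologicalClosure.completeSpace_coe
  have hbound : ∀ x, ‖x‖ ≤ (1 + c⁻¹) * ‖F x‖ := by
    rintro ⟨⟨w, p⟩, hw⟩
    have hci : 0 < c⁻¹ := inv_pos.2 hc
    change max ‖w‖ ‖p‖ ≤ (1 + c⁻¹) * max ‖w‖ ‖symbol Ω B p‖
    have h1 : 0 ≤ max ‖w‖ ‖symbol Ω B p‖ := (norm_nonneg w).trans (le_max_left _ _)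
    refine max_le ?_ ((pi_norm_le_iff_of_nonneg (by positivity)).2 fun j => ?_)
    · nlinarith [le_max_left ‖w‖ ‖symbol Ω B p‖]
    · have h2 := hB.norm_le_symbol hc hw j
      nlinarith [le_max_right ‖w‖ ‖symbol Ω B p‖]
  have hcl : IsClosed (Set.range F) :=
    (AddMonoidHomClass.antilipschitz_of_bound F (K := ⟨1 + c⁻¹, by positivity⟩)
      hbound).isClosed_range (ContinuousLinearMap.uniformContinuous ⟨F, hF⟩)
  convert! hcl using 1
  ext x
  constructor
  · rintro ⟨y, hy, rfl⟩
    exact ⟨⟨y, hy⟩, rfl⟩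
  · rintro ⟨⟨y, hy⟩, rfl⟩
    exact ⟨y, hy, rfl⟩

theorem firstOrderGraph_single [CompleteSpace V] {g : L2 Ω V}
    (h : ((0 : L2 Ω V), g) ∈ firstOrderGraph Ω B) : g = 0 := by
  obtain ⟨p, hp, rfl⟩ := mem_firstOrderGraph.1 h
  rw [H10Graph_single Ω hp, map_zero]

/-- `∑ⱼ Bⱼ ∂ⱼ` is injective on `H¹₀`. -/
theorem IsClifford.eq_zero_of_mem_firstOrderGraph [CompleteSpace V] (hB : IsClifford c B)
    (hc : 0 < c) (j : Fin d) {u : L2 Ω V} (h : (u, (0 : L2 Ω V)) ∈ firstOrderGraph Ω B) : u = 0 := by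
  obtain ⟨p, hp, h0⟩ := mem_firstOrderGraph.1 h
  obtain rfl : p = 0 := funext fun k => by
    have := hB.norm_le_symbol hc hp k
    rw [h0, norm_zero, mul_zero] at this
    exact norm_le_zero_iff.1 this
  exact eq_zero_of_grad_eq_zero j hp

end Clifford

section Adjoint

variable {d : ℕ} {V : Type*} [NormedAddCommGroup V] [InnerProductSpace ℂ V]
  {Ω : Opens (Euc d)} {B S : Fin d → V →L[ℂ] V} {c : ℝ}

/-- The test function `conj ψ · v`. The conjugate turns inner products against it, which are
conjugate linear in the first argument, into the pairings with `ψ` that define distributions. -/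
def conjSMulTest (ψ : 𝓓(Ω, ℂ)) (v : V) : 𝓓(Ω, V) :=
  ⟨fun x => ContinuousLinearMap.toSpanSingleton ℂ v (Complex.conjCLE (ψ x)),
    (ContinuousLinearMap.toSpanSingleton ℂ v |>.restrictScalars ℝ).contDiff.comp
      (Complex.conjCLE.contDiff.comp ψ.contDiff),
    (ψ.hasCompactSupport.comp_left (g := Complex.conjCLE) (map_zero _)).comp_left
      (g := ContinuousLinearMap.toSpanSingleton ℂ v) (map_zero _),
    ((closure_mono ((Function.support_comp_subset (map_zero _) _).trans
      (Function.support_comp_subset (map_zero _) ψ)))).trans ψ.tsupport_subset⟩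

theorem conjSMulTest_apply (ψ : 𝓓(Ω, ℂ)) (v : V) (x : Euc d) :
    conjSMulTest ψ v x = (starRingEnd ℂ) (ψ x) • v := rfl

theorem pderiv_conjSMulTest (ψ : 𝓓(Ω, ℂ)) (v : V) (j : Fin d) (x : Euc d) :
    pderiv j (conjSMulTest ψ v) x = (starRingEnd ℂ) (pderiv j ψ x) • v := by
  have h1 : HasFDerivAt ψ (fderiv ℝ ψ x) x :=
    (ψ.contDiff.differentiable (by simp) x).hasFDerivAt
  have h2 := (ContinuousLinearMap.toSpanSingleton ℂ v |>.restrictScalars ℝ).hasFDerivAt.comp x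
    (Complex.conjCLE.hasFDerivAt.comp x h1)
  have h3 : fderiv ℝ (conjSMulTest ψ v) x = _ := h2.fderiv
  rw [pderiv, h3]
  rfl

theorem inner_toL2_conjSMulTest [CompleteSpace V] (ψ : 𝓓(Ω, ℂ)) (v : V) (g : L2 Ω V) :
    inner ℂ ((isSmoothCompact_test (conjSMulTest ψ v)).toL2 Ω) g =
      inner ℂ v (∫ x in Ω, ψ x • g x) := by
  rw [L2.inner_def, ← integral_inner (integrable_smul_of_memLp Ω (memLp_test Ω ψ) g)]
  refine integral_congr_ae ?_
  filter_upwards [(isSmoothCompact_test (conjSMulTest ψ v)).coeFn_toL2 Ω] with x hx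
  rw [hx, conjSMulTest_apply, inner_smul_left, inner_smul_right, Complex.conj_conj]

theorem inner_toL2_pderiv_conjSMulTest [CompleteSpace V] (ψ : 𝓓(Ω, ℂ)) (v : V) (j : Fin d)
    (L : V →L[ℂ] V) (f : L2 Ω V) :
    inner ℂ (((isSmoothCompact_test (conjSMulTest ψ v)).pderiv j).toL2 Ω) (pointwise Ω L f) =
      inner ℂ v (∫ x in Ω, pderiv j ψ x • L (f x)) := by
  rw [L2.inner_def, ← integral_inner (integrable_smul_clm Ω (memLp_pderiv Ω ψ j) L f)]
  refine integral_congr_ae ?_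
  filter_upwards [((isSmoothCompact_test (conjSMulTest ψ v)).pderiv j).coeFn_toL2 Ω,
    coeFn_pointwise L f] with x hx hx'
  rw [hx, hx', pderiv_conjSMulTest, inner_smul_left, inner_smul_right, Complex.conj_conj]

/-- The projection of a test function to the line of `v` is of the form `conj ψ · v`. -/
theorem exists_conjSMulTest_eq (φ : 𝓓(Ω, V)) (v : V) :
    ∃ ψ : 𝓓(Ω, ℂ), ⇑(conjSMulTest ψ v) = fun x => InnerProductSpace.rankOne ℂ v v (φ x) :=
  ⟨⟨fun x => Complex.conjCLE (innerSL ℂ v (φ x)), Complex.conjCLE.contDiff.comp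
      (((innerSL ℂ v).restrictScalars ℝ).contDiff.comp φ.contDiff),
      (φ.hasCompactSupport.comp_left (g := innerSL ℂ v) (map_zero _)).comp_left
        (g := Complex.conjCLE) (map_zero _),
      ((closure_mono ((Function.support_comp_subset (map_zero _) _).trans
        (Function.support_comp_subset (map_zero _) φ)))).trans φ.tsupport_subset⟩, funext fun x => by
    rw [conjSMulTest_apply]
    change (starRingEnd ℂ) ((starRingEnd ℂ) (inner ℂ v (φ x))) • _ = _
    rw [Complex.conj_conj]
    rfl⟩

theorem sum_pointwise_rankOne [FiniteDimensional ℂ V] (f : L2 Ω V) :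
    ∑ i, pointwise Ω (InnerProductSpace.rankOne ℂ (stdOrthonormalBasis ℂ V i)
      (stdOrthonormalBasis ℂ V i)) f = f := by
  refine Lp.ext ?_
  have h : ∀ i, pointwise Ω (InnerProductSpace.rankOne ℂ (stdOrthonormalBasis ℂ V i)
      (stdOrthonormalBasis ℂ V i)) f =ᵐ[volume.restrict (Ω : Set (Euc d))] fun x =>
        inner ℂ (stdOrthonormalBasis ℂ V i) (f x) • stdOrthonormalBasis ℂ V i := fun i =>
    coeFn_pointwise _ f
  filter_upwards [Lp.coeFn_finsetSum Finset.univ (fun i => pointwise Ω (InnerProductSpace.rankOne ℂ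
    (stdOrthonormalBasis ℂ V i) (stdOrthonormalBasis ℂ V i)) f), ae_all_iff.2 h] with x h1 h2
  rw [h1, Finset.sum_apply, Finset.sum_congr rfl fun i _ => h2 i]
  exact (stdOrthonormalBasis ℂ V).sum_repr' (f x)

/-- A linear condition on `H¹₀(Ω; V)` may be checked on the test functions `conj ψ · v`. -/
theorem H10Graph_induction_conjSMulTest [FiniteDimensional ℂ V]
    (F : L2 Ω V × (Fin d → L2 Ω V) →L⋆[ℂ] ℂ)
    (h : ∀ (ψ : 𝓓(Ω, ℂ)) (v : V), F ((isSmoothCompact_test (conjSMulTest ψ v)).toL2 Ω,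
      fun j => ((isSmoothCompact_test (conjSMulTest ψ v)).pderiv j).toL2 Ω) = 0)
    {w : L2 Ω V} {p : Fin d → L2 Ω V} (hw : (w, p) ∈ H10Graph Ω V) : F (w, p) = 0 := by
  refine H10Graph_induction (P := fun w p => F (w, p) = 0)
    (isClosed_eq F.continuous continuous_const) (fun φ => ?_) hw
  have hφ := isSmoothCompact_test φ
  let L : Fin (Module.finrank ℂ V) → V →L[ℂ] V := fun i =>
    InnerProductSpace.rankOne ℂ (stdOrthonormalBasis ℂ V i) (stdOrthonormalBasis ℂ V i)
  have key : ∀ i, F ((hφ.clm_comp (L i)).toL2 Ω,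
      fun j => ((hφ.clm_comp (L i)).pderiv j).toL2 Ω) = 0 := fun i => by
    obtain ⟨ψ, hψ⟩ := exists_conjSMulTest_eq φ (stdOrthonormalBasis ℂ V i)
    have := h ψ (stdOrthonormalBasis ℂ V i)
    simpa only [hψ] using this
  have e : ((hφ.toL2 Ω, fun j => (hφ.pderiv j).toL2 Ω) : L2 Ω V × (Fin d → L2 Ω V)) =
      ∑ i, ((hφ.clm_comp (L i)).toL2 Ω, fun j => ((hφ.clm_comp (L i)).pderiv j).toL2 Ω) := by
    refine Prod.ext ?_ (funext fun j => ?_)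
    · rw [Prod.fst_sum]
      exact (sum_pointwise_rankOne _).symm
    · rw [Prod.snd_sum, Finset.sum_apply]
      simp only [toL2_pderiv_clm_comp _ hφ]
      exact (sum_pointwise_rankOne _).symm
  rw [e, map_sum]
  exact Finset.sum_eq_zero fun i _ => key i

/-- The adjoint of `∑ⱼ Bⱼ ∂ⱼ` on `H¹₀` is the maximal realization of `-∑ⱼ Bⱼ* ∂ⱼ`. -/
theorem mem_adjoint_firstOrderGraph_iff [FiniteDimensional ℂ V] (hc : c ≠ 0)
    (hBS : ∀ j v w, inner ℂ (B j v) w = Complex.I * c * inner ℂ v (S j w)) {f g : L2 Ω V} :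
    (f, (-Complex.I * c) • g) ∈ (firstOrderGraph Ω B).adjoint ↔ (f, g) ∈ weakGraph Ω S := by
  have : CompleteSpace V := FiniteDimensional.complete ℂ V
  have hI : (Complex.I * c : ℂ) ≠ 0 := mul_ne_zero Complex.I_ne_zero (Complex.ofReal_ne_zero.2 hc)
  have e1 : ∀ p : Fin d → L2 Ω V, inner ℂ (symbol Ω B p) f =
      Complex.I * c * ∑ j, inner ℂ (p j) (pointwise Ω (S j) f) := fun p => by
    rw [symbol_apply, sum_inner, Finset.mul_sum]
    refine Finset.sum_congr rfl fun j _ => ?_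
    rw [L2.inner_def, L2.inner_def, ← integral_const_mul]
    refine integral_congr_ae ?_
    filter_upwards [coeFn_pointwise (B j) (p j), coeFn_pointwise (S j) f] with x h1 h2
    rw [h1, h2, hBS]
  have e2 : ∀ (ψ : 𝓓(Ω, ℂ)) (v : V),
      inner ℂ (symbol Ω B fun j => ((isSmoothCompact_test (conjSMulTest ψ v)).pderiv j).toL2 Ω) f =
        Complex.I * c * inner ℂ v (∑ j, ∫ x in Ω, pderiv j ψ x • S j (f x)) := fun ψ v => by
    simp only [e1, inner_toL2_pderiv_conjSMulTest, inner_sum]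
  have e3 : ∀ (ψ : 𝓓(Ω, ℂ)) (v : V),
      inner ℂ ((isSmoothCompact_test (conjSMulTest ψ v)).toL2 Ω) ((-Complex.I * c) • g) =
        Complex.I * c * inner ℂ v (-∫ x in Ω, ψ x • g x) := fun ψ v => by
    rw [inner_smul_right, inner_toL2_conjSMulTest, inner_neg_right]
    ring
  constructor
  · intro h ψ
    refine ext_inner_left ℂ fun v => mul_left_cancel₀ hI ?_
    rw [← e2, ← e3]
    exact inner_eq_of_mem_adjoint
      (mem_firstOrderGraph.2 ⟨_, toL2_mem_H10Graph (conjSMulTest ψ v), rfl⟩) h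
  · intro h
    refine mem_adjoint_of_forall fun u k hu => ?_
    obtain ⟨p, hp, rfl⟩ := mem_firstOrderGraph.1 hu
    let F : L2 Ω V × (Fin d → L2 Ω V) →L⋆[ℂ] ℂ :=
      ((innerSLFlip ℂ f).comp ((symbol Ω B).comp (ContinuousLinearMap.snd ℂ _ _))) -
        (innerSLFlip ℂ ((-Complex.I * c) • g)).comp (ContinuousLinearMap.fst ℂ _ _)
    have hF : ∀ w, F w = inner ℂ (symbol Ω B w.2) f - inner ℂ w.1 ((-Complex.I * c) • g) :=
      fun w => rfl
    refine sub_eq_zero.1 (H10Graph_induction_conjSMulTest F (fun ψ v => ?_) hp)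
    rw [hF, e2, e3, h ψ, sub_self]

/-- `H¹₀` is dense in `L²`. -/
theorem dense_firstOrderGraph_fst [FiniteDimensional ℂ V] :
    Dense ((firstOrderGraph Ω B).map (LinearMap.fst ℂ (L2 Ω V) (L2 Ω V)) : Set (L2 Ω V)) := by
  have : CompleteSpace V := FiniteDimensional.complete ℂ V
  rw [Submodule.dense_iff_topologicalClosure_eq_top, Submodule.topologicalClosure_eq_top_iff,
    Submodule.eq_bot_iff]
  intro g hg
  refine eq_zero_of_test Ω g fun ψ => ext_inner_left ℂ fun v => ?_
  rw [inner_zero_right, ← inner_toL2_conjSMulTest]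
  exact (Submodule.mem_orthogonal _ _).1 hg _
    ⟨_, mem_firstOrderGraph.2 ⟨_, toL2_mem_H10Graph (conjSMulTest ψ v), rfl⟩, rfl⟩

end Adjoint

/-! ### The Dirichlet Laplacian as a Gram operator -/

section Coordinates

variable {d : ℕ} {Ω : Opens (Euc d)} {V ι : Type*} [NormedAddCommGroup V] [InnerProductSpace ℂ V]
  [Fintype ι]

/-- The `i`-th coordinate in an orthonormal basis. -/
def coordCLM (b : OrthonormalBasis ι ℂ V) (i : ι) : V →L[ℂ] ℂ := innerSL ℂ (b i)

/-- The embedding of the `i`-th coordinate axis. -/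
def axisCLM (b : OrthonormalBasis ι ℂ V) (i : ι) : ℂ →L[ℂ] V :=
  ContinuousLinearMap.toSpanSingleton ℂ (b i)

theorem sum_pointwise_axis_coord (b : OrthonormalBasis ι ℂ V) (f : L2 Ω V) :
    ∑ i, pointwise Ω (axisCLM b i) (pointwise Ω (coordCLM b i) f) = f := by
  refine Lp.ext ?_
  have h : ∀ i, pointwise Ω (axisCLM b i) (pointwise Ω (coordCLM b i) f)
      =ᵐ[volume.restrict (Ω : Set (Euc d))] fun x => inner ℂ (b i) (f x) • b i := fun i => by
    rw [pointwise_pointwise]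
    exact coeFn_pointwise _ f
  filter_upwards [Lp.coeFn_finsetSum Finset.univ
    (fun i => pointwise Ω (axisCLM b i) (pointwise Ω (coordCLM b i) f)), ae_all_iff.2 h]
    with x h1 h2
  rw [h1, Finset.sum_apply, Finset.sum_congr rfl fun i _ => h2 i]
  exact b.sum_repr' (f x)

theorem pointwise_coord_axis [DecidableEq ι] (b : OrthonormalBasis ι ℂ V) (i k : ι) (f : L2 Ω ℂ) :
    pointwise Ω (coordCLM b i) (pointwise Ω (axisCLM b k) f) = if i = k then f else 0 := by
  have e : coordCLM b i ∘L axisCLM b k = if i = k then ContinuousLinearMap.id ℂ ℂ else 0 := by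
    ext
    change inner ℂ (b i) ((1 : ℂ) • b k) = _
    rw [one_smul, b.inner_eq_ite]
    split_ifs <;> rfl
  rw [pointwise_pointwise, e]
  split_ifs
  · exact pointwise_id f
  · exact pointwise_zero f

theorem inner_pointwise_axis (b : OrthonormalBasis ι ℂ V) (i : ι) (f : L2 Ω ℂ) (g : L2 Ω V) :
    inner ℂ (pointwise Ω (axisCLM b i) f) g = inner ℂ f (pointwise Ω (coordCLM b i) g) := by
  rw [L2.inner_def, L2.inner_def]
  refine integral_congr_ae ?_
  filter_upwards [coeFn_pointwise (axisCLM b i) f, coeFn_pointwise (coordCLM b i) g] with x h1 h2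
  rw [h1, h2]
  change inner ℂ (f x • b i) (g x) = inner ℂ (f x) (inner ℂ (b i) (g x))
  rw [inner_smul_left, RCLike.inner_apply, mul_comm]

/-- The coordinates of an `L²` function in an orthonormal basis. -/
def coordEquiv (Ω : Opens (Euc d)) (b : OrthonormalBasis ι ℂ V) : L2 Ω V ≃L[ℂ] (ι → L2 Ω ℂ) := by
  classical
  exact ContinuousLinearEquiv.equivOfInverse
    (ContinuousLinearMap.pi fun i =>
      (coordCLM b i).compLpL 2 (volume.restrict (Ω : Set (Euc d))))
    (∑ i, (axisCLM b i).compLpL 2 (volume.restrict (Ω : Set (Euc d))) ∘L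
      ContinuousLinearMap.proj i)
    (fun f => by
      rw [sum_apply]
      exact sum_pointwise_axis_coord b f)
    (fun f => by
      funext i
      rw [sum_apply]
      change pointwise Ω (coordCLM b i) (∑ k, pointwise Ω (axisCLM b k) (f k)) = f i
      simp only [map_sum, pointwise_coord_axis, Finset.sum_ite_eq, Finset.mem_univ, if_true])

theorem coordEquiv_apply (b : OrthonormalBasis ι ℂ V) (f : L2 Ω V) (i : ι) :
    coordEquiv Ω b f i = pointwise Ω (coordCLM b i) f := rfl

theorem IsClifford.mem_gramGraph_firstOrderGraph_iff [CompleteSpace V] {c : ℝ} {B : Fin d → V →L[ℂ] V}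
    (hB : IsClifford c B) (hc : 0 < c) {u v : L2 Ω V} :
    (u, ((c ^ 2 : ℝ) : ℂ) • v) ∈ gramGraph (firstOrderGraph Ω B) ↔
      ∃ p, (u, p) ∈ H10Graph Ω V ∧ ∀ w q, (w, q) ∈ H10Graph Ω V →
        ∑ j, inner ℂ (q j) (p j) = inner ℂ w v := by
  have hc2 : ((c ^ 2 : ℝ) : ℂ) ≠ 0 := Complex.ofReal_ne_zero.2 (by positivity)
  constructor
  · rintro ⟨g, h1, h2⟩
    obtain ⟨p, hp, rfl⟩ := mem_firstOrderGraph.1 h1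
    refine ⟨p, hp, fun w q hq => mul_left_cancel₀ hc2 ?_⟩
    have hw : (w, symbol Ω B q) ∈ firstOrderGraph Ω B := mem_firstOrderGraph.2 ⟨q, hq, rfl⟩
    have e1 := inner_eq_of_mem_adjoint hw h2
    have e2 := hB.inner_symbol hp hq
    rw [← Complex.ofReal_pow] at e2
    have e3 := inner_smul_right (𝕜 := ℂ) w v ((c ^ 2 : ℝ) : ℂ)
    rw [← e2, ← e3]
    exact e1
  · rintro ⟨p, hp, h⟩
    refine ⟨symbol Ω B p, mem_firstOrderGraph.2 ⟨p, hp, rfl⟩, mem_adjoint_of_forall fun w k hw => ?_⟩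
    obtain ⟨q, hq, rfl⟩ := mem_firstOrderGraph.1 hw
    have e2 := hB.inner_symbol hp hq
    rw [← Complex.ofReal_pow, h w q hq] at e2
    have e3 := inner_smul_right (𝕜 := ℂ) w v ((c ^ 2 : ℝ) : ℂ)
    rw [e2, e3]

/-- If `A = ∑ⱼ Bⱼ ∂ⱼ` on `H¹₀` has Clifford coefficients, then `A* A` acts on each component as
`c²` times the Dirichlet Laplacian. -/
theorem IsClifford.mem_gramGraph_iff_dirichletLaplacian [CompleteSpace V] {c : ℝ} {B : Fin d → V →L[ℂ] V}
    (hB : IsClifford c B) (hc : 0 < c) (b : OrthonormalBasis ι ℂ V) (u v : L2 Ω V) :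
    (u, ((c ^ 2 : ℝ) : ℂ) • v) ∈ gramGraph (firstOrderGraph Ω B) ↔
      ∀ i, (coordEquiv Ω b u i, coordEquiv Ω b v i) ∈ (dirichletLaplacian Ω).graph := by
  rw [hB.mem_gramGraph_firstOrderGraph_iff hc, dirichletLaplacian_graph]
  simp only [coordEquiv_apply]
  constructor
  · rintro ⟨p, hp, h⟩ i
    refine ⟨fun j => pointwise Ω (coordCLM b i) (p j), H10Graph_pointwise _ hp, fun w q hq => ?_⟩
    have := h _ _ (H10Graph_pointwise (axisCLM b i) hq)
    simpa only [inner_pointwise_axis] using this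
  · intro h
    choose p hp h using h
    refine ⟨fun j => ∑ i, pointwise Ω (axisCLM b i) (p i j), ?_, fun w q hq => ?_⟩
    · have := Submodule.sum_mem (H10Graph Ω V) fun i (_ : i ∈ Finset.univ) =>
        H10Graph_pointwise (axisCLM b i) (hp i)
      convert! this using 1
      refine Prod.ext ?_ (funext fun j => ?_)
      · rw [Prod.fst_sum]
        exact (sum_pointwise_axis_coord b u).symm
      · rw [Prod.snd_sum, Finset.sum_apply]
    · have e : ∀ f g : L2 Ω V, inner ℂ f g =
          ∑ i, inner ℂ (pointwise Ω (coordCLM b i) f) (pointwise Ω (coordCLM b i) g) := fun f g => by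
        nth_rewrite 1 [← sum_pointwise_axis_coord b f]
        simp only [sum_inner, inner_pointwise_axis]
      have e' : ∀ (f : L2 Ω V) (i : ι) (g : L2 Ω ℂ), inner ℂ f (pointwise Ω (axisCLM b i) g) =
          inner ℂ (pointwise Ω (coordCLM b i) f) g := fun f i g => by
        rw [← inner_conj_symm, inner_pointwise_axis, inner_conj_symm]
      rw [e, Finset.sum_congr rfl fun i _ => (h i _ _ (H10Graph_pointwise (coordCLM b i) hq)).symm,
        Finset.sum_comm]
      simp only [inner_sum, e']

end Coordinates

/-! ### Finite codimension of `H¹₀` when the adjoint has a finite-dimensional kernel -/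

section LinearAlgebra

/-- A closed subspace with finite-dimensional orthogonal complement has preimages of finite
codimension. The complex structure is restricted to the reals because `T` is only real linear. -/
theorem finite_quotient_comap {E X : Type*} [AddCommGroup E] [Module ℝ E] [NormedAddCommGroup X]
    [InnerProductSpace ℂ X] [Module ℝ X] [IsScalarTower ℝ ℂ X] (R : Submodule ℂ X)
    [R.HasOrthogonalProjection] [FiniteDimensional ℂ Rᗮ] (T : E →ₗ[ℝ] X) :
    Module.Finite ℝ (E ⧸ (R.restrictScalars ℝ).comap T) := by
  let P : X →ₗ[ℝ] Rᗮ := Rᗮ.orthogonalProjectionOnto.toLinearMap.restrictScalars ℝ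
  have hk : LinearMap.ker (P ∘ₗ T) = (R.restrictScalars ℝ).comap T := by
    ext x
    change Rᗮ.orthogonalProjectionOnto (T x) = 0 ↔ T x ∈ R
    rw [Submodule.orthogonalProjectionOnto_eq_zero_iff, Submodule.orthogonal_orthogonal]
  have : Module.Finite ℝ Rᗮ := Module.Finite.trans ℂ Rᗮ
  rw [← hk]
  exact Module.Finite.equiv (P ∘ₗ T).quotKerEquivRange.symm

theorem finite_quotient_ker_of_finite_map {E Q : Type*} [AddCommGroup E] [Module ℝ E]
    [AddCommGroup Q] [Module ℝ Q] (f : E →ₗ[ℝ] Q) (I : Submodule ℝ E) [Module.Finite ℝ (E ⧸ I)]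
    {N : Submodule ℝ Q} [Module.Finite ℝ N] (h : I.map f ≤ N) :
    Module.Finite ℝ (E ⧸ LinearMap.ker f) := by
  obtain ⟨K, hK⟩ := Submodule.exists_isCompl I
  have : Module.Finite ℝ K := Module.Finite.equiv (I.quotientEquivOfIsCompl K hK)
  have hle : LinearMap.range f ≤ N ⊔ K.map f := by
    rw [← Submodule.map_top, ← hK.sup_eq_top, Submodule.map_sup]
    exact sup_le_sup_right h _
  have : Module.Finite ℝ (LinearMap.range f) := Submodule.finiteDimensional_of_le hle
  exact Module.Finite.equiv f.quotKerEquivRange.symm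

/-- The second finiteness step: on a subspace of finite codimension, `Z` takes values in `G` up to
a finite-dimensional error. -/
theorem finite_quotient_comap_of_sub_mem {E X Y : Type*} [AddCommGroup E] [Module ℝ E]
    [AddCommGroup X] [Module ℂ X] [AddCommGroup Y] [Module ℂ Y] [Module ℝ X] [IsScalarTower ℝ ℂ X]
    [Module ℝ Y] [IsScalarTower ℝ ℂ Y] (Z : E →ₗ[ℝ] X × Y) (G : Submodule ℂ (X × Y))
    (I : Submodule ℝ E) [Module.Finite ℝ (E ⧸ I)] (N : Submodule ℂ X) [FiniteDimensional ℂ N]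
    (h : ∀ g ∈ I, ∃ w, (w, (Z g).2) ∈ G ∧ (Z g).1 - w ∈ N) :
    Module.Finite ℝ (E ⧸ (G.restrictScalars ℝ).comap Z) := by
  let q := (G.restrictScalars ℝ).mkQ
  have hk : LinearMap.ker (q ∘ₗ Z) = (G.restrictScalars ℝ).comap Z := by
    rw [LinearMap.ker_comp, Submodule.ker_mkQ]
  rw [← hk]
  have : Module.Finite ℝ N := Module.Finite.trans ℂ N
  have : Module.Finite ℝ (N.restrictScalars ℝ) := this
  refine finite_quotient_ker_of_finite_map _ I
    (N := (N.restrictScalars ℝ).map (q ∘ₗ LinearMap.inl ℝ X Y)) ?_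
  rintro _ ⟨g, hg, rfl⟩
  obtain ⟨w, hw, hN⟩ := h g hg
  refine ⟨(Z g).1 - w, hN, (Submodule.Quotient.eq _).2 ?_⟩
  have e : LinearMap.inl ℝ X Y ((Z g).1 - w) - Z g = -(w, (Z g).2) := by
    refine Prod.ext ?_ (zero_sub _)
    change (Z g).1 - w - (Z g).1 = -w
    abel
  rw [e]
  exact neg_mem hw

/-- If the quotient by an invariant subspace `J` is finite-dimensional, then some nonzero
polynomial of the endomorphism maps everything to `J`. -/
theorem exists_polynomial_aeval_mem {E : Type*} [AddCommGroup E] [Module ℝ E] (J : Submodule ℝ E)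
    [Module.Finite ℝ (E ⧸ J)] (M : Module.End ℝ E) (hM : J ≤ J.comap M) :
    ∃ P : Polynomial ℝ, P ≠ 0 ∧ ∀ g, Polynomial.aeval M P g ∈ J := by
  let N : Module.End ℝ (E ⧸ J) := J.mapQ J M hM
  have key : ∀ (P : Polynomial ℝ) (g : E),
      J.mkQ (Polynomial.aeval M P g) = Polynomial.aeval N P (J.mkQ g) := fun P g => by
    have hpow : ∀ (n : ℕ), J.mkQ ((M ^ n) g) = (N ^ n) (J.mkQ g) := fun n => by
      induction n with
      | zero => rfl
      | succ n ih => rw [pow_succ', pow_succ', Module.End.mul_apply, Module.End.mul_apply, ← ih]; rfl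
    induction P using Polynomial.induction_on' with
    | add p q hp hq => simp only [map_add, LinearMap.add_apply, hp, hq]
    | monomial n a =>
      simp only [Polynomial.aeval_monomial, Module.End.mul_apply, Module.algebraMap_end_apply,
        map_smul, hpow]
  refine ⟨N.charpoly, N.charpoly_monic.ne_zero, fun g => ?_⟩
  rw [← Submodule.Quotient.mk_eq_zero, ← Submodule.mkQ_apply, key, LinearMap.aeval_self_charpoly,
    LinearMap.zero_apply]

variable {K₁ K₂ : Type*} [NormedAddCommGroup K₁] [InnerProductSpace ℂ K₁] [NormedAddCommGroup K₂]
  [InnerProductSpace ℂ K₂]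

theorem orthogonal_map_snd_eq (Γ : Submodule ℂ (K₂ × K₁)) :
    (Γ.map (LinearMap.snd ℂ K₂ K₁))ᗮ = Γ.adjoint.comap (LinearMap.inl ℂ K₁ K₂) := by
  ext f
  constructor
  · intro hf
    exact mem_adjoint_of_forall fun u g hu =>
      ((Submodule.mem_orthogonal _ _).1 hf g ⟨(u, g), hu, rfl⟩).trans (inner_zero_right u).symm
  · intro hf
    refine (Submodule.mem_orthogonal _ _).2 ?_
    rintro _ ⟨⟨u, g⟩, hu, rfl⟩
    exact (inner_eq_of_mem_adjoint hu hf).trans (inner_zero_right _)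

theorem isClosed_map_snd [CompleteSpace K₁] [CompleteSpace K₂] {Γ : Submodule ℂ (K₂ × K₁)}
    (hΓ : IsClosed (Γ : Set (K₂ × K₁))) {C : ℝ} (hC : 0 ≤ C)
    (hbound : ∀ u g, (u, g) ∈ Γ → ‖u‖ ≤ C * ‖g‖) :
    IsClosed (Γ.map (LinearMap.snd ℂ K₂ K₁) : Set K₁) := by
  have : CompleteSpace Γ := hΓ.completeSpace_coe
  let F : Γ →L[ℂ] K₁ := ContinuousLinearMap.snd ℂ _ _ ∘L Γ.subtypeL
  have hF : ∀ x, ‖x‖ ≤ (1 + C) * ‖F x‖ := by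
    rintro ⟨⟨u, g⟩, hu⟩
    change max ‖u‖ ‖g‖ ≤ (1 + C) * ‖g‖
    have := hbound u g hu
    have := norm_nonneg g
    exact max_le (by nlinarith) (by nlinarith)
  have hcl : IsClosed (Set.range F) :=
    (AddMonoidHomClass.antilipschitz_of_bound F (K := ⟨1 + C, by positivity⟩)
      hF).isClosed_range F.uniformContinuous
  convert! hcl using 1
  ext g
  constructor
  · rintro ⟨x, hx, rfl⟩
    exact ⟨⟨x, hx⟩, rfl⟩
  · rintro ⟨⟨x, hx⟩, rfl⟩
    exact ⟨x, hx, rfl⟩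

end LinearAlgebra

section FiniteCodimension

/-- The space of real smooth compactly supported functions on `ℝᵈ`. -/
def smoothCompact (d : ℕ) : Submodule ℝ (Euc d → ℝ) where
  carrier := {g | IsSmoothCompact g}
  zero_mem' := ⟨contDiff_const, HasCompactSupport.zero⟩
  add_mem' := fun h1 h2 => ⟨h1.1.add h2.1, h1.2.add h2.2⟩
  smul_mem' := fun _ _ h => ⟨contDiff_const.smul h.1, h.2.smul_left⟩

variable {d : ℕ} {V : Type*} [NormedAddCommGroup V] [InnerProductSpace ℂ V]

theorem IsSmoothCompact.pderiv_smul_const {g : Euc d → ℝ} (h : IsSmoothCompact g) (χ : V)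
    (j : Fin d) : Zigzag.pderiv j (fun x => g x • χ) = fun x => Zigzag.pderiv j g x • χ := by
  funext x
  rw [pderiv_smul (h.differentiable x) (differentiableAt_const χ)]
  simp [Zigzag.pderiv]

theorem IsSmoothCompact.coeFn_toL2_pderiv {g : Euc d → ℝ} (h : IsSmoothCompact g) (χ : V)
    (Ω : Opens (Euc d)) (j : Fin d) : ((h.smul_const χ).pderiv j).toL2 Ω
      =ᵐ[volume.restrict (Ω : Set (Euc d))] fun x => Zigzag.pderiv j g x • χ := by
  rw [← h.pderiv_smul_const]
  exact ((h.smul_const χ).pderiv j).coeFn_toL2 Ω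

/-- The map `g ↦ (g χ, ∇(g χ))`, restricted to `Ω`. -/
def gradientPair (Ω : Opens (Euc d)) (χ : V) :
    smoothCompact d →ₗ[ℝ] L2 Ω V × (Fin d → L2 Ω V) where
  toFun g := ((g.2.smul_const χ).toL2 Ω, fun j => ((g.2.smul_const χ).pderiv j).toL2 Ω)
  map_add' g h := by
    refine Prod.ext (Lp.ext ?_) (funext fun j => Lp.ext ?_)
    · rw [Prod.fst_add]
      filter_upwards [((g + h).2.smul_const χ).coeFn_toL2 Ω, (g.2.smul_const χ).coeFn_toL2 Ω,
        (h.2.smul_const χ).coeFn_toL2 Ω,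
        Lp.coeFn_add ((g.2.smul_const χ).toL2 Ω) ((h.2.smul_const χ).toL2 Ω)] with x h1 h2 h3 h4
      rw [h1, h4, Pi.add_apply, h2, h3, ← add_smul]
      rfl
    · rw [Prod.snd_add, Pi.add_apply]
      filter_upwards [(g + h).2.coeFn_toL2_pderiv χ Ω j, g.2.coeFn_toL2_pderiv χ Ω j,
        h.2.coeFn_toL2_pderiv χ Ω j, Lp.coeFn_add (((g.2.smul_const χ).pderiv j).toL2 Ω)
          (((h.2.smul_const χ).pderiv j).toL2 Ω)] with x h1 h2 h3 h4
      rw [h1, h4, Pi.add_apply, h2, h3, ← add_smul]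
      congr 1
      change fderiv ℝ ((g : Euc d → ℝ) + (h : Euc d → ℝ)) x _ = _
      rw [fderiv_add (g.2.differentiable x) (h.2.differentiable x)]
      rfl
  map_smul' a g := by
    refine Prod.ext (Lp.ext ?_) (funext fun j => Lp.ext ?_)
    · rw [RingHom.id_apply, Prod.smul_fst]
      filter_upwards [((a • g).2.smul_const χ).coeFn_toL2 Ω, (g.2.smul_const χ).coeFn_toL2 Ω,
        Lp.coeFn_smul a ((g.2.smul_const χ).toL2 Ω)] with x h1 h2 h3
      rw [h1, h3, Pi.smul_apply, h2, smul_smul]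
      rfl
    · rw [RingHom.id_apply, Prod.smul_snd, Pi.smul_apply]
      filter_upwards [(a • g).2.coeFn_toL2_pderiv χ Ω j, g.2.coeFn_toL2_pderiv χ Ω j,
        Lp.coeFn_smul a (((g.2.smul_const χ).pderiv j).toL2 Ω)] with x h1 h2 h3
      rw [h1, h3, Pi.smul_apply, h2, smul_smul]
      congr 1
      change fderiv ℝ (a • (g : Euc d → ℝ)) x _ = _
      rw [fderiv_const_smul (g.2.differentiable x)]
      rfl

/-- Multiplication by `arctan xⱼ`. -/
def mulArctan (j : Fin d) : Module.End ℝ (smoothCompact d) where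
  toFun g := ⟨fun x => arctanCoord j x * (g : Euc d → ℝ) x,
    (contDiff_arctanCoord j).mul g.2.1, g.2.2.mul_left⟩
  map_add' _ _ := Subtype.ext (funext fun _ => mul_add _ _ _)
  map_smul' _ _ := Subtype.ext (funext fun _ => mul_left_comm _ _ _)

theorem aeval_mulArctan_apply (j : Fin d) (P : Polynomial ℝ) (g : smoothCompact d) (x : Euc d) :
    (Polynomial.aeval (mulArctan j) P g : Euc d → ℝ) x =
      P.eval (arctanCoord j x) * (g : Euc d → ℝ) x := by
  have hpow : ∀ n : ℕ, ((mulArctan j ^ n) g : Euc d → ℝ) x =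
      arctanCoord j x ^ n * (g : Euc d → ℝ) x := fun n => by
    induction n with
    | zero => simp
    | succ n ih =>
      rw [pow_succ', pow_succ', Module.End.mul_apply, mul_assoc, ← ih]
      rfl
  induction P using Polynomial.induction_on' with
  | add p q hp hq =>
    rw [Polynomial.eval_add, add_mul, ← hp, ← hq, map_add]
    rfl
  | monomial n a =>
    rw [Polynomial.eval_monomial, mul_assoc, ← hpow, Polynomial.aeval_monomial]
    rfl

theorem gradientPair_mulArctan_mem {Ω : Opens (Euc d)} {χ : V} (j : Fin d) {g : smoothCompact d}
    (h : gradientPair Ω χ g ∈ H10Graph Ω V) :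
    gradientPair Ω χ (mulArctan j g) ∈ H10Graph Ω V := by
  have hm := H10Graph_mul (contDiff_arctanCoord j) (abs_arctanCoord_le j)
    (continuous_pderiv_arctanCoord j) (abs_pderiv_arctanCoord_le j) h
  convert! hm using 1
  refine Prod.ext (Lp.ext ?_) (funext fun k => Lp.ext ?_)
  · filter_upwards [((mulArctan j g).2.smul_const χ).coeFn_toL2 Ω, (g.2.smul_const χ).coeFn_toL2 Ω,
      coeFn_mulL2 (contDiff_arctanCoord j (n := 1)).continuous (abs_arctanCoord_le j)
        ((g.2.smul_const χ).toL2 Ω)] with x h1 h2 h3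
    refine h1.trans (Eq.trans ?_ h3.symm)
    rw [h2, smul_smul]
    rfl
  · filter_upwards [(mulArctan j g).2.coeFn_toL2_pderiv χ Ω k, g.2.coeFn_toL2_pderiv χ Ω k,
      (g.2.smul_const χ).coeFn_toL2 Ω,
      coeFn_mulL2 (contDiff_arctanCoord j (n := 1)).continuous (abs_arctanCoord_le j)
        (((g.2.smul_const χ).pderiv k).toL2 Ω),
      coeFn_mulL2 (continuous_pderiv_arctanCoord j k) (abs_pderiv_arctanCoord_le j k)
        ((g.2.smul_const χ).toL2 Ω),
      Lp.coeFn_add (mulL2 Ω V (continuous_pderiv_arctanCoord j k) (abs_pderiv_arctanCoord_le j k)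
        ((g.2.smul_const χ).toL2 Ω))
        (mulL2 Ω V (contDiff_arctanCoord j (n := 1)).continuous (abs_arctanCoord_le j)
        (((g.2.smul_const χ).pderiv k).toL2 Ω))] with x h1 h2 h3 h4 h5 h6
    refine h1.trans (Eq.trans ?_ h6.symm)
    rw [Pi.add_apply, h5, h4, h3, h2, smul_smul, smul_smul, ← add_smul]
    congr 1
    exact pderiv_smul ((contDiff_arctanCoord j (n := 1)).differentiable one_ne_zero x)
      (g.2.differentiable x) k

variable {Ω : Opens (Euc d)} {B : Fin d → V →L[ℂ] V} {c : ℝ}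

/-- For `ψ = g χ` with a real function `g`, the identity `|∑ⱼ Bⱼ ∂ⱼψ|² = c² |∇ψ|²` holds
pointwise. -/
theorem IsClifford.inner_symbol_gradientPair (hB : IsClifford c B) (χ : V) (g : smoothCompact d) :
    inner ℂ (symbol Ω B (gradientPair Ω χ g).2) (symbol Ω B (gradientPair Ω χ g).2) =
      (c : ℂ) ^ 2 * ∑ j, inner ℂ ((gradientPair Ω χ g).2 j) ((gradientPair Ω χ g).2 j) := by
  refine hB.inner_symbol_of_swap fun j k => ?_
  rw [L2.inner_def, L2.inner_def]
  refine integral_congr_ae ?_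
  have h : ∀ a b, pointwise Ω (B a) ((gradientPair Ω χ g).2 b)
      =ᵐ[volume.restrict (Ω : Set (Euc d))] fun x => ((pderiv b g x : ℝ) : ℂ) • B a χ :=
    fun a b => by
      filter_upwards [coeFn_pointwise (B a) ((gradientPair Ω χ g).2 b),
        g.2.coeFn_toL2_pderiv χ Ω b] with x h1 h2
      rw [h1]
      refine (congrArg (B a) h2).trans ?_
      rw [← Complex.coe_smul, map_smul]
  filter_upwards [h j j, h k k, h j k, h k j] with x h1 h2 h3 h4
  rw [h1, h2, h3, h4]
  simp only [inner_smul_left, inner_smul_right, Complex.conj_ofReal]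
  ring

/-- If `A (g χ) = A w` with `w ∈ H¹₀`, then `∇(g χ) = ∇w`. -/
theorem IsClifford.gradientPair_eq [CompleteSpace V] (hB : IsClifford c B) (hc : 0 < c) (χ : V)
    (g : smoothCompact d) {w : L2 Ω V} {p : Fin d → L2 Ω V} (hw : (w, p) ∈ H10Graph Ω V)
    (h : symbol Ω B p = symbol Ω B (gradientPair Ω χ g).2) : p = (gradientPair Ω χ g).2 := by
  set D := (gradientPair Ω χ g).2 with hD
  have e1 : inner ℂ (symbol Ω B D) (symbol Ω B D) = (c : ℂ) ^ 2 * ∑ j, inner ℂ (D j) (D j) :=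
    hB.inner_symbol_gradientPair χ g
  have e2 : inner ℂ (symbol Ω B D) (symbol Ω B p) = (c : ℂ) ^ 2 * ∑ j, inner ℂ (D j) (p j) :=
    hB.inner_symbol_toL2 (g.2.smul_const χ) hw
  have e3 : inner ℂ (symbol Ω B p) (symbol Ω B D) = (c : ℂ) ^ 2 * ∑ j, inner ℂ (p j) (D j) := by
    rw [← inner_conj_symm, e2]
    simp [map_sum]
  have e4 := hB.inner_symbol hw hw
  have hc2 : (c : ℂ) ^ 2 ≠ 0 := pow_ne_zero 2 (Complex.ofReal_ne_zero.2 hc.ne')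
  have e5 : ∑ j, inner ℂ (D j - p j) (D j - p j) = 0 := by
    refine mul_left_cancel₀ hc2 ?_
    simp only [inner_sub_left, inner_sub_right, Finset.sum_sub_distrib, mul_sub, mul_zero]
    rw [← e1, ← e2, ← e3, ← e4, h]
    ring
  have e6 : ∑ j, ‖D j - p j‖ ^ 2 = 0 := by
    have := congrArg Complex.re e5
    rw [Complex.re_sum] at this
    rw [← Complex.zero_re, ← this]
    exact Finset.sum_congr rfl fun j _ => (inner_self_eq_norm_sq (𝕜 := ℂ) (D j - p j)).symm
  funext j
  have := (Finset.sum_eq_zero_iff_of_nonneg fun j _ => sq_nonneg ‖D j - p j‖).1 e6 j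
    (Finset.mem_univ j)
  exact (sub_eq_zero.1 (norm_eq_zero.1 (pow_eq_zero_iff two_ne_zero |>.1 this))).symm

/-- If `g χ` has the same gradient as `w ∈ H¹₀`, then the difference is in the kernel of `A*`. -/
theorem gradientPair_sub_mem_ker {χ : V} {g : smoothCompact d} {w : L2 Ω V}
    (hw : (w, (gradientPair Ω χ g).2) ∈ H10Graph Ω V) :
    ((gradientPair Ω χ g).1 - w, (0 : L2 Ω V)) ∈ (firstOrderGraph Ω B).adjoint := by
  refine mem_adjoint_of_forall fun u k hu => ?_
  obtain ⟨q, hq, rfl⟩ := mem_firstOrderGraph.1 hu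
  rw [inner_zero_right, symbol_apply, sum_inner]
  refine Finset.sum_eq_zero fun j _ => ?_
  have h1 := H10Graph_inner hw (H10Graph_pointwise (B j) hq) j
  have h2 := H10Graph_inner_toL2 (g.2.smul_const χ) (H10Graph_pointwise (B j) hq) j
  have h3 := congrArg (starRingEnd ℂ) h2
  rw [map_neg, inner_conj_symm, inner_conj_symm] at h3
  rw [inner_sub_right, sub_eq_zero, h1]
  exact (neg_eq_iff_eq_neg.2 h3).symm

variable [FiniteDimensional ℂ V]

/-- If `A` is bounded below and `A*` has a finite-dimensional kernel, then `g χ ∈ H¹₀(Ω; V)` for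
all `g` in a subspace of finite codimension in `C₀^∞(ℝᵈ)`. -/
theorem IsClifford.finite_quotient_gradientPair (hB : IsClifford c B) (hc : 0 < c) {C : ℝ}
    (hC : 0 ≤ C) (hbound : ∀ u g, (u, g) ∈ firstOrderGraph Ω B → ‖u‖ ≤ C * ‖g‖)
    (hfin : FiniteDimensional ℂ
      ((firstOrderGraph Ω B).adjoint.comap (LinearMap.inl ℂ (L2 Ω V) (L2 Ω V)))) (χ : V) :
    Module.Finite ℝ (smoothCompact d ⧸
      ((H10Graph Ω V).restrictScalars ℝ).comap (gradientPair Ω χ)) := by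
  have : CompleteSpace V := FiniteDimensional.complete ℂ V
  let R : Submodule ℂ (L2 Ω V) := (firstOrderGraph Ω B).map (LinearMap.snd ℂ _ _)
  have hperp : Rᗮ = (firstOrderGraph Ω B).adjoint.comap (LinearMap.inl ℂ _ _) :=
    orthogonal_map_snd_eq _
  have hRc : IsClosed (R : Set (L2 Ω V)) :=
    isClosed_map_snd (hB.isClosed_firstOrderGraph hc) hC hbound
  have : CompleteSpace R := hRc.completeSpace_coe
  have hfin' : FiniteDimensional ℂ Rᗮ := by rw [hperp]; exact hfin
  let T : smoothCompact d →ₗ[ℝ] L2 Ω V :=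
    (symbol Ω B).toLinearMap.restrictScalars ℝ ∘ₗ LinearMap.snd ℝ _ _ ∘ₗ gradientPair Ω χ
  -- `A (g χ)` is in the closed range of `A` for all `g` in a subspace of finite codimension. For
  -- these `g` there is `w ∈ H¹₀` with the gradient of `g χ`, and `g χ - w` is in `ker A*`.
  have hI := finite_quotient_comap R T
  refine finite_quotient_comap_of_sub_mem (gradientPair Ω χ) (H10Graph Ω V)
    ((R.restrictScalars ℝ).comap T) Rᗮ fun g hg => ?_
  obtain ⟨⟨w, k⟩, hwk, (hk : k = T g)⟩ := hg
  obtain ⟨p, hp, hpk⟩ := mem_firstOrderGraph.1 hwk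
  obtain rfl := hB.gradientPair_eq hc χ g hp (hpk.trans hk)
  refine ⟨w, hp, ?_⟩
  rw [hperp]
  exact gradientPair_sub_mem_ker hp

/-- Multiplication by `arctan xⱼ` preserves the functions `g` with `g χ ∈ H¹₀(Ω; V)`. As these have
finite codimension, some nonzero polynomial in `arctan xⱼ` maps all smooth functions to them. -/
theorem IsClifford.exists_polynomial_mul_mem (hB : IsClifford c B) (hc : 0 < c) {C : ℝ}
    (hC : 0 ≤ C) (hbound : ∀ u g, (u, g) ∈ firstOrderGraph Ω B → ‖u‖ ≤ C * ‖g‖)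
    (hfin : FiniteDimensional ℂ
      ((firstOrderGraph Ω B).adjoint.comap (LinearMap.inl ℂ (L2 Ω V) (L2 Ω V)))) (χ : V)
    (j : Fin d) : ∃ P : Polynomial ℝ, P ≠ 0 ∧ ∀ g h : smoothCompact d,
      (∀ x, (h : Euc d → ℝ) x = P.eval (arctanCoord j x) * (g : Euc d → ℝ) x) →
        gradientPair Ω χ h ∈ H10Graph Ω V := by
  have := hB.finite_quotient_gradientPair hc hC hbound hfin χ
  obtain ⟨P, hP, h⟩ := exists_polynomial_aeval_mem
    (((H10Graph Ω V).restrictScalars ℝ).comap (gradientPair Ω χ)) (mulArctan j)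
    (fun g hg => gradientPair_mulArctan_mem j hg)
  refine ⟨P, hP, fun g k hk => ?_⟩
  have e : k = Polynomial.aeval (mulArctan j) P g :=
    Subtype.ext (funext fun x => (hk x).trans (aeval_mulArctan_apply j P g x).symm)
  rw [e]
  exact h g

end FiniteCodimension

/-! ### Sets that contain a half space up to a null set -/

section HalfSpace

variable {d : ℕ}

theorem isSmoothCompact_bump (f : ContDiffBump (0 : Euc d)) (x : Euc d) :
    IsSmoothCompact fun t => f (x - t) :=
  ⟨f.contDiff.comp (contDiff_const.sub contDiff_id),
    f.hasCompactSupport.comp_homeomorph (Homeomorph.subLeft x)⟩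

theorem tsupport_bump_subset (f : ContDiffBump (0 : Euc d)) (x : Euc d) :
    tsupport (fun t => f (x - t)) ⊆ Metric.closedBall x f.rOut := by
  refine closure_minimal (fun t ht => ?_) Metric.isClosed_closedBall
  have h : x - t ∈ Metric.ball (0 : Euc d) f.rOut := by rw [← f.support_eq]; exact ht
  rw [mem_ball_zero_iff, ← dist_eq_norm, dist_comm] at h
  exact h.le

theorem abs_coord_sub_le {x t : Euc d} {r : ℝ} (h : t ∈ Metric.closedBall x r) (j : Fin d) :
    |t j - x j| ≤ r := by
  have h1 := PiLp.norm_apply_le (t - x) j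
  rw [Metric.mem_closedBall, dist_eq_norm] at h
  exact h1.trans h

/-- The mollification `x ↦ ∫_Ω f(x - t) dt` is constant on a convex open set `s` if the integrals
over `Ω` of the derivatives of the functions `t ↦ f(x - t)`, `x ∈ s`, vanish. -/
theorem setIntegral_bump_eq (Ω : Opens (Euc d)) (f : ContDiffBump (0 : Euc d)) {s : Set (Euc d)}
    (hs : Convex ℝ s) (ho : IsOpen s)
    (h : ∀ x ∈ s, ∀ k, ∫ t in Ω, pderiv k (fun t => f (x - t)) t = 0) {x y : Euc d} (hx : x ∈ s)
    (hy : y ∈ s) : ∫ t in Ω, f (x - t) = ∫ t in Ω, f (y - t) := by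
  let i : Euc d → ℝ := (Ω : Set (Euc d)).indicator fun _ => 1
  have hi : LocallyIntegrable i volume :=
    (locallyIntegrable_const (1 : ℝ)).indicator Ω.isOpen.measurableSet
  have hind : ∀ g : Euc d → ℝ, ∫ t, i t * g t = ∫ t in Ω, g t := fun g => by
    rw [← integral_indicator Ω.isOpen.measurableSet]
    refine integral_congr_ae (Filter.Eventually.of_forall fun t => ?_)
    by_cases ht : t ∈ (Ω : Set (Euc d)) <;> simp [i, ht]
  let F : Euc d → ℝ := convolution i f (ContinuousLinearMap.lsmul ℝ ℝ) volume
  have hF : ∀ x, F x = ∫ t in Ω, f (x - t) := fun x => by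
    rw [← hind]
    rfl
  have hd : ∀ x, HasFDerivAt F _ x := fun x =>
    f.hasCompactSupport.hasFDerivAt_convolution_right (ContinuousLinearMap.lsmul ℝ ℝ) hi
      (f.contDiff (n := 1)) x
  have hz : ∀ x ∈ s, fderiv ℝ F x = 0 := fun x hx => by
    rw [(hd x).fderiv]
    refine ContinuousLinearMap.coe_injective
      ((EuclideanSpace.basisFun (Fin d) ℝ).toBasis.ext fun k => ?_)
    rw [OrthonormalBasis.coe_toBasis, EuclideanSpace.basisFun_apply,
      ContinuousLinearMap.coe_coe, convolution_precompR_apply _ hi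
      (f.hasCompactSupport.fderiv ℝ) ((f.contDiff (n := 1)).continuous_fderiv one_ne_zero)]
    have e : ∀ t, pderiv k (fun t => f (x - t)) t =
        -(fderiv ℝ f (x - t) (EuclideanSpace.single k 1)) := fun t => by
      have h1 := ((f.contDiff (n := 1)).differentiable one_ne_zero (x - t)).hasFDerivAt.comp t
        ((hasFDerivAt_id t).const_sub x)
      have h2 : fderiv ℝ (fun t => f (x - t)) t = _ := h1.fderiv
      rw [pderiv, h2]
      simp
    have h2 := h x hx k
    simp only [e, integral_neg, neg_eq_zero] at h2
    rw [← hind] at h2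
    exact h2
  rw [← hF, ← hF]
  exact ho.is_const_of_fderiv_eq_zero hs.isPreconnected
    (fun x _ => (hd x).differentiableAt.differentiableWithinAt) hz hx hy

theorem exists_mem_coord_notMem (Ω : Opens (Euc d)) (hΩ : (Ω : Set (Euc d)).Nonempty) (j : Fin d)
    {F : Set ℝ} (hF : F.Finite) : ∃ y ∈ Ω, y j ∉ F := by
  obtain ⟨x, hx⟩ := hΩ
  have hc : Continuous fun t : ℝ => x + EuclideanSpace.single j t := by
    have : (fun t : ℝ => x + EuclideanSpace.single j t) =
        fun t : ℝ => x + t • EuclideanSpace.single j (1 : ℝ) := by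
      funext t
      congr 1
      ext k
      simp
    rw [this]
    fun_prop
  have hn : (fun t : ℝ => x + EuclideanSpace.single j t) ⁻¹' Ω ∈ nhds (0 : ℝ) := by
    refine hc.continuousAt.preimage_mem_nhds (Ω.isOpen.mem_nhds ?_)
    have : x + EuclideanSpace.single j (0 : ℝ) = x := by
      ext k; simp
    simpa only [this] using hx
  have hinf := infinite_of_mem_nhds (0 : ℝ) hn
  have hfin : ((fun t : ℝ => x j + t) ⁻¹' F).Finite :=
    hF.preimage (add_right_injective (x j)).injOn
  obtain ⟨t, ht, ht'⟩ := hinf.exists_notMem_finite hfin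
  refine ⟨_, ht, ?_⟩
  simpa using ht'

/-- If `∫_Ω ∂ₖ h = 0` for all `h` whose support avoids finitely many hyperplanes `x_{j₀} = t` or
finitely many hyperplanes `x_{j₁} = t`, then `Ω` contains a half space up to a null set. -/
theorem exists_halfSpace_diff_null (Ω : Opens (Euc d)) (hΩ : (Ω : Set (Euc d)).Nonempty)
    {j₀ j₁ : Fin d} (hj : j₀ ≠ j₁) {F₀ F₁ : Set ℝ} (hF₀ : F₀.Finite) (hF₁ : F₁.Finite)
    (h₀ : ∀ h : Euc d → ℝ, IsSmoothCompact h → (∀ x ∈ tsupport h, x j₀ ∉ F₀) →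
      ∀ k, ∫ x in Ω, pderiv k h x = 0)
    (h₁ : ∀ h : Euc d → ℝ, IsSmoothCompact h → (∀ x ∈ tsupport h, x j₁ ∉ F₁) →
      ∀ k, ∫ x in Ω, pderiv k h x = 0) :
    ∃ β : ℝ, (∀ t > β, t ∉ F₁) ∧ volume ({x : Euc d | β < x j₁} \ Ω) = 0 := by
  obtain ⟨y, hy, hyF⟩ := exists_mem_coord_notMem Ω hΩ j₀ hF₀
  obtain ⟨ε, hε, hεF⟩ := Metric.isOpen_iff.1 hF₀.isClosed.isOpen_compl (y j₀) hyF
  obtain ⟨r, hr, hrΩ⟩ := Metric.isOpen_iff.1 Ω.isOpen y hy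
  obtain ⟨b, hb⟩ := hF₁.bddAbove
  -- Balls of radius `δ` centred in the slab `|x_{j₀} - y_{j₀}| < δ` avoid the hyperplanes over `F₀`,
  -- those centred in the half space `x_{j₁} > b + δ` avoid the hyperplanes over `F₁`.
  let δ := min (ε / 2) r / 2
  have hδ : 0 < δ := by positivity
  have hδε : 2 * δ < ε := by
    have : min (ε / 2) r ≤ ε / 2 := min_le_left _ _
    have : δ = min (ε / 2) r / 2 := rfl
    linarith
  have hδr : δ < r := by
    have : min (ε / 2) r ≤ r := min_le_right _ _
    have : δ = min (ε / 2) r / 2 := rfl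
    linarith
  let f : ContDiffBump (0 : Euc d) := ⟨δ / 2, δ, by positivity, by linarith⟩
  have hcoord : ∀ j : Fin d, Continuous fun x : Euc d => x j := fun j => by fun_prop
  have slab : ∀ x : Euc d, |x j₀ - y j₀| < δ → ∀ k, ∫ t in Ω, pderiv k (fun t => f (x - t)) t = 0 :=
    fun x hx => h₀ _ (isSmoothCompact_bump f x) fun t ht => by
      refine hεF ?_
      have h1 : |t j₀ - x j₀| ≤ δ := abs_coord_sub_le (tsupport_bump_subset f x ht) j₀
      rw [Metric.mem_ball, Real.dist_eq]
      have := abs_sub_le (t j₀) (x j₀) (y j₀)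
      linarith
  have half : ∀ x : Euc d, b + δ < x j₁ → ∀ k, ∫ t in Ω, pderiv k (fun t => f (x - t)) t = 0 :=
    fun x hx => h₁ _ (isSmoothCompact_bump f x) fun t ht htF => by
      have h1 : |t j₁ - x j₁| ≤ δ := abs_coord_sub_le (tsupport_bump_subset f x ht) j₁
      have h2 := hb htF
      have := (abs_le.1 h1).1
      linarith
  have slab_convex : Convex ℝ {x : Euc d | |x j₀ - y j₀| < δ} := by
    have : {x : Euc d | |x j₀ - y j₀| < δ} =
        (EuclideanSpace.proj j₀ : Euc d →L[ℝ] ℝ) ⁻¹' Metric.ball (y j₀) δ := by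
      ext x
      simp [Real.dist_eq]
    rw [this]
    exact (convex_ball _ _).linear_preimage (EuclideanSpace.proj j₀ : Euc d →L[ℝ] ℝ).toLinearMap
  have half_convex : Convex ℝ {x : Euc d | b + δ < x j₁} :=
    (convex_Ioi (b + δ)).linear_preimage (EuclideanSpace.proj j₁ : Euc d →L[ℝ] ℝ).toLinearMap
  have slab_open : IsOpen {x : Euc d | |x j₀ - y j₀| < δ} :=
    isOpen_lt ((hcoord j₀).sub continuous_const).abs continuous_const
  have half_open : IsOpen {x : Euc d | b + δ < x j₁} := isOpen_lt continuous_const (hcoord j₁)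
  -- a common point of the slab and the half space
  let z : Euc d := y + EuclideanSpace.single j₁ (|b| + |y j₁| + δ + 1)
  have hz₀ : z j₀ = y j₀ := by simp [z, hj]
  have hz₁ : z j₁ = y j₁ + (|b| + |y j₁| + δ + 1) := by simp [z]
  have hzslab : z ∈ {x : Euc d | |x j₀ - y j₀| < δ} := by
    change |z j₀ - y j₀| < δ
    rw [hz₀, sub_self, abs_zero]
    exact hδ
  have hzhalf : z ∈ {x : Euc d | b + δ < x j₁} := by
    change b + δ < z j₁
    rw [hz₁]
    have := le_abs_self b
    have := neg_abs_le (y j₁)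
    linarith
  have hyslab : y ∈ {x : Euc d | |x j₀ - y j₀| < δ} := by
    change |y j₀ - y j₀| < δ
    rw [sub_self, abs_zero]
    exact hδ
  -- The ball around `y` is contained in `Ω`, so the mollification has its full value there.
  have hfull : ∫ t in Ω, f (y - t) = ∫ t, f t := by
    rw [setIntegral_eq_integral_of_forall_compl_eq_zero]
    · exact integral_sub_left_eq_self (fun t => f t) volume y
    · intro t ht
      refine f.zero_of_le_dist ?_
      rw [dist_zero_right, ← dist_eq_norm, dist_comm]
      by_contra hlt
      exact ht (hrΩ (Metric.mem_ball.2 ((not_le.1 hlt).trans hδr)))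
  have key : ∀ x ∈ {x : Euc d | b + δ < x j₁}, ∫ t in Ω, f (x - t) = ∫ t, f (x - t) :=
    fun x hx => by
      rw [setIntegral_bump_eq Ω f half_convex half_open half hx hzhalf,
        setIntegral_bump_eq Ω f slab_convex slab_open slab hzslab hyslab, hfull]
      exact (integral_sub_left_eq_self (fun t => f t) volume x).symm
  refine ⟨b + δ, fun t ht htF => ?_, ?_⟩
  · have := hb htF
    linarith
  refine measure_null_of_locally_null _ fun x hx => ⟨Metric.ball x δ \ Ω, ?_, ?_⟩
  · have h1 : Metric.ball x δ ∩ ({x : Euc d | b + δ < x j₁} \ Ω) ∈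
        nhdsWithin x ({x : Euc d | b + δ < x j₁} \ Ω) :=
      Filter.inter_mem (mem_nhdsWithin_of_mem_nhds (Metric.ball_mem_nhds x hδ)) self_mem_nhdsWithin
    exact Filter.mem_of_superset h1 fun t ht => ⟨ht.1, ht.2.2⟩
  · have hint : Integrable (fun t => f (x - t)) volume :=
      (isSmoothCompact_bump f x).1.continuous.integrable_of_hasCompactSupport
        (isSmoothCompact_bump f x).2
    have h1 := integral_add_compl Ω.isOpen.measurableSet hint
    rw [key x hx.1] at h1
    have h2 : ∫ t in (Ω : Set (Euc d))ᶜ, f (x - t) = 0 := by linarith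
    rw [setIntegral_eq_zero_iff_of_nonneg_ae (Filter.Eventually.of_forall fun t => f.nonneg)
      hint.integrableOn] at h2
    have h3 : ∀ᵐ t ∂volume, t ∈ (Ω : Set (Euc d))ᶜ → f (x - t) = 0 :=
      (ae_restrict_iff' Ω.isOpen.measurableSet.compl).1 h2
    refine measure_mono_null (fun t ht => ?_) h3
    intro ht'
    refine (f.pos_of_mem_ball (x := x - t) ?_).ne' (ht' ht.2)
    rw [mem_ball_zero_iff, ← dist_eq_norm, dist_comm]
    exact ht.1

end HalfSpace

/-! ### The kernel of the adjoint is infinite-dimensional -/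

section InfiniteKernel

variable {d : ℕ} {V : Type*} [NormedAddCommGroup V] [InnerProductSpace ℂ V] {Ω : Opens (Euc d)}

theorem norm_sq_L2_eq_integral (f : L2 Ω V) : ‖f‖ ^ 2 = ∫ x in Ω, ‖f x‖ ^ 2 := by
  have h : (((‖f‖ ^ 2 : ℝ)) : ℂ) = ((∫ x in Ω, ‖f x‖ ^ 2 : ℝ) : ℂ) := by
    rw [← integral_complex_ofReal, Complex.ofReal_pow]
    refine (inner_self_eq_norm_sq_to_K f).symm.trans ?_
    rw [L2.inner_def]
    refine integral_congr_ae (Filter.Eventually.of_forall fun x => ?_)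
    exact (inner_self_eq_norm_sq_to_K (𝕜 := ℂ) (f x)).trans (Complex.ofReal_pow _ _).symm
  exact Complex.ofReal_injective h

/-- Division by a function `P(arctan xⱼ)` that does not vanish on the support. -/
theorem exists_eq_eval_arctan_mul (P : Polynomial ℝ) (j : Fin d) (h : smoothCompact d)
    (hP : ∀ x ∈ tsupport (h : Euc d → ℝ), P.eval (arctanCoord j x) ≠ 0) :
    ∃ g : smoothCompact d,
      ∀ x, (h : Euc d → ℝ) x = P.eval (arctanCoord j x) * (g : Euc d → ℝ) x := by
  have hPs : ContDiff ℝ ((⊤ : ℕ∞) : WithTop ℕ∞) fun x : Euc d => P.eval (arctanCoord j x) := by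
    have : (fun x : Euc d => P.eval (arctanCoord j x)) =
        fun x => Polynomial.aeval (arctanCoord j x) P := by
      funext x; simp
    rw [this]
    exact P.contDiff_aeval _ |>.comp (contDiff_arctanCoord j)
  refine ⟨⟨fun x => (h : Euc d → ℝ) x / P.eval (arctanCoord j x),
    contDiff_iff_contDiffAt.2 fun x => ?_, ?_⟩, fun x => ?_⟩
  · by_cases hx : x ∈ tsupport (h : Euc d → ℝ)
    · exact h.2.1.contDiffAt.div hPs.contDiffAt (hP x hx)
    · have h0 : (h : Euc d → ℝ) =ᶠ[nhds x] 0 := notMem_tsupport_iff_eventuallyEq.1 hx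
      refine contDiffAt_const (c := (0 : ℝ)) |>.congr_of_eventuallyEq ?_
      filter_upwards [h0] with t ht
      rw [ht, Pi.zero_apply, zero_div]
  · simp only [div_eq_mul_inv]
    exact h.2.2.mul_right
  · by_cases hx : x ∈ tsupport (h : Euc d → ℝ)
    · exact (mul_div_cancel₀ _ (hP x hx)).symm
    · change (h : Euc d → ℝ) x = _ * ((h : Euc d → ℝ) x / _)
      rw [image_eq_zero_of_notMem_tsupport hx, zero_div, mul_zero]

/-- If the restriction of `h χ` to `Ω` vanishes on the boundary, then `∫_Ω ∂ₖ h = 0`. -/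
theorem setIntegral_pderiv_eq_zero {χ : V} (hχ : χ ≠ 0) {h : smoothCompact d}
    (hh : gradientPair Ω χ h ∈ H10Graph Ω V) (k : Fin d) :
    ∫ x in Ω, pderiv k (h : Euc d → ℝ) x = 0 := by
  -- Integrate by parts against a cutoff function that is `1` near the support of `h`.
  obtain ⟨R, hR⟩ := h.2.2.isCompact.isBounded.subset_ball (0 : Euc d)
  let f : ContDiffBump (0 : Euc d) := ⟨max R 1, max R 1 + 1, by positivity, by linarith⟩
  have hf : IsSmoothCompact (f : Euc d → ℝ) := ⟨f.contDiff, f.hasCompactSupport⟩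
  have hball : ∀ x ∈ tsupport (h : Euc d → ℝ), x ∈ Metric.ball (0 : Euc d) f.rIn := fun x hx =>
    Metric.ball_subset_ball (le_max_left _ _) (hR hx)
  have hibp := H10Graph_inner_toL2 (hf.smul_const χ) hh k
  have e1 : inner ℂ (((hf.smul_const χ).pderiv k).toL2 Ω) (gradientPair Ω χ h).1 = 0 := by
    rw [L2.inner_def]
    refine integral_eq_zero_of_ae ?_
    filter_upwards [hf.coeFn_toL2_pderiv χ Ω k, (h.2.smul_const χ).coeFn_toL2 Ω] with x h1 h2
    rw [h1]
    refine (congrArg (inner ℂ _) h2).trans ?_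
    by_cases hx : x ∈ tsupport (h : Euc d → ℝ)
    · have : pderiv k f x = 0 := by
        rw [pderiv, (f.eventuallyEq_one_of_mem_ball (hball x hx)).fderiv_eq, fderiv_one]
        rfl
      rw [this, zero_smul, inner_zero_left]
      rfl
    · rw [image_eq_zero_of_notMem_tsupport hx, zero_smul, inner_zero_right]
      rfl
  have e2 : inner ℂ ((hf.smul_const χ).toL2 Ω) ((gradientPair Ω χ h).2 k) =
      ((∫ x in Ω, pderiv k (h : Euc d → ℝ) x : ℝ) : ℂ) * inner ℂ χ χ := by
    rw [L2.inner_def, ← integral_complex_ofReal, ← integral_mul_const]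
    refine integral_congr_ae ?_
    filter_upwards [(hf.smul_const χ).coeFn_toL2 Ω, h.2.coeFn_toL2_pderiv χ Ω k] with x h1 h2
    rw [h1]
    refine (congrArg (inner ℂ _) h2).trans ?_
    by_cases hx : x ∈ tsupport (h : Euc d → ℝ)
    · rw [f.one_of_mem_closedBall (Metric.ball_subset_closedBall (hball x hx)), one_smul,
        ← Complex.coe_smul, inner_smul_right]
    · have : pderiv k (h : Euc d → ℝ) x = 0 := by
        rw [pderiv, image_eq_zero_of_notMem_tsupport fun h' => hx (tsupport_fderiv_subset ℝ h')]
        rfl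
      rw [this, zero_smul, inner_zero_right, Complex.ofReal_zero, zero_mul]
  replace hibp := neg_eq_zero.1 ((e1.symm.trans (hibp.trans (congrArg Neg.neg e2))).symm)
  have := (mul_eq_zero.1 hibp).resolve_right (inner_self_ne_zero.2 hχ)
  exact Complex.ofReal_eq_zero.1 this

/-- A bump function of width `R`, centred at `z`. -/
def scaledBump (f : ContDiffBump (0 : Euc d)) (z : Euc d) {R : ℝ} (hR : 0 < R) :
    smoothCompact d :=
  ⟨fun x => f (R⁻¹ • (x - z)), f.contDiff.comp (by fun_prop : ContDiff ℝ _ fun x => R⁻¹ • (x - z)),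
    f.hasCompactSupport.comp_homeomorph
      ((Homeomorph.subRight z).trans (Homeomorph.smulOfNeZero R⁻¹ (inv_pos.2 hR).ne'))⟩

theorem tsupport_scaledBump_subset (f : ContDiffBump (0 : Euc d)) (z : Euc d) {R : ℝ} (hR : 0 < R) :
    tsupport (scaledBump f z hR : Euc d → ℝ) ⊆ Metric.closedBall z (R * f.rOut) := by
  refine closure_minimal (fun x hx => ?_) Metric.isClosed_closedBall
  have h : R⁻¹ • (x - z) ∈ Metric.ball (0 : Euc d) f.rOut := by rw [← f.support_eq]; exact hx
  rw [mem_ball_zero_iff, norm_smul, Real.norm_of_nonneg (inv_pos.2 hR).le, ← dist_eq_norm,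
    inv_mul_lt_iff₀ hR] at h
  exact h.le

theorem pderiv_scaledBump (f : ContDiffBump (0 : Euc d)) (z : Euc d) {R : ℝ} (hR : 0 < R)
    (j : Fin d) (x : Euc d) : pderiv j (scaledBump f z hR : Euc d → ℝ) x =
      R⁻¹ * pderiv j f (R⁻¹ • (x - z)) := by
  have h1 := ((f.contDiff (n := 1)).differentiable one_ne_zero (R⁻¹ • (x - z))).hasFDerivAt.comp x
    (((hasFDerivAt_id x).sub_const z).const_smul R⁻¹)
  have h2 : fderiv ℝ (scaledBump f z hR : Euc d → ℝ) x = _ := h1.fderiv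
  rw [pderiv, h2]
  simp [pderiv]

/-- A set that contains a half space up to a null set admits no Poincaré inequality for the
functions supported in the half space: bump functions of large width violate it. -/
theorem not_poincare_of_halfSpace {j₁ : Fin d} {β : ℝ}
    (hnull : volume ({x : Euc d | β < x j₁} \ Ω) = 0) {χ : V} (hχ : χ ≠ 0) (C : ℝ)
    (h : ∀ g : smoothCompact d, (∀ x ∈ tsupport (g : Euc d → ℝ), β < x j₁) →
      ‖(gradientPair Ω χ g).1‖ ^ 2 ≤ C * ∑ j, ‖(gradientPair Ω χ g).2 j‖ ^ 2) : False := by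
  let f : ContDiffBump (0 : Euc d) := ⟨1, 2, one_pos, one_lt_two⟩
  have hf : IsSmoothCompact (f : Euc d → ℝ) := ⟨f.contDiff, f.hasCompactSupport⟩
  have hM : ∃ M : ℝ, ∀ j x, |pderiv j f x| ≤ M := by
    choose M hM using fun j =>
      (hf.pderiv j).1.continuous.bounded_above_of_compact_support (hf.pderiv j).2
    refine ⟨∑ j, |M j|, fun j x => (hM j x).trans ((le_abs_self _).trans ?_)⟩
    exact Finset.single_le_sum (f := fun j => |M j|) (fun i _ => abs_nonneg _) (Finset.mem_univ j)
  obtain ⟨M, hM⟩ := hM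
  -- For a bump function of width `R`, the inequality gives `R² ≤ K`.
  let K : ℝ := |C| * d * M ^ 2 * 2 ^ d
  have hK : 0 ≤ K := by positivity
  let R : ℝ := K + 1
  have hR : 0 < R := by positivity
  let z : Euc d := EuclideanSpace.single j₁ (β + 2 * R + 1)
  have hz : z j₁ = β + 2 * R + 1 := by simp [z]
  have hpos : ∀ x ∈ Metric.closedBall z (R * 2), β < x j₁ := fun x hx => by
    have h1 := (abs_le.1 (abs_coord_sub_le hx j₁)).1
    rw [hz] at h1
    linarith
  let g := scaledBump f z hR
  have hsupp : tsupport (g : Euc d → ℝ) ⊆ Metric.closedBall z (R * 2) :=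
    tsupport_scaledBump_subset f z hR
  have hineq := h g fun x hx => hpos x (hsupp hx)
  let v : ℝ := (volume (Metric.ball (0 : Euc d) 1)).toReal
  have hv : 0 < v := ENNReal.toReal_pos (Metric.measure_ball_pos _ _ one_pos).ne'
    measure_ball_lt_top.ne
  have hvol : ∀ r : ℝ, 0 ≤ r → (volume (Metric.closedBall z r)).toReal = r ^ d * v := fun r hr => by
    rw [Measure.addHaar_closedBall _ _ hr, ENNReal.toReal_mul, ENNReal.toReal_ofReal (by positivity),
      finrank_euclideanSpace_fin]
  have hχ2 : 0 < ‖χ‖ ^ 2 := by positivity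
  have hlow : R ^ d * v * ‖χ‖ ^ 2 ≤ ‖(gradientPair Ω χ g).1‖ ^ 2 := by
    have e : ‖(gradientPair Ω χ g).1‖ ^ 2 = ∫ x in Ω, ‖(g : Euc d → ℝ) x • χ‖ ^ 2 := by
      rw [norm_sq_L2_eq_integral]
      refine integral_congr_ae ?_
      filter_upwards [(g.2.smul_const χ).coeFn_toL2 Ω] with x hx
      exact congrArg (fun y => ‖y‖ ^ 2) hx
    have hint : Integrable (fun x => ‖(g : Euc d → ℝ) x • χ‖ ^ 2)
        (volume.restrict (Ω : Set (Euc d))) := ((g.2.smul_const χ).memLp Ω).integrable_norm_pow two_ne_zero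
    have hsub : ∫ x in (Ω : Set (Euc d)) ∩ Metric.closedBall z R, ‖(g : Euc d → ℝ) x • χ‖ ^ 2 ≤
        ∫ x in Ω, ‖(g : Euc d → ℝ) x • χ‖ ^ 2 :=
      setIntegral_mono_set hint (Filter.Eventually.of_forall fun x => sq_nonneg _)
        (Set.inter_subset_left).eventuallyLE
    have hone : ∀ x ∈ (Ω : Set (Euc d)) ∩ Metric.closedBall z R,
        ‖(g : Euc d → ℝ) x • χ‖ ^ 2 = ‖χ‖ ^ 2 := fun x hx => by
      have : (g : Euc d → ℝ) x = 1 := by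
        refine f.one_of_mem_closedBall ?_
        rw [mem_closedBall_zero_iff, norm_smul, Real.norm_of_nonneg (inv_pos.2 hR).le,
          ← dist_eq_norm]
        change R⁻¹ * dist x z ≤ 1
        rw [inv_mul_le_iff₀ hR, mul_one]
        exact hx.2
      rw [this, one_smul]
    rw [setIntegral_congr_fun (Ω.isOpen.measurableSet.inter Metric.isClosed_closedBall.measurableSet)
      hone, setIntegral_const] at hsub
    have hm : volume ((Ω : Set (Euc d)) ∩ Metric.closedBall z R) = volume (Metric.closedBall z R) := by
      refine le_antisymm (measure_mono Set.inter_subset_right) ?_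
      have : Metric.closedBall z R ⊆ ((Ω : Set (Euc d)) ∩ Metric.closedBall z R) ∪
          ({x : Euc d | β < x j₁} \ Ω) := fun x hx => by
        by_cases hxΩ : x ∈ (Ω : Set (Euc d))
        · exact Or.inl ⟨hxΩ, hx⟩
        · exact Or.inr ⟨hpos x (Metric.closedBall_subset_closedBall (by linarith) hx), hxΩ⟩
      refine (measure_mono this).trans ((measure_union_le _ _).trans ?_)
      rw [hnull, add_zero]
    rw [Measure.real, hm, hvol R hR.le, smul_eq_mul] at hsub
    rw [e]
    exact hsub
  have hup : ∀ j, ‖(gradientPair Ω χ g).2 j‖ ^ 2 ≤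
      (R⁻¹ * M) ^ 2 * ‖χ‖ ^ 2 * ((R * 2) ^ d * v) := fun j => by
    have e : ‖(gradientPair Ω χ g).2 j‖ ^ 2 =
        ∫ x in Ω, ‖pderiv j (g : Euc d → ℝ) x • χ‖ ^ 2 := by
      rw [norm_sq_L2_eq_integral]
      refine integral_congr_ae ?_
      filter_upwards [g.2.coeFn_toL2_pderiv χ Ω j] with x hx
      exact congrArg (fun y => ‖y‖ ^ 2) hx
    have hconst : Integrable ((Metric.closedBall z (R * 2)).indicator
        fun _ : Euc d => (R⁻¹ * M) ^ 2 * ‖χ‖ ^ 2) volume :=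
      (integrable_indicator_iff Metric.isClosed_closedBall.measurableSet).2
        (integrableOn_const measure_closedBall_lt_top.ne)
    have hle : ∀ x, ‖pderiv j (g : Euc d → ℝ) x • χ‖ ^ 2 ≤
        (Metric.closedBall z (R * 2)).indicator
          (fun _ : Euc d => (R⁻¹ * M) ^ 2 * ‖χ‖ ^ 2) x := fun x => by
      by_cases hx : x ∈ Metric.closedBall z (R * 2)
      · rw [Set.indicator_of_mem hx, norm_smul, mul_pow]
        refine mul_le_mul_of_nonneg_right ?_ hχ2.le
        refine pow_le_pow_left₀ (norm_nonneg _) ?_ 2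
        rw [pderiv_scaledBump, norm_mul, Real.norm_of_nonneg (inv_pos.2 hR).le]
        exact mul_le_mul_of_nonneg_left (hM j _) (inv_pos.2 hR).le
      · have : pderiv j (g : Euc d → ℝ) x = 0 := by
          rw [pderiv, image_eq_zero_of_notMem_tsupport fun h' =>
            hx (hsupp (tsupport_fderiv_subset ℝ h'))]
          rfl
        rw [Set.indicator_of_notMem hx, this, zero_smul, norm_zero, zero_pow two_ne_zero]
    rw [e]
    refine (integral_mono_of_nonneg (Filter.Eventually.of_forall fun x => sq_nonneg _)
      hconst.integrableOn (Filter.Eventually.of_forall hle)).trans ?_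
    refine (setIntegral_le_integral hconst (Filter.Eventually.of_forall fun x =>
      Set.indicator_nonneg (fun _ _ => by positivity) x)).trans ?_
    rw [integral_indicator Metric.isClosed_closedBall.measurableSet, setIntegral_const,
      Measure.real, hvol _ (by positivity), smul_eq_mul, mul_comm]
  have hsum : ∑ j, ‖(gradientPair Ω χ g).2 j‖ ^ 2 ≤
      d * ((R⁻¹ * M) ^ 2 * ‖χ‖ ^ 2 * ((R * 2) ^ d * v)) := by
    refine (Finset.sum_le_sum fun j _ => hup j).trans ?_
    rw [Finset.sum_const, Finset.card_univ, Fintype.card_fin, nsmul_eq_mul]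
  have hchain : R ^ d * v * ‖χ‖ ^ 2 ≤
      |C| * (d * ((R⁻¹ * M) ^ 2 * ‖χ‖ ^ 2 * ((R * 2) ^ d * v))) :=
    hlow.trans (hineq.trans ((mul_le_mul_of_nonneg_right (le_abs_self C)
      (Finset.sum_nonneg fun j _ => sq_nonneg _)).trans
        (mul_le_mul_of_nonneg_left hsum (abs_nonneg C))))
  have hfactor : |C| * (d * ((R⁻¹ * M) ^ 2 * ‖χ‖ ^ 2 * ((R * 2) ^ d * v))) =
      (R⁻¹ ^ 2 * K) * (R ^ d * v * ‖χ‖ ^ 2) := by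
    simp only [K, mul_pow]
    ring
  rw [hfactor] at hchain
  have hpos' : 0 < R ^ d * v * ‖χ‖ ^ 2 := by positivity
  have h1 : 1 ≤ R⁻¹ ^ 2 * K := by
    by_contra hlt
    nlinarith [not_le.1 hlt]
  rw [inv_pow, inv_mul_eq_div, le_div_iff₀ (by positivity), one_mul] at h1
  have : R ^ 2 = K ^ 2 + 2 * K + 1 := by simp only [R]; ring
  nlinarith

/-- If `A = ∑ⱼ Bⱼ ∂ⱼ` on `H¹₀(Ω; V)` is bounded below, then `ker A*` is infinite-dimensional.
Otherwise every smooth `h χ` supported away from finitely many hyperplanes would be in `H¹₀(Ω; V)`,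
which forces `Ω` to contain a half space and contradicts boundedness below. At least two coordinates
are needed: in dimension one the kernel of the adjoint can be finite-dimensional. -/
theorem IsClifford.not_finiteDimensional_ker_adjoint [FiniteDimensional ℂ V] [Nontrivial V] {c : ℝ}
    {B : Fin d → V →L[ℂ] V} (hB : IsClifford c B) (hc : 0 < c) {j₀ j₁ : Fin d} (hj : j₀ ≠ j₁)
    (hΩ : (Ω : Set (Euc d)).Nonempty) {C : ℝ} (hC : 0 ≤ C)
    (hbound : ∀ u g, (u, g) ∈ firstOrderGraph Ω B → ‖u‖ ≤ C * ‖g‖) :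
    ¬ FiniteDimensional ℂ
      ((firstOrderGraph Ω B).adjoint.comap (LinearMap.inl ℂ (L2 Ω V) (L2 Ω V))) := by
  intro hfin
  have : CompleteSpace V := FiniteDimensional.complete ℂ V
  obtain ⟨χ, hχ⟩ := exists_ne (0 : V)
  have hex : ∀ j : Fin d, ∃ F : Set ℝ, F.Finite ∧ ∀ h : smoothCompact d,
      (∀ x ∈ tsupport (h : Euc d → ℝ), x j ∉ F) → gradientPair Ω χ h ∈ H10Graph Ω V := fun j => by
    obtain ⟨P, hP, hmem⟩ := hB.exists_polynomial_mul_mem hc hC hbound hfin χ j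
    refine ⟨Real.arctan ⁻¹' {t | P.IsRoot t}, (Polynomial.finite_setOfPred_isRoot hP).preimage
      Real.arctan_injective.injOn, fun h hh => ?_⟩
    obtain ⟨g, hg⟩ := exists_eq_eval_arctan_mul P j h hh
    exact hmem g h hg
  obtain ⟨F₀, hF₀, h₀⟩ := hex j₀
  obtain ⟨F₁, hF₁, h₁⟩ := hex j₁
  obtain ⟨β, hβ, hnull⟩ := exists_halfSpace_diff_null Ω hΩ hj hF₀ hF₁
    (fun h hh hx k => setIntegral_pderiv_eq_zero hχ (h₀ ⟨h, hh⟩ hx) k)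
    (fun h hh hx k => setIntegral_pderiv_eq_zero hχ (h₁ ⟨h, hh⟩ hx) k)
  refine not_poincare_of_halfSpace hnull hχ (C ^ 2 * c ^ 2) fun g hg => ?_
  have hmem := h₁ g fun x hx => hβ _ (hg x hx)
  have h1 := hbound _ _ (mem_firstOrderGraph.2 ⟨_, hmem, rfl⟩)
  have h2 := pow_le_pow_left₀ (norm_nonneg _) h1 2
  rw [mul_pow, hB.norm_symbol_sq hmem, ← mul_assoc] at h2
  exact h2

end InfiniteKernel

/-! ### Dirac operators as block operators -/

section Chiral

variable {d : ℕ} {V W : Type*} [NormedAddCommGroup V] [InnerProductSpace ℂ V]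
  [NormedAddCommGroup W] [InnerProductSpace ℂ W]

/-- A splitting `v ↦ (P v, Q v)` of the spinor space `W` into two copies of `V`, with inverse
`(v, w) ↦ J v + K w`, for which `αⱼ = [[0, Sⱼ*], [Sⱼ, 0]]` and `β = [[1, 0], [0, -1]]`; here `S' j` is
the adjoint of `S j`. -/
structure IsChiralSplitting (α : Fin d → W →L[ℂ] W) (β : W →L[ℂ] W) (S S' : Fin d → V →L[ℂ] V)
    (P Q : W →L[ℂ] V) (J K : V →L[ℂ] W) : Prop where
  fst_inl : P ∘L J = ContinuousLinearMap.id ℂ V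
  fst_inr : P ∘L K = 0
  snd_inl : Q ∘L J = 0
  snd_inr : Q ∘L K = ContinuousLinearMap.id ℂ V
  inner_eq : ∀ v w, inner ℂ v w = inner ℂ (P v) (P w) + inner ℂ (Q v) (Q w)
  fst_alpha : ∀ j v, P (α j v) = S' j (Q v)
  snd_alpha : ∀ j v, Q (α j v) = S j (P v)
  fst_beta : P ∘L β = P
  snd_beta : Q ∘L β = -Q
  adjoint : ∀ j v w, inner ℂ (S' j v) w = inner ℂ v (S j w)

namespace IsChiralSplitting

variable {α : Fin d → W →L[ℂ] W} {β : W →L[ℂ] W} {S S' : Fin d → V →L[ℂ] V} {P Q : W →L[ℂ] V}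
  {J K : V →L[ℂ] W}

theorem ext_iff (h : IsChiralSplitting α β S S' P Q J K) {v w : W} :
    v = w ↔ P v = P w ∧ Q v = Q w := by
  refine ⟨fun e => ⟨congrArg P e, congrArg Q e⟩, fun ⟨h1, h2⟩ => sub_eq_zero.1 ?_⟩
  rw [← inner_self_eq_zero (𝕜 := ℂ), h.inner_eq, map_sub, map_sub, h1, h2]
  simp

theorem inl_add_inr (h : IsChiralSplitting α β S S' P Q J K) :
    J ∘L P + K ∘L Q = ContinuousLinearMap.id ℂ W := by
  ext v
  have h1 : ∀ v, P (J v) = v := fun v => congrArg (fun L => L v) h.fst_inl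
  have h2 : ∀ v, P (K v) = 0 := fun v => congrArg (fun L => L v) h.fst_inr
  have h3 : ∀ v, Q (J v) = 0 := fun v => congrArg (fun L => L v) h.snd_inl
  have h4 : ∀ v, Q (K v) = v := fun v => congrArg (fun L => L v) h.snd_inr
  change J (P v) + K (Q v) = v
  rw [h.ext_iff, map_add, map_add, h1, h2, h3, h4, add_zero, zero_add]
  exact ⟨rfl, rfl⟩

/-- The splitting `f ↦ (P f, Q f)` of `L²(Ω; W)`. -/
def splitEquiv (h : IsChiralSplitting α β S S' P Q J K) (Ω : Opens (Euc d)) :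
    L2 Ω W ≃L[ℂ] L2 Ω V × L2 Ω V :=
  ContinuousLinearEquiv.equivOfInverse
    ((P.compLpL 2 (volume.restrict (Ω : Set (Euc d)))).prod
      (Q.compLpL 2 (volume.restrict (Ω : Set (Euc d)))))
    ((J.compLpL 2 (volume.restrict (Ω : Set (Euc d)))).coprod
      (K.compLpL 2 (volume.restrict (Ω : Set (Euc d)))))
    (fun f => by
      change pointwise Ω J (pointwise Ω P f) + pointwise Ω K (pointwise Ω Q f) = f
      rw [pointwise_pointwise, pointwise_pointwise, ← pointwise_add, h.inl_add_inr, pointwise_id])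
    (fun f => by
      change (pointwise Ω P (pointwise Ω J f.1 + pointwise Ω K f.2),
        pointwise Ω Q (pointwise Ω J f.1 + pointwise Ω K f.2)) = f
      rw [map_add, map_add]
      simp only [pointwise_pointwise, h.fst_inl, h.fst_inr, h.snd_inl, h.snd_inr, pointwise_id,
        pointwise_zero, add_zero, zero_add])

variable {Ω : Opens (Euc d)}

theorem splitEquiv_apply (h : IsChiralSplitting α β S S' P Q J K) (f : L2 Ω W) :
    h.splitEquiv Ω f = (pointwise Ω P f, pointwise Ω Q f) := rfl

theorem inner_splitEquiv (h : IsChiralSplitting α β S S' P Q J K) (f g : L2 Ω W) :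
    inner ℂ f g = inner ℂ (h.splitEquiv Ω f).1 (h.splitEquiv Ω g).1 +
      inner ℂ (h.splitEquiv Ω f).2 (h.splitEquiv Ω g).2 := by
  rw [L2.inner_def, L2.inner_def, L2.inner_def, ← integral_add (L2.integrable_inner _ _)
    (L2.integrable_inner _ _)]
  refine integral_congr_ae ?_
  filter_upwards [coeFn_pointwise P f, coeFn_pointwise Q f, coeFn_pointwise P g,
    coeFn_pointwise Q g] with x h1 h2 h3 h4
  rw [h.inner_eq]
  simp only [splitEquiv_apply, h1, h2, h3, h4]

end IsChiralSplitting

/-- Applying a linear map to the equation `∑ⱼ αⱼ ∂ⱼ f = g`. -/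
theorem weakGraph_pointwise {Ω : Opens (Euc d)} {U X Y : Type*} [NormedAddCommGroup U]
    [NormedSpace ℂ U] [NormedAddCommGroup X] [NormedSpace ℂ X] [NormedAddCommGroup Y]
    [NormedSpace ℂ Y] [CompleteSpace X] [CompleteSpace Y] {A : Fin d → U →L[ℂ] X}
    {S : Fin d → W →L[ℂ] Y} {L : X →L[ℂ] Y} {M : U →L[ℂ] W} (h : ∀ j v, L (A j v) = S j (M v))
    {f : L2 Ω U} (φ : 𝓓(Ω, ℂ)) :
    L (∑ j, ∫ x in Ω, pderiv j φ x • A j (f x)) =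
      ∑ j, ∫ x in Ω, pderiv j φ x • S j (pointwise Ω M f x) := by
  rw [map_sum]
  refine Finset.sum_congr rfl fun j _ => ?_
  rw [← ContinuousLinearMap.integral_comp_comm _ (integrable_smul_clm Ω (memLp_pderiv Ω φ j) _ _)]
  refine integral_congr_ae ?_
  filter_upwards [coeFn_pointwise M f] with x hx
  rw [map_smul, h, hx]

theorem integral_smul_pointwise {Ω : Opens (Euc d)} {X Y : Type*} [NormedAddCommGroup X]
    [NormedSpace ℂ X] [NormedAddCommGroup Y] [NormedSpace ℂ Y] [CompleteSpace X] [CompleteSpace Y]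
    (L : X →L[ℂ] Y) (g : L2 Ω X) (φ : 𝓓(Ω, ℂ)) :
    L (∫ x in Ω, φ x • g x) = ∫ x in Ω, φ x • pointwise Ω L g x := by
  rw [← ContinuousLinearMap.integral_comp_comm _ (integrable_smul_of_memLp Ω (memLp_test Ω φ) _)]
  refine integral_congr_ae ?_
  filter_upwards [coeFn_pointwise L g] with x hx
  rw [map_smul, hx]

theorem weakGraph_unique {Ω : Opens (Euc d)} {X Y : Type*} [NormedAddCommGroup X]
    [NormedSpace ℂ X] [NormedAddCommGroup Y] [NormedSpace ℂ Y] [CompleteSpace Y]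
    {S : Fin d → X →L[ℂ] Y} {u : L2 Ω X} {g g' : L2 Ω Y} (h : (u, g) ∈ weakGraph Ω S)
    (h' : (u, g') ∈ weakGraph Ω S) : g = g' :=
  sub_eq_zero.1 (weakGraph_single Ω S ((u, g) - (u, g')) (sub_mem h h') (sub_self u))

/-- On `H¹₀` the maximal realization of `∑ⱼ Sⱼ ∂ⱼ` acts through the weak gradient. -/
theorem mem_weakGraph_of_H10Graph [CompleteSpace V] {Ω : Opens (Euc d)} (S : Fin d → V →L[ℂ] V)
    {u : L2 Ω V} {p : Fin d → L2 Ω V} (h : (u, p) ∈ H10Graph Ω V) :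
    (u, symbol Ω S p) ∈ weakGraph Ω S := by
  intro φ
  have e : ∀ j, ∫ x in Ω, pderiv j φ x • S j (u x) = -∫ x in Ω, φ x • pointwise Ω (S j) (p j) x :=
    fun j => by
      rw [← integral_smul_pointwise, ← map_neg, ← H10Graph_weak Ω h,
        ← ContinuousLinearMap.integral_comp_comm _
          (integrable_smul_of_memLp Ω (memLp_pderiv Ω φ j) _)]
      simp only [map_smul]
  simp only [e, Finset.sum_neg_distrib, symbol_apply]
  rw [← integral_finsetSum _ fun j _ => integrable_smul_of_memLp Ω (memLp_test Ω φ) _]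
  congr 1
  refine integral_congr_ae ?_
  filter_upwards [Lp.coeFn_finsetSum Finset.univ (fun j => pointwise Ω (S j) (p j))] with x hx
  rw [hx, Finset.sum_apply, Finset.smul_sum]

namespace IsChiralSplitting

variable {α : Fin d → W →L[ℂ] W} {β : W →L[ℂ] W} {S S' : Fin d → V →L[ℂ] V} {P Q : W →L[ℂ] V}
  {J K : V →L[ℂ] W} {Ω : Opens (Euc d)}

theorem mem_weakGraph_iff [CompleteSpace V] [CompleteSpace W]
    (h : IsChiralSplitting α β S S' P Q J K) {f F : L2 Ω W} :
    (f, F) ∈ weakGraph Ω α ↔ (pointwise Ω Q f, pointwise Ω P F) ∈ weakGraph Ω S' ∧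
      (pointwise Ω P f, pointwise Ω Q F) ∈ weakGraph Ω S := by
  have e1 := fun φ => weakGraph_pointwise h.fst_alpha (f := f) φ
  have e2 := fun φ => weakGraph_pointwise h.snd_alpha (f := f) φ
  constructor
  · intro hf
    constructor
    · intro φ
      have := congrArg P (hf φ)
      rwa [e1, map_neg, integral_smul_pointwise] at this
    · intro φ
      have := congrArg Q (hf φ)
      rwa [e2, map_neg, integral_smul_pointwise] at this
  · rintro ⟨h1, h2⟩ φ
    refine h.ext_iff.2 ⟨?_, ?_⟩
    · rw [e1, map_neg, integral_smul_pointwise]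
      exact h1 φ
    · rw [e2, map_neg, integral_smul_pointwise]
      exact h2 φ

/-- The coefficients of `-i c ∑ⱼ Sⱼ* ∂ⱼ`. -/
theorem isClifford_smul (c : ℝ) (hS' : IsClifford 1 S') :
    IsClifford c fun j => (-Complex.I * c : ℂ) • S' j := by
  intro j k v w
  have h := hS' j k v w
  simp only [smul_apply, inner_smul_left, inner_smul_right, map_mul, map_neg,
    Complex.conj_I, Complex.conj_ofReal, neg_neg]
  have e : ∀ z : ℂ, -Complex.I * c * (Complex.I * c * z) = (c : ℂ) ^ 2 * z := fun z => by
    linear_combination (-(c : ℂ) ^ 2 * z) * Complex.I_mul_I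
  rw [e, e, ← mul_add, h]
  split_ifs
  · push_cast; ring
  · ring

theorem mem_graph_diracExpr_iff [CompleteSpace W] {m c : ℝ} {D : Submodule ℂ (L2 Ω W)}
    {x y : L2 Ω W} : (x, y) ∈ ((diracExpr Ω α β m c).domRestrict D).graph ↔
      x ∈ D ∧ ∃ F, (x, F) ∈ weakGraph Ω α ∧
        ((m * c ^ 2 : ℝ) : ℂ) • pointwise Ω β x + (-Complex.I * (c : ℂ)) • F = y := by
  rw [LinearPMap.mem_graph_iff]
  constructor
  · rintro ⟨⟨x, hx⟩, rfl, rfl⟩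
    refine ⟨hx.1, weakOp Ω α ⟨x, hx.2⟩, ?_, rfl⟩
    rw [← weakOp_graph]
    exact LinearPMap.mem_graph (weakOp Ω α) ⟨x, hx.2⟩
  · rintro ⟨hD, F, hF, rfl⟩
    rw [← weakOp_graph] at hF
    obtain ⟨⟨x', hx'⟩, rfl, rfl⟩ := (LinearPMap.mem_graph_iff _).1 hF
    exact ⟨⟨x', hD, hx'⟩, rfl, rfl⟩

set_option maxHeartbeats 1000000 in
/-- With respect to the chiral splitting, the Dirac operator with zigzag boundary conditions is the
block operator `[[mc², A], [A*, -mc²]]` with `A = -i c ∑ⱼ Sⱼ* ∂ⱼ` on `H¹₀(Ω; V)`. -/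
theorem isBlockOperator [FiniteDimensional ℂ V] [CompleteSpace W]
    (h : IsChiralSplitting α β S S' P Q J K) (hS' : IsClifford 1 S') {m c : ℝ} (hc : 0 < c)
    {D : Submodule ℂ (L2 Ω W)} (hD : D = (weakOp Ω S).domain.comap (pointwise Ω P) ⊓
      (H10 Ω V).comap (pointwise Ω Q)) :
    IsBlockOperator (firstOrderGraph Ω fun j => (-Complex.I * c : ℂ) • S' j) (m * c ^ 2)
      (h.splitEquiv Ω) ((diracExpr Ω α β m c).domRestrict D) := by
  have : CompleteSpace V := FiniteDimensional.complete ℂ V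
  have hI : (-Complex.I * c : ℂ) ≠ 0 :=
    mul_ne_zero (neg_ne_zero.2 Complex.I_ne_zero) (Complex.ofReal_ne_zero.2 hc.ne')
  have hB := isClifford_smul c hS'
  have hadj : ∀ j v w, inner ℂ (((-Complex.I * c : ℂ) • S' j) v) w =
      Complex.I * c * inner ℂ v (S j w) := fun j v w => by
    rw [smul_apply, inner_smul_left, h.adjoint]
    simp
  have hsym : ∀ p, symbol Ω (fun j => (-Complex.I * c : ℂ) • S' j) p =
      (-Complex.I * c : ℂ) • symbol Ω S' p := fun p => by
    simp only [symbol_apply, pointwise_smul, Finset.smul_sum]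
  have hβ₁ : ∀ f : L2 Ω W, pointwise Ω P (pointwise Ω β f) = pointwise Ω P f := fun f => by
    rw [pointwise_pointwise, h.fst_beta]
  have hβ₂ : ∀ f : L2 Ω W, pointwise Ω Q (pointwise Ω β f) = -pointwise Ω Q f := fun f => by
    rw [pointwise_pointwise, h.snd_beta, ← neg_one_smul ℂ Q, pointwise_smul, neg_one_smul]
  refine ⟨hB.isClosed_firstOrderGraph hc, fun g => firstOrderGraph_single,
    dense_firstOrderGraph_fst, h.inner_splitEquiv, fun x y => ?_⟩
  rw [mem_graph_diracExpr_iff, hD]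
  simp only [splitEquiv_apply]
  constructor
  · rintro ⟨⟨-, hx⟩, F, hF, rfl⟩
    obtain ⟨⟨_, p⟩, hp, rfl : _ = pointwise Ω Q x⟩ := hx
    obtain ⟨h1, h2⟩ := h.mem_weakGraph_iff.1 hF
    have hPF : pointwise Ω P F = symbol Ω S' p :=
      weakGraph_unique h1 (mem_weakGraph_of_H10Graph S' hp)
    have hΓ : (pointwise Ω Q x, (-Complex.I * c : ℂ) • pointwise Ω P F) ∈
        firstOrderGraph Ω fun j => (-Complex.I * c : ℂ) • S' j :=
      mem_firstOrderGraph.2 ⟨p, hp, by rw [hsym, hPF]⟩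
    refine ⟨_, _, hΓ, (mem_adjoint_firstOrderGraph_iff hc.ne' hadj).2 h2, ?_⟩
    simp only [map_add, map_smul, hβ₁, hβ₂]
    rw [smul_neg, neg_add_eq_sub]
  · rintro ⟨g, k, hg, hk, hy⟩
    obtain ⟨p, hp, rfl⟩ := mem_firstOrderGraph.1 hg
    have hkk : (-Complex.I * c : ℂ) • (-Complex.I * c : ℂ)⁻¹ • k = k := smul_inv_smul₀ hI k
    have hk' : (pointwise Ω P x, (-Complex.I * c : ℂ)⁻¹ • k) ∈ weakGraph Ω S := by
      refine (mem_adjoint_firstOrderGraph_iff hc.ne' hadj).1 ?_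
      rw [hkk]
      exact hk
    obtain ⟨F, hF⟩ := (h.splitEquiv Ω).surjective (symbol Ω S' p, (-Complex.I * c : ℂ)⁻¹ • k)
    obtain ⟨hF₁, hF₂⟩ := Prod.mk.inj ((h.splitEquiv_apply F).symm.trans hF)
    refine ⟨⟨⟨_, hk', rfl⟩, ⟨_, hp, rfl⟩⟩, F, h.mem_weakGraph_iff.2 ⟨?_, ?_⟩,
      (h.splitEquiv Ω).injective ?_⟩
    · rw [hF₁]
      exact mem_weakGraph_of_H10Graph S' hp
    · rw [hF₂]
      exact hk'
    · rw [splitEquiv_apply, splitEquiv_apply, hy]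
      simp only [map_add, map_smul, hβ₁, hβ₂, hF₁, hF₂, hsym]
      rw [hkk, smul_neg, neg_add_eq_sub]

end IsChiralSplitting

end Chiral

section SpectralProperties

variable {d : ℕ} {V W ι : Type} [NormedAddCommGroup V] [InnerProductSpace ℂ V]
  [FiniteDimensional ℂ V] [Nontrivial V] [NormedAddCommGroup W] [InnerProductSpace ℂ W]
  [CompleteSpace W] [Fintype ι] [Nonempty ι]
  {α : Fin d → W →L[ℂ] W} {β : W →L[ℂ] W} {S S' : Fin d → V →L[ℂ] V} {P Q : W →L[ℂ] V}
  {J K : V →L[ℂ] W} {Ω : Opens (Euc d)}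

/-- The spectral properties of Dirac operators with zigzag boundary conditions, for general Dirac
matrices. -/
theorem IsChiralSplitting.spectral_properties (h : IsChiralSplitting α β S S' P Q J K)
    (hS' : IsClifford 1 S') (b : OrthonormalBasis ι ℂ V) {j₀ j₁ : Fin d} (hj : j₀ ≠ j₁)
    (hΩ : (Ω : Set (Euc d)).Nonempty) {m c : ℝ} (hm : 0 ≤ m) (hc : 0 < c)
    {A : Submodule ℂ (L2 Ω W)} (hA : A = (weakOp Ω S).domain.comap (pointwise Ω P) ⊓
      (H10 Ω V).comap (pointwise Ω Q)) {T : L2 Ω W →ₗ.[ℂ] L2 Ω W}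
    (hT : T = (diracExpr Ω α β m c).domRestrict A) :
    IsSelfAdjoint T ∧
      spectrum T = {((m * c ^ 2 : ℝ) : ℂ)} ∪ {z | ∃ l : ℝ,
        (l : ℂ) ∈ spectrum (dirichletLaplacian Ω) ∧
        (z = ((c * √(l + (m * c) ^ 2) : ℝ) : ℂ) ∨ z = ((-(c * √(l + (m * c) ^ 2)) : ℝ) : ℂ))} ∧
      ((m * c ^ 2 : ℝ) : ℂ) ∈ essentialSpectrum T ∧
      (m ≠ 0 → ((-(m * c ^ 2) : ℝ) : ℂ) ∉ pointSpectrum T) ∧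
      ∀ l : ℝ, 0 < l → ∀ E : ℝ, (E = c * √(l + (m * c) ^ 2) ∨ E = -(c * √(l + (m * c) ^ 2))) →
        ((E : ℂ) ∈ pointSpectrum T ↔ (l : ℂ) ∈ pointSpectrum (dirichletLaplacian Ω)) ∧
        multiplicity T E = Fintype.card ι * multiplicity (dirichletLaplacian Ω) l := by
  have : CompleteSpace V := FiniteDimensional.complete ℂ V
  have hB := isClifford_smul c hS'
  subst hT
  exact (h.isBlockOperator hS' hc hA).spectral_properties hm hc
    (fun u => hB.eq_zero_of_mem_firstOrderGraph hc j₀)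
    (fun C hC hbound => hB.not_finiteDimensional_ker_adjoint hc hj hΩ hC hbound)
    (coordEquiv Ω b) (hB.mem_gramGraph_iff_dirichletLaplacian hc b)

end SpectralProperties

/-! ### The Dirac matrices in dimensions two and three -/

/-- The coefficients of `∂₁ - i ∂₂`. -/
def dbarAdjoint : Fin 2 → ℂ →L[ℂ] ℂ :=
  ![ContinuousLinearMap.id ℂ ℂ, -Complex.I • ContinuousLinearMap.id ℂ ℂ]

theorem isClifford_dbarAdjoint : IsClifford 1 dbarAdjoint := by
  intro j k v w
  fin_cases j <;> fin_cases k <;> simp [dbarAdjoint] <;> ring_nf <;> simp [Complex.I_sq]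

theorem isChiralSplitting_two : IsChiralSplitting (fun j : Fin 2 => mat (pauli j.castSucc))
    (mat (pauli 2)) dbar dbarAdjoint (EuclideanSpace.proj (0 : Fin 2))
    (EuclideanSpace.proj (1 : Fin 2))
    (ContinuousLinearMap.toSpanSingleton ℂ (EuclideanSpace.single (0 : Fin 2) (1 : ℂ)))
    (ContinuousLinearMap.toSpanSingleton ℂ (EuclideanSpace.single (1 : Fin 2) (1 : ℂ))) where
  fst_inl := by ext; simp
  fst_inr := by ext; simp
  snd_inl := by ext; simp
  snd_inr := by ext; simp
  inner_eq v w := by simp [PiLp.inner_apply]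
  fst_alpha j v := by fin_cases j <;> simp [mat_apply, pauli, dbarAdjoint]
  snd_alpha j v := by fin_cases j <;> simp [mat_apply, pauli, dbar]
  fst_beta := by ext v; simp [mat_apply, pauli]
  snd_beta := by ext v; simp [mat_apply, pauli]
  adjoint j v w := by fin_cases j <;> simp [dbar, dbarAdjoint] <;> ring

/-- The embedding of `ℂ²` as the first two components of `ℂ⁴`. -/
def ofUpper : C2 →L[ℂ] C4 :=
  LinearMap.toContinuousLinearMap
    { toFun := fun v => WithLp.toLp 2 (Sum.elim v 0)
      map_add' := fun _ _ => by ext (i | i) <;> simp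
      map_smul' := fun _ _ => by ext (i | i) <;> simp }

/-- The embedding of `ℂ²` as the last two components of `ℂ⁴`. -/
def ofLower : C2 →L[ℂ] C4 :=
  LinearMap.toContinuousLinearMap
    { toFun := fun v => WithLp.toLp 2 (Sum.elim 0 v)
      map_add' := fun _ _ => by ext (i | i) <;> simp
      map_smul' := fun _ _ => by ext (i | i) <;> simp }

theorem upper_apply (v : C4) (i : Fin 2) : upper v i = v (Sum.inl i) := rfl

theorem lower_apply (v : C4) (i : Fin 2) : lower v i = v (Sum.inr i) := rfl

theorem isClifford_pauli : IsClifford 1 fun j => mat (pauli j) := by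
  intro j k v w
  fin_cases j <;> fin_cases k <;>
    simp [PiLp.inner_apply, mat_apply, pauli, Fin.sum_univ_two] <;> ring_nf <;>
    simp [Complex.I_sq]

theorem isChiralSplitting_three : IsChiralSplitting (fun j : Fin 3 => mat (alphaMatrix j))
    (mat betaMatrix) (fun j => mat (pauli j)) (fun j => mat (pauli j)) upper lower ofUpper
    ofLower where
  fst_inl := by ext v i; rfl
  fst_inr := by ext v i; rfl
  snd_inl := by ext v i; rfl
  snd_inr := by ext v i; rfl
  inner_eq v w := by simp [PiLp.inner_apply, upper_apply, lower_apply]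
  fst_alpha j v := by
    ext i
    simp [upper_apply, lower_apply, mat_apply, alphaMatrix]
  snd_alpha j v := by
    ext i
    simp [upper_apply, lower_apply, mat_apply, alphaMatrix]
  fst_beta := by
    ext v i
    simp [upper_apply, mat_apply, betaMatrix, Matrix.one_apply]
  snd_beta := by
    ext v i
    simp [lower_apply, mat_apply, betaMatrix, Matrix.one_apply]
  adjoint j v w := by
    fin_cases j <;> simp [PiLp.inner_apply, mat_apply, pauli, Fin.sum_univ_two] <;> ring

end Zigzag

end

theorem theorem2p1 :
    (∀ (Ω : TopologicalSpace.Opens (Zigzag.Euc 2)) (m c : ℝ), (Ω : Set (Zigzag.Euc 2)).Nonempty → 0 ≤ m → 0 < c →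
      IsSelfAdjoint (Zigzag.dirac2 m c Ω) ∧
      Zigzag.spectrum (Zigzag.dirac2 m c Ω) =
        {((m * c ^ 2 : ℝ) : ℂ)} ∪
          {z | ∃ l : ℝ, (l : ℂ) ∈ Zigzag.spectrum (Zigzag.dirichletLaplacian Ω) ∧
            (z = ((c * √(l + (m * c) ^ 2) : ℝ) : ℂ) ∨
              z = ((-(c * √(l + (m * c) ^ 2)) : ℝ) : ℂ))} ∧
      ((m * c ^ 2 : ℝ) : ℂ) ∈ Zigzag.essentialSpectrum (Zigzag.dirac2 m c Ω) ∧
      (m ≠ 0 → ((-(m * c ^ 2) : ℝ) : ℂ) ∉ Zigzag.pointSpectrum (Zigzag.dirac2 m c Ω)) ∧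
      ∀ l : ℝ, 0 < l → ∀ E : ℝ, (E = c * √(l + (m * c) ^ 2) ∨ E = -(c * √(l + (m * c) ^ 2))) →
        ((E : ℂ) ∈ Zigzag.pointSpectrum (Zigzag.dirac2 m c Ω) ↔
          (l : ℂ) ∈ Zigzag.pointSpectrum (Zigzag.dirichletLaplacian Ω)) ∧
        ∀ k : ℕ∞, Zigzag.multiplicity (Zigzag.dirac2 m c Ω) E = k ↔
          Zigzag.multiplicity (Zigzag.dirichletLaplacian Ω) l = k) ∧
    (∀ (Ω : TopologicalSpace.Opens (Zigzag.Euc 3)) (m c : ℝ), (Ω : Set (Zigzag.Euc 3)).Nonempty → 0 ≤ m → 0 < c →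
      IsSelfAdjoint (Zigzag.dirac3 m c Ω) ∧
      Zigzag.spectrum (Zigzag.dirac3 m c Ω) =
        {((m * c ^ 2 : ℝ) : ℂ)} ∪
          {z | ∃ l : ℝ, (l : ℂ) ∈ Zigzag.spectrum (Zigzag.dirichletLaplacian Ω) ∧
            (z = ((c * √(l + (m * c) ^ 2) : ℝ) : ℂ) ∨
              z = ((-(c * √(l + (m * c) ^ 2)) : ℝ) : ℂ))} ∧
      ((m * c ^ 2 : ℝ) : ℂ) ∈ Zigzag.essentialSpectrum (Zigzag.dirac3 m c Ω) ∧
      (m ≠ 0 → ((-(m * c ^ 2) : ℝ) : ℂ) ∉ Zigzag.pointSpectrum (Zigzag.dirac3 m c Ω)) ∧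
      ∀ l : ℝ, 0 < l → ∀ E : ℝ, (E = c * √(l + (m * c) ^ 2) ∨ E = -(c * √(l + (m * c) ^ 2))) →
        ((E : ℂ) ∈ Zigzag.pointSpectrum (Zigzag.dirac3 m c Ω) ↔
          (l : ℂ) ∈ Zigzag.pointSpectrum (Zigzag.dirichletLaplacian Ω)) ∧
        ∀ k : ℕ∞, Zigzag.multiplicity (Zigzag.dirac3 m c Ω) E = 2 * k ↔
          Zigzag.multiplicity (Zigzag.dirichletLaplacian Ω) l = k) := by
  refine ⟨fun Ω m c hΩ hm hc => ?_, fun Ω m c hΩ hm hc => ?_⟩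
  · obtain ⟨h1, h2, h3, h4, h5⟩ := Zigzag.isChiralSplitting_two.spectral_properties
      Zigzag.isClifford_dbarAdjoint (OrthonormalBasis.singleton Unit ℂ)
      (zero_ne_one : (0 : Fin 2) ≠ 1) hΩ hm hc rfl (T := Zigzag.dirac2 m c Ω) rfl
    refine ⟨h1, h2, h3, h4, fun l hl E hE => ⟨(h5 l hl E hE).1, fun k => ?_⟩⟩
    rw [(h5 l hl E hE).2, Fintype.card_unit, Nat.cast_one, one_mul]
  · obtain ⟨h1, h2, h3, h4, h5⟩ := Zigzag.isChiralSplitting_three.spectral_properties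
      Zigzag.isClifford_pauli (EuclideanSpace.basisFun (Fin 2) ℂ)
      (by decide : (0 : Fin 3) ≠ 1) hΩ hm hc rfl (T := Zigzag.dirac3 m c Ω) rfl
    refine ⟨h1, h2, h3, h4, fun l hl E hE => ⟨(h5 l hl E hE).1, fun k => ?_⟩⟩
    rw [(h5 l hl E hE).2, Fintype.card_fin, Nat.cast_ofNat]
    exact (ENat.mul_right_strictMono two_ne_zero (by decide)).injective.eq_iff
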